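/- Let $G$ be a locally finite bipartite graph (vertices coloured black and white) embedded in the plane $\mathbb R^2$, with all faces bounded and homeomorphic to open discs, and invariant (with its colours) under the translations by $\mathbb Z^2$. **Train-tracks.** Let $G^T$ be the graph whose vertices are the (midpoints of) edges of $G$ and whose edges join the midpoints of two consecutive edges around a vertex $v$ of $G$; such an edge of $G^T$ is called a strand around $v$, and also a strand in the face of $G$ in which it lies. Orient strands counterclockwise around white vertices and clockwise around black vertices. A *train-track* is a maximal oriented path of strands which at every midpoint of an edge continues through the opposite side, that is, which turns alternately around white and black vertices. Let $\mathcal T$ be the set of these oriented train-tracks. Two train-tracks *intersect* if they cross at the midpoint of some edge. The graph $G$ is *minimal* if no train-track crosses itself and there is no pair of distinct train-tracks crossing at two distinct points $x,y$ and both oriented from $x$ to $y$. Assume that $G$ is minimal. **Cyclic orders.** Each train-track $t$ projects to an oriented closed curve on the torus $\mathbb R^2/\mathbb Z^2$, with homology class $\Pi(t)\in\mathbb Z^2$. Train-tracks are *parallel* (resp. *anti-parallel*) if their classes are equal (resp. opposite). The *global cyclic order* on $\mathcal T$ is the partial one in which $[t_1,t_2,t_3]$ holds if $\Pi(t_1),\Pi(t_2),\Pi(t_3)$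 have pairwise distinct directions, met in this counterclockwise cyclic order. For a vertex $v$, let $\mathcal T(v)$ be the set of strands around $v$; for a face $f$, let $\mathcal T^{\bullet}(f)$ and $\mathcal T^{\circ}(f)$ be the sets of strands in $f$ around its black, resp. white, boundary vertices. Each of these sets carries its counterclockwise (*local*) cyclic order around $v$, resp. around $f$. A map $\alpha$ from a set with a partial cyclic order to $\mathbb R/2\pi\mathbb Z$ is *monotone* if, whenever $t_1,\dots,t_n$ are cyclically ordered (i.e. $[t_i,t_j,t_k]$ for all $i<j<k$), the angles $\alpha(t_1),\dots,\alpha(t_n)$ are weakly cyclically ordered, i.e. have real lifts $\theta_1\le\dots\le\theta_n\le\theta_1+2\pi$. An angle map $\alpha:\mathcal T\to\mathbb R/2\pi\mathbb Z$ induces a map on strands, by assigning to a strand the angle of its train-track. **Spaces of angle maps.** Let * $X_G$ be the set of monotone maps $\alpha:\mathcal T\to\mathbb R/2\pi\mathbb Z$ (for the global cyclic order) mapping any two intersecting or anti-parallel train-tracks to distinct angles; * $Y_G$ be the set of maps $\alpha:\mathcal T\to\mathbb R/2\pi\mathbb Z$ whose restriction to $\mathcal T(v)$ is monotone, injective and non-constant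 for every vertex $v$, and whose restrictions to $\mathcal T^\bullet(f)$ and $\mathcal T^\circ(f)$ are monotone and non-constant for every face $f$; * $X'_G$ be the set of monotone maps $\alpha:\mathcal T\to\mathbb R/2\pi\mathbb Z$ (for the global cyclic order) mapping any two intersecting train-tracks to distinct angles. **Corollary.** For every $\mathbb Z^2$-periodic minimal bipartite graph $G$ as above, $X_G=X'_G$ and $Y_G=X'_G$. In particular the local cyclic orders on the sets $\mathcal T(v)$, $\mathcal T^\bullet(f)$, $\mathcal T^\circ(f)$ determine the global cyclic order on $\mathcal T$: for all $t_1,t_2,t_3\in\mathcal T$, one has $[t_1,t_2,t_3]$ if and only if $t_1,t_2,t_3$ are distinct and, for every $\alpha\in Y_G$, the angles $\alpha(t_1),\alpha(t_2),\alpha(t_3)$ are weakly cyclically ordered. -/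

import Mathlib

/-! Bipartite plane graphs are encoded by their rotation systems: the set `E` of edges together
with, for each colour, the permutation sending an edge to the next edge in counterclockwise order
around its endpoint of that colour. Vertices, faces and train-tracks are the cycles of suitable
permutations built from these two. -/

/-- The two colours of the vertices of a bipartite graph. -/
inductive VertexColor
  | white
  | black

/-- The other colour. -/
def VertexColor.other : VertexColor → VertexColor
  | .white => .black
  | .black => .white

/-- The cyclic order carried by each finite cycle of a permutation `p`:
`[x, y, z]` holds when `x, y, z` are distinct elements of one cycle, met in this order
when one starts at `x` and iterates `p`. Elements of different cycles are not related. -/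
def cycleOrder {S : Type*} (p : Equiv.Perm S) (x y z : S) : Prop :=
  ∃ i j : ℕ, 0 < i ∧ i < j ∧ j < Function.minimalPeriod p x ∧ p^[i] x = y ∧ p^[j] x = z

/-- A finite sequence of points of `ℝ/2πℤ` is (weakly) cyclically ordered if it is met in this
order, repetitions being allowed, when going counterclockwise at most once around the circle. -/
def CyclicallyOrdered {n : ℕ} (x : Fin n → Real.Angle) : Prop :=
  ∃ θ : Fin n → ℝ, Monotone θ ∧ (∀ i j, θ j ≤ θ i + 2 * Real.pi) ∧
    ∀ i, ((θ i : ℝ) : Real.Angle) = x i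

/-- Monotone maps from a partially cyclically ordered set to `ℝ/2πℤ`: finite cyclically ordered
families are mapped to weakly cyclically ordered families. -/
def CyclicMonotone {S : Type*} (R : S → S → S → Prop) (α : S → Real.Angle) : Prop :=
  ∀ (n : ℕ) (t : Fin n → S), (∀ i j k, i < j → j < k → R (t i) (t j) (t k)) →
    CyclicallyOrdered fun i => α (t i)

/-- The determinant of two vectors of `ℤ²`. -/
def latticeDet (u v : ℤ × ℤ) : ℤ := u.1 * v.2 - u.2 * v.1

/-- The strict counterclockwise cyclic order on directions of nonzero vectors of `ℤ²`.
The three consecutive oriented angles from `u` to `v`, `v` to `w` and `w` to `u` lie in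
`(0, 2π)` and add up to `2π` exactly when at least two of them lie in `(0, π)`. -/
def directionOrder (u v w : ℤ × ℤ) : Prop :=
  (0 < latticeDet u v ∧ 0 < latticeDet v w) ∨ (0 < latticeDet v w ∧ 0 < latticeDet w u) ∨
    (0 < latticeDet w u ∧ 0 < latticeDet u v)

/-- The cross product on `ℝ²`. -/
def planeCross (p q : ℝ × ℝ) : ℝ := p.1 * q.2 - p.2 * q.1

/-- A bipartite graph on an oriented surface, with set of edges `E`: `rot c e` is the next edge
after `e`, counterclockwise, around the endpoint of `e` of colour `c`. The vertices of colour `c`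
are the cycles of `rot c`. -/
structure BipartiteMap (E : Type*) where
  rot : VertexColor → Equiv.Perm E

namespace BipartiteMap

variable {E : Type*} (G : BipartiteMap E)

/-- The face permutation. Travelling along `e` from white to black, and then along
`(rot black)⁻¹ e` from black to white, with the face on the left, the next edge travelled from
white to black is `face e`. The faces are the cycles of this permutation: the cycle of `e` is the
face on the left of `e` oriented from white to black, its boundary being run counterclockwise; a
cycle of length `m` is a face of degree `2m`. -/
def face : Equiv.Perm E := (G.rot .white)⁻¹ * (G.rot .black)⁻¹

/-- Strands of oriented train-tracks are pairs `(e, c)`: the strand `(e, c)` starts at the midpoint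
of `e` and turns around the endpoint of `e` of colour `c`, counterclockwise if `c` is white and
clockwise if `c` is black, up to the midpoint of the consecutive edge. The strand that follows it on
its train-track starts at this edge and turns around the endpoint of the other colour. -/
def step : Equiv.Perm (E × VertexColor) where
  toFun
    | (e, .white) => (G.rot .white e, .black)
    | (e, .black) => ((G.rot .black).symm e, .white)
  invFun
    | (e, .white) => (G.rot .black e, .black)
    | (e, .black) => ((G.rot .white).symm e, .white)
  left_inv := by rintro ⟨e, _ | _⟩ <;> simp
  right_inv := by rintro ⟨e, _ | _⟩ <;> simp

/-- Consistently oriented train-tracks: maximal sequences of successive strands. -/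
def TrainTrack : Type _ := Quotient (Equiv.Perm.SameCycle.setoid G.step)

/-- The oriented train-track containing a given strand. An edge `e` is crossed by the two
train-tracks of the strands `(e, white)` and `(e, black)`. -/
def track (s : E × VertexColor) : G.TrainTrack := Quotient.mk _ s

/-- Two train-tracks intersect if they cross at some edge. -/
def Intersect (t₁ t₂ : G.TrainTrack) : Prop :=
  ∃ (e : E) (c : VertexColor), t₁ = G.track (e, c) ∧ t₂ = G.track (e, c.other)

/-- Some train-track crosses itself. -/
def HasSelfIntersection : Prop := ∃ e : E, G.track (e, .white) = G.track (e, .black)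

/-- Some pair of train-tracks cross at two distinct edges `x`, `y` and both are oriented from `x`
to `y`. -/
def HasParallelBigon : Prop :=
  ∃ (x y : E) (c : VertexColor) (m n : ℕ), x ≠ y ∧
    G.track (x, .white) ≠ G.track (x, .black) ∧
    G.step^[m] (x, .white) = (y, c) ∧ G.step^[n] (x, .black) = (y, c.other)

/-- Minimal graphs: no self-intersecting train-track and no parallel bigon. -/
def IsMinimal : Prop := ¬ G.HasSelfIntersection ∧ ¬ G.HasParallelBigon

/-- The word, in the free group on the edges (oriented from white to black), of the walk
`a 0, (b 0)⁻¹, a 1, (b 1)⁻¹, …, a (n - 1), (b (n - 1))⁻¹`. -/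
def walkWord (n : ℕ) (a b : ℕ → E) : FreeGroup E :=
  ((List.range n).map fun i => FreeGroup.of (a i) * (FreeGroup.of (b i))⁻¹).prod

/-- `a 0, (b 0)⁻¹, …, a (n - 1), (b (n - 1))⁻¹` is a closed walk of the graph. -/
def IsClosedWalk (n : ℕ) (a b : ℕ → E) : Prop :=
  a n = a 0 ∧ (∀ i < n, (G.rot .black).SameCycle (a i) (b i)) ∧
    ∀ i < n, (G.rot .white).SameCycle (b i) (a (i + 1))

/-- The words of the boundaries of faces, run once or several times. -/
def faceWords : Set (FreeGroup E) :=
  {w | ∃ (e : E) (n : ℕ), G.face^[n] e = e ∧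
    w = walkWord n (fun i => G.face^[i] e) (fun i => (G.rot .black)⁻¹ (G.face^[i] e))}

/-- The surface obtained by gluing a disc along the boundary of each face is simply connected:
closed walks are null-homotopic. -/
def SimplyConnected : Prop :=
  ∀ (n : ℕ) (a b : ℕ → E), G.IsClosedWalk n a b →
    walkWord n a b ∈ Subgroup.normalClosure G.faceWords

/-- The signed area of the polygon with the vertices of the face of `e` as vertices, in
counterclockwise order around the face, if the endpoint of colour `c` of each edge `e'` is placed at
the point `pos c e'` of the plane (shoelace formula). -/
noncomputable def faceArea (pos : VertexColor → E → ℝ × ℝ) (e : E) : ℝ :=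
  (∑ i ∈ Finset.range (Function.minimalPeriod G.face e),
    (planeCross (pos .white (G.face^[i] e)) (pos .black (G.face^[i] e)) +
      planeCross (pos .black (G.face^[i] e)) (pos .white (G.face^[i + 1] e)))) / 2

end BipartiteMap

/-- A `ℤ²`-periodic bipartite plane graph without unbounded faces, whose faces are topological discs.
Gluing discs to the faces yields a connected, simply connected, non-compact surface, that is, a
plane. The group `ℤ²` acts on it cellularly and freely, preserving its orientation and the colours,
with compact quotient; up to homeomorphism, this is the action of `ℤ²` on `ℝ²` by translations.
The last field says that this homeomorphism can be taken to preserve orientation: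
the vertices can be placed equivariantly in `ℝ²` in such a way that the signed areas of
the faces, bounded by straight segments, of one period add up to the area `1` of the torus `ℝ²/ℤ²`.
(The sum is over edges modulo `ℤ²`: a face whose boundary has `2m` edges is counted for `m` edges,
each time with weight `1/m`. It does not depend on the positions.) -/
structure PeriodicPlaneGraph (E : Type*) [AddAction (ℤ × ℤ) E] extends BipartiteMap E where
  nonempty : Nonempty E
  finite_degree : ∀ c e, e ∈ Function.periodicPts (rot c)
  finite_face_degree : ∀ e, e ∈ Function.periodicPts toBipartiteMap.face
  connected : ∀ e e' : E, ∃ g ∈ Subgroup.closure (Set.range rot), g e = e'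
  simplyConnected : toBipartiteMap.SimplyConnected
  equivariant : ∀ c (z : ℤ × ℤ) (e : E), rot c (z +ᵥ e) = z +ᵥ rot c e
  free : ∀ (z : ℤ × ℤ) (e : E), z +ᵥ e = e → z = 0
  finite_quotient : Finite (AddAction.orbitRel.Quotient (ℤ × ℤ) E)
  oriented : ∃ pos : VertexColor → E → ℝ × ℝ,
    (∀ c e, pos c (rot c e) = pos c e) ∧
    (∀ c (z : ℤ × ℤ) (e : E), pos c (z +ᵥ e) = pos c e + ((z.1 : ℝ), (z.2 : ℝ))) ∧
    ∑ᶠ o : AddAction.orbitRel.Quotient (ℤ × ℤ) E,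
      toBipartiteMap.faceArea pos (Quotient.out o) /
        (Function.minimalPeriod toBipartiteMap.face (Quotient.out o) : ℝ) = 1

namespace PeriodicPlaneGraph

variable {E : Type*} [AddAction (ℤ × ℤ) E] (G : PeriodicPlaneGraph E)

/-- The translate of a strand by a vector of `ℤ²`. -/
def translate (z : ℤ × ℤ) (s : E × VertexColor) : E × VertexColor := (z +ᵥ s.1, s.2)

theorem step_translate (z : ℤ × ℤ) (s : E × VertexColor) :
    G.step (translate z s) = translate z (G.step s) := by
  obtain ⟨e, _ | _⟩ := s
  · simp [translate, BipartiteMap.step, G.equivariant]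
  · simp only [translate, BipartiteMap.step, Equiv.coe_fn_mk, Prod.mk.injEq, and_true]
    rw [Equiv.symm_apply_eq, G.equivariant, Equiv.apply_symm_apply]

theorem iterate_step_translate (n : ℕ) (z : ℤ × ℤ) (s : E × VertexColor) :
    G.step^[n] (translate z s) = translate z (G.step^[n] s) := by
  induction n generalizing s with
  | zero => rfl
  | succ n ih => rw [Function.iterate_succ_apply, step_translate, ih, Function.iterate_succ_apply]

/-- Every train-track is mapped to itself by a translation along it. -/
theorem exists_period (s : E × VertexColor) :
    ∃ n : ℕ, 0 < n ∧ ∃ z : ℤ × ℤ, G.step^[n] s = translate z s := by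
  have := G.finite_quotient
  have : Finite VertexColor :=
    Finite.of_surjective (fun b : Bool => if b then VertexColor.white else VertexColor.black)
      (by rintro (_ | _); exacts [⟨true, rfl⟩, ⟨false, rfl⟩])
  let f : ℕ → AddAction.orbitRel.Quotient (ℤ × ℤ) E × VertexColor :=
    fun n => (Quotient.mk _ (G.step^[n] s).1, (G.step^[n] s).2)
  obtain ⟨i, j, hij, h⟩ : ∃ i j, i < j ∧ f i = f j := by
    obtain ⟨i, j, hne, h⟩ := Finite.exists_ne_map_eq_of_infinite f
    rcases lt_or_gt_of_ne hne with hlt | hlt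
    exacts [⟨i, j, hlt, h⟩, ⟨j, i, hlt, h.symm⟩]
  obtain ⟨h1, h2⟩ := Prod.mk.inj h
  obtain ⟨z, hz⟩ := AddAction.orbitRel_apply.1 (Quotient.exact h1.symm)
  refine ⟨j - i, Nat.sub_pos_of_lt hij, z, ?_⟩
  apply G.step.injective.iterate i
  rw [← Function.iterate_add_apply, Nat.add_sub_cancel' hij.le, iterate_step_translate]
  exact Prod.ext hz.symm h2.symm

open Classical in
/-- The number of strands in the closed curve of the torus onto which the train-track of `s`
projects. -/
noncomputable def strandPeriod (s : E × VertexColor) : ℕ := Nat.find (G.exists_period s)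

open Classical in
/-- The vector of `ℤ²` by which one is translated when following the train-track of `s` until its
projection to the torus closes up. -/
noncomputable def strandClass (s : E × VertexColor) : ℤ × ℤ :=
  (Nat.find_spec (G.exists_period s)).2.choose

/-- The homology class in `H₁(ℝ²/ℤ²; ℤ) = ℤ²` of the oriented closed curve of the torus onto which
an oriented train-track projects. -/
noncomputable def homologyClass (t : G.TrainTrack) : ℤ × ℤ := G.strandClass (Quotient.out t)

/-- The homology class may be computed from any strand of the train-track. -/
theorem homologyClass_track (s : E × VertexColor) :
    G.homologyClass (G.track s) = G.strandClass s := by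
  classical
  have key : ∀ s s' : E × VertexColor, G.step.SameCycle s s' → ∀ (n : ℕ) (z : ℤ × ℤ),
      G.step^[n] s = translate z s → G.step^[n] s' = translate z s' := by
    have one : ∀ (s : E × VertexColor) (k n : ℕ) (z : ℤ × ℤ),
        G.step^[n] s = translate z s ↔
          G.step^[n] (G.step^[k] s) = translate z (G.step^[k] s) := by
      intro s k n z
      rw [← Function.iterate_add_apply, Nat.add_comm, Function.iterate_add_apply,
        ← iterate_step_translate]
      exact (G.step.injective.iterate k).eq_iff.symm
    rintro s s' ⟨i, hi⟩ n z h
    obtain ⟨k, rfl | rfl⟩ := i.eq_nat_or_neg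
    · rw [zpow_natCast, ← Equiv.Perm.iterate_eq_pow] at hi
      exact hi ▸ (one s k n z).1 h
    · have hi' : G.step^[k] s' = s := by
        rw [Equiv.Perm.iterate_eq_pow, ← hi, zpow_neg, zpow_natCast, ← Equiv.Perm.mul_apply, mul_inv_cancel,
          Equiv.Perm.one_apply]
      rw [← hi'] at h
      exact (one s' k n z).2 h
  have hs : G.step.SameCycle (Quotient.out (G.track s)) s :=
    Quotient.exact (Quotient.out_eq (G.track s))
  set s' := Quotient.out (G.track s) with hs'
  have hp : G.strandPeriod s' = G.strandPeriod s := by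
    unfold strandPeriod
    apply Nat.find_congr'
    intro n
    exact ⟨fun ⟨h0, z, hz⟩ => ⟨h0, z, key _ _ hs _ _ hz⟩,
      fun ⟨h0, z, hz⟩ => ⟨h0, z, key _ _ hs.symm _ _ hz⟩⟩
  have h1 : G.step^[G.strandPeriod s'] s' = translate (G.strandClass s') s' :=
    (Nat.find_spec (G.exists_period s')).2.choose_spec
  have h2 : G.step^[G.strandPeriod s] s = translate (G.strandClass s) s :=
    (Nat.find_spec (G.exists_period s)).2.choose_spec
  have h3 := key _ _ hs _ _ h1
  rw [hp, h2] at h3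
  have h4 : G.strandClass s +ᵥ s.1 = G.strandClass s' +ᵥ s.1 := congrArg Prod.fst h3
  have h5 : (-G.strandClass s + G.strandClass s') +ᵥ s.1 = s.1 := by
    rw [add_vadd, ← h4, neg_vadd_vadd]
  have h6 := G.free _ _ h5
  exact (neg_add_eq_zero.1 h6).symm

/-- The global (partial) cyclic order on oriented train-tracks. -/
def globalOrder (t₁ t₂ t₃ : G.TrainTrack) : Prop :=
  directionOrder (G.homologyClass t₁) (G.homologyClass t₂) (G.homologyClass t₃)

/-- Anti-parallel train-tracks: opposite homology classes. -/
def AntiParallel (t₁ t₂ : G.TrainTrack) : Prop := G.homologyClass t₁ = -G.homologyClass t₂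

/-- The space `X_G`: monotone angle maps for the global cyclic order, mapping intersecting or
anti-parallel train-tracks to distinct angles. -/
def X : Set (G.TrainTrack → Real.Angle) :=
  {α | CyclicMonotone G.globalOrder α ∧
    ∀ t₁ t₂, G.Intersect t₁ t₂ ∨ G.AntiParallel t₁ t₂ → α t₁ ≠ α t₂}

/-- The space `X'_G`: monotone angle maps for the global cyclic order, mapping intersecting
train-tracks to distinct angles. -/
def X' : Set (G.TrainTrack → Real.Angle) :=
  {α | CyclicMonotone G.globalOrder α ∧ ∀ t₁ t₂, G.Intersect t₁ t₂ → α t₁ ≠ α t₂}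

/-- The space `Y_G`, defined by the local cyclic orders around vertices and faces.

The strands around the vertex of colour `c` incident to `e` are the `(e', c)` with `e'` in the cycle
of `e` under `rot c`, in the counterclockwise cyclic order of `e'`.
The strands in the face on the left of `e` that turn around a vertex of colour `c` are the `(e', c)`
with `e'` in the cycle of `e` under `face`, in the counterclockwise cyclic order of `e'`. -/
def Y : Set (G.TrainTrack → Real.Angle) :=
  {α | (∀ c, CyclicMonotone (cycleOrder (G.rot c)) (fun e => α (G.track (e, c))) ∧
        (∀ e e', (G.rot c).SameCycle e e' →
          α (G.track (e, c)) = α (G.track (e', c)) → e = e') ∧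
        ∀ e, ∃ e₁ e₂, (G.rot c).SameCycle e e₁ ∧ (G.rot c).SameCycle e e₂ ∧
          α (G.track (e₁, c)) ≠ α (G.track (e₂, c))) ∧
    ∀ c, CyclicMonotone (cycleOrder G.face) (fun e => α (G.track (e, c))) ∧
        ∀ e, ∃ e₁ e₂, G.face.SameCycle e e₁ ∧ G.face.SameCycle e e₂ ∧
          α (G.track (e₁, c)) ≠ α (G.track (e₂, c))}

end PeriodicPlaneGraph

/-! Choose a vector `z` that is parallel to no train-track and cut the circle of directions at `z`:
the global cyclic order becomes the cyclic order of the real numbers `key z t` (`globalOrder_iff`).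
The pivot of the proof is `IsLift`: a real lift of the angle map that increases strictly with the
key, by less than `2π`. A map with such a lift lies in `X` and in `Y` (`IsLift.mem_X`,
`IsLift.mem_Y`), so both equalities follow once every element of `X'` and every element of `Y` is
shown to have a lift.

Local and global orders are compared by counting descents, the edges whose two train-tracks are met
in the order black, `z`, white. By minimality the two train-tracks leaving an edge never meet again,
so they bound a sector, and the edge is a descent exactly when this sector contains the point at
infinity in direction `z` (`limitAt_sector`). The sectors at the edges of a vertex tile the
complement of that vertex, so each vertex has exactly one descent (`sum_descent_rot`). The sectors
at the `2d` edges of a face cover every vertex `d - 1` times, so the face has `d - 1` descents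
(`sum_descent_face`). Hence the keys turn exactly once around each vertex, and once around each face
for either colour; this gives `mem_Y`.

Conversely, for `α ∈ Y` the angles in `(0, 2π)` from the black to the white train-track at an edge
add up to `2π` at a vertex and to `2π(d - 1)` at a face. After subtracting `2π` at each descent all
these sums vanish, and simple connectivity yields a lift (`exists_crossing_lift`). For `α ∈ X'` the
lift is obtained by adding angles in the order of the keys. In both cases train-tracks with
different keys that do not cross have opposite directions, and are handled through train-tracks
crossing both of them (`exists_separating`).

The topological input is a calculus of potentials, functions on vertices with prescribed increments
along edges, and of their limits at infinity. A discrete area pairing gives Poincaré duality on the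
torus (`increment_eq`), from which the left side of a train-track is found to lie on the left of its
homology class (`limitAt_side`).

For the final assertion, parallel train-tracks can be moved independently within `Y`, which leaves
no cyclic relation valid for all `α ∈ Y` beyond the global ones. -/

/-! ### Sums over finite quotients and primitives on cycles -/

/-- The permutation `p` induces a permutation `φ` of the quotient, under which the sum of `T` over
the quotient is invariant. The number `m x` need not be a period of `p`: any positive number
constant along `p` and on the fibres will do, which allows the period of a train-track on the torus.
-/
theorem sum_average_of_invariant {S Q : Type*} [Fintype Q] (π : S → Q) (out : Q → S)
    (hout : ∀ q, π (out q) = q) (p : Equiv.Perm S)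
    (hp : ∀ x y, π x = π y → π (p x) = π (p y)) (T : S → ℝ)
    (hT : ∀ x y, π x = π y → T x = T y) (m : S → ℕ) (hm0 : ∀ x, 0 < m x)
    (hm : ∀ x y, π x = π y → m x = m y) (hmp : ∀ x, m (p x) = m x) :
    ∑ q, (∑ i ∈ Finset.range (m (out q)), T (p^[i] (out q))) / (m (out q) : ℝ)
      = ∑ q, T (out q) := by
  classical
  have hsurj : Function.Surjective fun q => π (p (out q)) := by
    intro q
    refine ⟨π (p.symm (out q)), ?_⟩
    have := hp (out (π (p.symm (out q)))) (p.symm (out q)) (hout _)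
    simpa [hout] using this
  let φ : Equiv.Perm Q := Equiv.ofBijective _ (Finite.injective_iff_bijective.1
    (Finite.injective_iff_surjective.2 hsurj))
  have hφ : ∀ i q, π (p^[i] (out q)) = (φ ^ i) q := by
    intro i q
    induction i with
    | zero => simp [hout]
    | succ i ih =>
      rw [Function.iterate_succ_apply', pow_succ', Equiv.Perm.mul_apply]
      exact hp _ _ (by rw [ih, hout])
  have hmi : ∀ i x, m (p^[i] x) = m x := by
    intro i x
    induction i with
    | zero => rfl
    | succ i ih => rw [Function.iterate_succ_apply', hmp, ih]
  have hmφ : ∀ i q, m (out ((φ ^ i) q)) = m (out q) := by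
    intro i q
    rw [hm _ (p^[i] (out q)) (by rw [hout, hφ]), hmi]
  have hTφ : ∀ i q, T (p^[i] (out q)) = T (out ((φ ^ i) q)) := fun i q =>
    hT _ _ (by rw [hout, hφ])
  set M := ∑ q, m (out q) with hM
  have hle : ∀ q, m (out q) ≤ M := fun q =>
    Finset.single_le_sum (f := fun q => m (out q)) (fun _ _ => Nat.zero_le _) (Finset.mem_univ q)
  -- Padding with zeros to the common length `M` makes it possible to exchange the two sums.
  have h1 : ∀ (q : Q) (F : ℕ → ℝ), ∑ i ∈ Finset.range (m (out q)), F i =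
      ∑ i ∈ Finset.range M, if i < m (out q) then F i else 0 := by
    intro q F
    rw [← Finset.sum_filter]
    apply Finset.sum_congr _ fun _ _ => rfl
    ext i
    simp only [Finset.mem_range, Finset.mem_filter]
    exact ⟨fun h => ⟨h.trans_le (hle q), h⟩, fun h => h.2⟩
  calc ∑ q, (∑ i ∈ Finset.range (m (out q)), T (p^[i] (out q))) / (m (out q) : ℝ)
      = ∑ q, ∑ i ∈ Finset.range M,
          if i < m (out q) then T (out ((φ ^ i) q)) / (m (out q) : ℝ) else 0 := by
        refine Finset.sum_congr rfl fun q _ => ?_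
        rw [Finset.sum_div, h1]
        simp_rw [hTφ]
    _ = ∑ i ∈ Finset.range M, ∑ q,
          if i < m (out q) then T (out ((φ ^ i) q)) / (m (out q) : ℝ) else 0 := Finset.sum_comm
    _ = ∑ i ∈ Finset.range M, ∑ q,
          if i < m (out q) then T (out q) / (m (out q) : ℝ) else 0 := by
        refine Finset.sum_congr rfl fun i _ => ?_
        rw [← Equiv.sum_comp (φ ^ i) fun q =>
          if i < m (out q) then T (out q) / (m (out q) : ℝ) else 0]
        simp_rw [hmφ]
    _ = ∑ q, ∑ i ∈ Finset.range M,
          if i < m (out q) then T (out q) / (m (out q) : ℝ) else 0 := Finset.sum_comm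
    _ = ∑ q, T (out q) := by
        refine Finset.sum_congr rfl fun q _ => ?_
        rw [← h1, Finset.sum_const, Finset.card_range, nsmul_eq_mul]
        have := hm0 (out q)
        field_simp

theorem exists_iterate_eq_of_sameCycle {S : Type*} {p : Equiv.Perm S}
    (hp : ∀ x, x ∈ Function.periodicPts p) {x y : S} (h : p.SameCycle x y) :
    ∃ n < Function.minimalPeriod p x, p^[n] x = y := by
  obtain ⟨i, rfl⟩ := h
  have hpos := Function.minimalPeriod_pos_of_mem_periodicPts (hp x)
  have hper : p^[Function.minimalPeriod p x] x = x := Function.iterate_minimalPeriod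
  set d := Function.minimalPeriod p x
  refine ⟨(i % d).toNat, ?_, ?_⟩
  · have := Int.emod_lt_of_pos i (show (0 : ℤ) < d by exact_mod_cast hpos)
    have := Int.emod_nonneg i (show (d : ℤ) ≠ 0 by exact_mod_cast hpos.ne')
    omega
  · rw [Equiv.Perm.iterate_eq_pow, ← zpow_natCast, Int.toNat_of_nonneg
      (Int.emod_nonneg i (show (d : ℤ) ≠ 0 by exact_mod_cast hpos.ne'))]
    conv_rhs => rw [← Int.emod_add_mul_ediv i d]
    rw [zpow_add, Equiv.Perm.mul_apply, zpow_mul, zpow_natCast]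
    congr 1
    rw [Equiv.Perm.iterate_eq_pow] at hper
    exact (Function.IsFixedPt.perm_zpow (e := p ^ d) hper (i / d)).symm

/-- In each cycle, `g` is summed from a chosen root; the vanishing of the total makes the definition
consistent when the cycle closes up. -/
theorem exists_cycle_primitive {S A : Type*} [AddCommGroup A] (p : Equiv.Perm S)
    (hp : ∀ x, x ∈ Function.periodicPts p) (g : S → A)
    (hg : ∀ x, ∑ i ∈ Finset.range (Function.minimalPeriod p x), g (p^[i] x) = 0) :
    ∃ U : S → A, ∀ x, U (p x) = U x + g x := by
  classical
  let r : S → S := fun x => Quotient.out (Quotient.mk (Equiv.Perm.SameCycle.setoid p) x)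
  have hr : ∀ x, p.SameCycle (r x) x := fun x =>
    Quotient.exact (Quotient.out_eq (Quotient.mk (Equiv.Perm.SameCycle.setoid p) x))
  have hrp : ∀ x, r (p x) = r x := fun x => by
    have : Quotient.mk (Equiv.Perm.SameCycle.setoid p) (p x) = Quotient.mk _ x :=
      Quotient.sound (Equiv.Perm.sameCycle_apply_left.2 (Equiv.Perm.SameCycle.refl p x))
    exact congrArg Quotient.out this
  choose n hn hnx using fun x => exists_iterate_eq_of_sameCycle hp (hr x)
  refine ⟨fun x => ∑ i ∈ Finset.range (n x), g (p^[i] (r x)), fun x => ?_⟩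
  have h1 : ∑ i ∈ Finset.range (n x), g (p^[i] (r x)) + g x =
      ∑ i ∈ Finset.range (n x + 1), g (p^[i] (r x)) := by
    rw [Finset.sum_range_succ, hnx]
  beta_reduce
  rw [h1, hrp]
  have h2 : p^[n (p x)] (r x) = p^[n x + 1] (r x) := by
    rw [Function.iterate_succ_apply', hnx, ← hrp, hnx]
  have h3 : n (p x) < Function.minimalPeriod p (r x) := by rw [← hrp]; exact hn _
  rcases Nat.lt_or_ge (n x + 1) (Function.minimalPeriod p (r x)) with h4 | h4
  · rw [Function.iterate_injOn_Iio_minimalPeriod h3 h4 h2]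
  · have h5 : n x + 1 = Function.minimalPeriod p (r x) := le_antisymm (hn x) h4
    rw [h5, hg]
    rw [h5, Function.iterate_minimalPeriod] at h2
    have h6 : n (p x) = 0 := Function.iterate_injOn_Iio_minimalPeriod h3
      (Set.mem_Iio.2 ((Nat.zero_le _).trans_lt h3)) h2
    rw [h6, Finset.sum_range_zero]

theorem sum_range_telescope_cycle {S A : Type*} [AddCommGroup A] {p : Equiv.Perm S} {U : S → A}
    (n : ℕ) (x : S) (h : p^[n] x = x) :
    ∑ i ∈ Finset.range n, (U (p^[i + 1] x) - U (p^[i] x)) = 0 := by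
  rw [Finset.sum_range_sub (fun i => U (p^[i] x)), h, Function.iterate_zero_apply, sub_self]

theorem sum_range_iterate_shift {S A : Type*} [AddCommGroup A] {p : Equiv.Perm S} (U : S → A)
    (n : ℕ) (x : S) (h : p^[n] x = x) :
    ∑ i ∈ Finset.range n, U (p^[i + 1] x) = ∑ i ∈ Finset.range n, U (p^[i] x) := by
  rw [← sub_eq_zero, ← Finset.sum_sub_distrib, sum_range_telescope_cycle n x h]

theorem minimalPeriod_perm_apply {S : Type*} (p : Equiv.Perm S) (x : S) :
    Function.minimalPeriod p (p x) = Function.minimalPeriod p x := by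
  by_cases hx : x ∈ Function.periodicPts p
  · exact Function.minimalPeriod_apply hx
  · have hpx : p x ∉ Function.periodicPts p := by
      rintro ⟨n, hn, h⟩
      refine hx ⟨n, hn, p.injective ?_⟩
      rw [← Function.iterate_succ_apply' p, Function.iterate_succ_apply]
      exact h
    rw [Function.minimalPeriod_eq_zero_of_notMem_periodicPts hx,
      Function.minimalPeriod_eq_zero_of_notMem_periodicPts hpx]

/-! ### Potentials of cocycles -/

namespace BipartiteMap

variable {E : Type*} (G : BipartiteMap E)

/-- `h c e` is the value at the endpoint of colour `c` of `e` of a function on vertices whose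
increment from black to white along each edge is given by `ω`. -/
structure IsPotential {A : Type*} [AddCommGroup A] (ω : E → A) (h : VertexColor → E → A) :
    Prop where
  rot : ∀ c e, h c (G.rot c e) = h c e
  sub : ∀ e, h .white e - h .black e = ω e

/-- The sum of a function of strands over the two strands starting at an edge. -/
def startSum {A : Type*} [Add A] (a : E × VertexColor → A) (e : E) : A :=
  a (e, .white) + a (e, .black)

theorem step_white (e : E) : G.step (e, .white) = (G.rot .white e, .black) := rfl

theorem step_black (e : E) : G.step (e, .black) = ((G.rot .black).symm e, .white) := rfl

theorem face_apply (e : E) : G.face e = (G.rot .white).symm ((G.rot .black).symm e) := rfl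

theorem rot_white_face (e : E) : G.rot .white (G.face e) = (G.rot .black).symm e := by
  simp [face_apply]

namespace IsPotential

variable {G} {A : Type*} [AddCommGroup A] {ω ω' : E → A} {h h' : VertexColor → E → A}

theorem white_eq (H : G.IsPotential ω h) (e : E) : h .white e = h .black e + ω e := by
  rw [← H.sub e]; abel

theorem black_eq (H : G.IsPotential ω h) (e : E) : h .black e = h .white e - ω e := by
  rw [← H.sub e]; abel

theorem rot_symm (H : G.IsPotential ω h) (c : VertexColor) (e : E) :
    h c ((G.rot c).symm e) = h c e := by
  rw [← H.rot, Equiv.apply_symm_apply]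

theorem iterate_rot (H : G.IsPotential ω h) (c : VertexColor) (e : E) (n : ℕ) :
    h c ((G.rot c)^[n] e) = h c e := by
  induction n with
  | zero => rfl
  | succ n ih => rw [Function.iterate_succ_apply', H.rot, ih]

theorem add (H : G.IsPotential ω h) (H' : G.IsPotential ω' h') :
    G.IsPotential (fun e => ω e + ω' e) (fun c e => h c e + h' c e) where
  rot c e := by rw [H.rot, H'.rot]
  sub e := by rw [← H.sub, ← H'.sub]; abel

theorem neg (H : G.IsPotential ω h) :
    G.IsPotential (fun e => -ω e) (fun c e => -h c e) where
  rot c e := by rw [H.rot]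
  sub e := by rw [← H.sub]; abel

theorem diff (H : G.IsPotential ω h) (H' : G.IsPotential ω' h') :
    G.IsPotential (fun e => ω e - ω' e) (fun c e => h c e - h' c e) where
  rot c e := by rw [H.rot, H'.rot]
  sub e := by rw [← H.sub, ← H'.sub]; abel

theorem zsmul (H : G.IsPotential ω h) (n : ℤ) :
    G.IsPotential (fun e => n • ω e) (fun c e => n • h c e) where
  rot c e := by rw [H.rot]
  sub e := by rw [← H.sub, smul_sub]

theorem add_const (H : G.IsPotential ω h) (k : A) :
    G.IsPotential ω (fun c e => h c e + k) where
  rot c e := by rw [H.rot]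
  sub e := by rw [← H.sub]; abel

theorem sum {ι : Type*} (s : Finset ι) {ω : ι → E → A} {h : ι → VertexColor → E → A}
    (H : ∀ i ∈ s, G.IsPotential (ω i) (h i)) :
    G.IsPotential (fun e => ∑ i ∈ s, ω i e) (fun c e => ∑ i ∈ s, h i c e) where
  rot c e := Finset.sum_congr rfl fun i hi => (H i hi).rot c e
  sub e := by
    rw [← Finset.sum_sub_distrib]
    exact Finset.sum_congr rfl fun i hi => (H i hi).sub e

theorem congr (H : G.IsPotential ω h) (hω : ∀ e, ω e = ω' e) : G.IsPotential ω' h where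
  rot := H.rot
  sub e := by rw [H.sub, hω]

end IsPotential

/-- The total increment of `ω` along the walk `a 0, (b 0)⁻¹, a 1, …`. -/
theorem lift_walkWord {A : Type*} [AddCommGroup A] (ω : E → A) (n : ℕ) (a b : ℕ → E) :
    FreeGroup.lift (fun e => Multiplicative.ofAdd (ω e)) (walkWord n a b) =
      Multiplicative.ofAdd (∑ i ∈ Finset.range n, (ω (a i) - ω (b i))) := by
  induction n with
  | zero => simp [walkWord]
  | succ n ih =>
    have : walkWord (n + 1) a b =
        walkWord n a b * (FreeGroup.of (a n) * (FreeGroup.of (b n))⁻¹) := by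
      simp [walkWord, List.range_succ]
    rw [this, map_mul, ih, Finset.sum_range_succ, ofAdd_add]
    simp [sub_eq_add_neg]

/-- There is a walk from the white end of `e` to the white end of `e'` along which the sum of the
increments of `ω` is `s`. -/
def HasWalk {A : Type*} [AddCommGroup A] (ω : E → A) (e e' : E) (s : A) : Prop :=
  ∃ (n : ℕ) (a b : ℕ → E), a 0 = e ∧ a n = e' ∧ (∀ i < n, (G.rot .black).SameCycle (a i) (b i)) ∧
    (∀ i < n, (G.rot .white).SameCycle (b i) (a (i + 1))) ∧
    ∑ i ∈ Finset.range n, (ω (a i) - ω (b i)) = s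

variable {G} {A : Type*} [AddCommGroup A] {ω : E → A}

theorem HasWalk.refl (e : E) : G.HasWalk ω e e 0 :=
  ⟨0, fun _ => e, fun _ => e, rfl, rfl, by simp, by simp, by simp⟩

theorem HasWalk.step {e e' b e'' : E} {s : A} (H : G.HasWalk ω e e' s)
    (h1 : (G.rot .black).SameCycle e' b) (h2 : (G.rot .white).SameCycle b e'') :
    G.HasWalk ω e e'' (s + (ω e' - ω b)) := by
  classical
  obtain ⟨n, a, b', h0, hn, hb, hw, hs⟩ := H
  have key : ∀ i ≤ n, Function.update a (n + 1) e'' i = a i := fun i hi =>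
    Function.update_of_ne (by omega) _ _
  have key' : ∀ i < n, Function.update b' n b i = b' i := fun i hi =>
    Function.update_of_ne (by omega) _ _
  refine ⟨n + 1, Function.update a (n + 1) e'', Function.update b' n b, ?_, ?_, ?_, ?_, ?_⟩
  · rw [key 0 (Nat.zero_le _), h0]
  · simp
  · intro i hi
    rcases Nat.lt_succ_iff_lt_or_eq.1 hi with h | rfl
    · rw [key i h.le, key' i h]; exact hb i h
    · rw [key i le_rfl, hn]; simpa using h1
  · intro i hi
    rcases Nat.lt_succ_iff_lt_or_eq.1 hi with h | rfl
    · rw [key (i + 1) h, key' i h]; exact hw i h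
    · simpa using h2
  · rw [Finset.sum_range_succ, ← hs, key n le_rfl, hn]
    congr 1
    · refine Finset.sum_congr rfl fun i hi => ?_
      rw [key i (Finset.mem_range.1 hi).le, key' i (Finset.mem_range.1 hi)]
    · simp

theorem HasWalk.trans {e e' e'' : E} {s s' : A} (H : G.HasWalk ω e e' s)
    (H' : G.HasWalk ω e' e'' s') : G.HasWalk ω e e'' (s + s') := by
  obtain ⟨n, a, b, h0, hn, hb, hw, rfl⟩ := H'
  suffices ∀ k ≤ n, G.HasWalk ω e (a k) (s + ∑ i ∈ Finset.range k, (ω (a i) - ω (b i))) by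
    simpa [hn] using this n le_rfl
  intro k hk
  induction k with
  | zero => simpa [h0] using H
  | succ k ih =>
    rw [Finset.sum_range_succ, ← add_assoc]
    exact (ih (by omega)).step (hb k hk) (hw k hk)

theorem HasWalk.rot_white (e : E) : G.HasWalk ω e (G.rot .white e) 0 := by
  simpa using (HasWalk.refl (G := G) (ω := ω) e).step (Equiv.Perm.SameCycle.refl _ e)
    (Equiv.Perm.sameCycle_apply_right.2 (Equiv.Perm.SameCycle.refl _ e))

theorem HasWalk.rot_black (e : E) : G.HasWalk ω e (G.rot .black e) (ω e - ω (G.rot .black e)) := by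
  simpa using (HasWalk.refl (G := G) (ω := ω) e).step
    (Equiv.Perm.sameCycle_apply_right.2 (Equiv.Perm.SameCycle.refl _ e))
    (Equiv.Perm.SameCycle.refl _ _)

theorem HasWalk.rot_symm (c : VertexColor) (e : E) :
    ∃ s, G.HasWalk ω e ((G.rot c).symm e) s := by
  cases c with
  | white => exact ⟨_, (HasWalk.refl (G := G) (ω := ω) e).step (Equiv.Perm.SameCycle.refl _ e)
      (Equiv.Perm.sameCycle_symm_apply_right.2 (Equiv.Perm.SameCycle.refl _ e))⟩
  | black => exact ⟨_, (HasWalk.refl (G := G) (ω := ω) e).step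
      (Equiv.Perm.sameCycle_symm_apply_right.2 (Equiv.Perm.SameCycle.refl _ e))
      (Equiv.Perm.SameCycle.refl _ _)⟩

end BipartiteMap

namespace PeriodicPlaneGraph

variable {E : Type*} [AddAction (ℤ × ℤ) E] (G : PeriodicPlaneGraph E)

theorem induction_on_edges {P : E → Prop} (e₀ : E) (h0 : P e₀)
    (h1 : ∀ c e, P e → P (G.rot c e)) (h2 : ∀ c e, P e → P ((G.rot c).symm e)) (e : E) : P e := by
  obtain ⟨g, hg, rfl⟩ := G.connected e₀ e
  -- The equivalence, rather than one implication, is what passes to inverses in the closure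
  -- induction.
  have : ∀ e, P e ↔ P (g e) := by
    induction hg using Subgroup.closure_induction with
    | mem x hx =>
      obtain ⟨c, rfl⟩ := hx
      exact fun e => ⟨h1 c e, fun h => by simpa using h2 c _ h⟩
    | one => simp
    | mul x y _ _ hx hy => exact fun e => (hy e).trans (hx _)
    | inv x _ hx => exact fun e => by rw [hx (x⁻¹ e)]; simp
  exact (this e₀).1 h0

theorem exists_hasWalk {A : Type*} [AddCommGroup A] (ω : E → A) (e e' : E) :
    ∃ s, G.HasWalk ω e e' s := by
  refine G.induction_on_edges (P := fun e' => ∃ s, G.HasWalk ω e e' s) e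
    ⟨0, BipartiteMap.HasWalk.refl e⟩ ?_ ?_ e'
  · rintro c e' ⟨s, h⟩
    cases c
    exacts [⟨_, h.trans (.rot_white e')⟩, ⟨_, h.trans (.rot_black e')⟩]
  · rintro c e' ⟨s, h⟩
    obtain ⟨s', h'⟩ := BipartiteMap.HasWalk.rot_symm (G := G.toBipartiteMap) (ω := ω) c e'
    exact ⟨_, h.trans h'⟩

/-- Two potentials of the same cocycle differ by a constant. -/
theorem potential_unique {A : Type*} [AddCommGroup A] {ω : E → A} {h h' : VertexColor → E → A}
    (H : G.IsPotential ω h) (H' : G.IsPotential ω h') (c c' : VertexColor) (e e' : E) :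
    h c e - h' c e = h c' e' - h' c' e' := by
  have hbw : ∀ e, h .white e - h' .white e = h .black e - h' .black e := fun e => by
    rw [H.white_eq, H'.white_eq]; abel
  have hc : ∀ c e, h c e - h' c e = h .white e - h' .white e := by
    rintro (_ | _) e
    exacts [rfl, (hbw e).symm]
  rw [hc c, hc c']
  refine G.induction_on_edges (P := fun e => h .white e - h' .white e = h .white e' - h' .white e')
    e' rfl ?_ ?_ e
  · intro c e he
    rw [← hc c, H.rot, H'.rot, hc, he]
  · intro c e he
    rw [← hc c, H.rot_symm, H'.rot_symm, hc, he]

/-- On a simply connected surface, a cocycle has a potential. -/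
theorem exists_potential {A : Type*} [AddCommGroup A] (ω U : E → A)
    (hω : ∀ e, ω e - ω ((G.rot .black).symm e) = U e - U (G.face e)) :
    ∃ h, G.IsPotential ω h := by
  have hclosed : ∀ e s, G.HasWalk ω e e s → s = 0 := by
    rintro e s ⟨n, a, b, h0, hn, hb, hw, rfl⟩
    have hmem := G.simplyConnected n a b ⟨hn.trans h0.symm, hb, hw⟩
    -- By `hω` the increments of `ω` around a face telescope, so the homomorphism defined by `ω`
    -- kills all face boundaries; by simple connectivity it kills all closed walks.
    have hle : Subgroup.normalClosure G.faceWords ≤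
        (FreeGroup.lift (fun e => Multiplicative.ofAdd (ω e))).ker := by
      refine Subgroup.normalClosure_le_normal ?_
      rintro w ⟨e, n, hn, rfl⟩
      rw [SetLike.mem_coe, MonoidHom.mem_ker, BipartiteMap.lift_walkWord]
      rw [← ofAdd_zero]
      congr 1
      have := sum_range_telescope_cycle (p := G.face) (U := fun x => -U x) n e hn
      rw [← this]
      refine Finset.sum_congr rfl fun i _ => ?_
      rw [Function.iterate_succ_apply']
      have := hω (G.face^[i] e)
      rw [Equiv.Perm.inv_def, this]
      abel
    have := hle hmem
    rw [MonoidHom.mem_ker, BipartiteMap.lift_walkWord, ← ofAdd_zero] at this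
    exact Multiplicative.ofAdd.injective this
  obtain ⟨e₀⟩ := G.nonempty
  have huniq : ∀ e s s', G.HasWalk ω e₀ e s → G.HasWalk ω e₀ e s' → s = s' := by
    intro e s s' h h'
    obtain ⟨r, hr⟩ := G.exists_hasWalk ω e e₀
    have h1 := hclosed _ _ (h.trans hr)
    have h2 := hclosed _ _ (h'.trans hr)
    exact add_right_cancel (h1.trans h2.symm)
  choose f hf using G.exists_hasWalk ω e₀
  -- The sign is reversed because a walk counts `+ω` from white to black, whereas a potential
  -- increases by `ω` from black to white.
  refine ⟨fun c e => match c with | .white => -f e | .black => -f e - ω e, ⟨?_, ?_⟩⟩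
  · rintro (_ | _) e
    · show -f _ = -f _
      rw [huniq _ _ _ (hf (G.rot .white e)) ((hf e).trans (.rot_white e)), add_zero]
    · show -f _ - _ = -f _ - _
      rw [huniq _ _ _ (hf (G.rot .black e)) ((hf e).trans (.rot_black e))]
      abel
  · intro e
    show -f e - (-f e - ω e) = ω e
    abel

/-- Conservation of a flow. Both strands starting at `e` lie in the face on the left of `e`, and `a`
records the flow where they cross `e`. By hypothesis what one gains inside the face the other loses,
so the flux through the boundary of each face vanishes. -/
theorem exists_potential_startSum {A : Type*} [AddCommGroup A] (a : E × VertexColor → A)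
    (ha : ∀ e, a (e, .white) + a (e, .black) =
      a (G.step (e, .white)) + a (G.step (e, .black))) :
    ∃ h, G.IsPotential (BipartiteMap.startSum a) h := by
  refine G.exists_potential _ (fun e => a (G.step (e, .white))) fun e => ?_
  simp only [BipartiteMap.startSum]
  rw [ha e, BipartiteMap.step_black, BipartiteMap.step_white G.toBipartiteMap (G.face e),
    BipartiteMap.rot_white_face]
  abel

end PeriodicPlaneGraph

/-! ### Translations and averages -/

namespace PeriodicPlaneGraph

variable {E : Type*} [AddAction (ℤ × ℤ) E] (G : PeriodicPlaneGraph E)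

theorem quotient_mk_eq_iff (x y : E) :
    (Quotient.mk _ x : AddAction.orbitRel.Quotient (ℤ × ℤ) E) = Quotient.mk _ y ↔
      ∃ z : ℤ × ℤ, x = z +ᵥ y :=
  ⟨fun h => let ⟨z, hz⟩ := AddAction.orbitRel_apply.1 (Quotient.exact h); ⟨z, hz.symm⟩,
    fun ⟨z, hz⟩ => Quotient.sound (AddAction.orbitRel_apply.2 ⟨z, hz.symm⟩)⟩

theorem rot_symm_vadd (c : VertexColor) (z : ℤ × ℤ) (e : E) :
    (G.rot c).symm (z +ᵥ e) = z +ᵥ (G.rot c).symm e := by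
  rw [Equiv.symm_apply_eq, G.equivariant, Equiv.apply_symm_apply]

theorem face_vadd (z : ℤ × ℤ) (e : E) : G.face (z +ᵥ e) = z +ᵥ G.face e := by
  rw [BipartiteMap.face_apply, BipartiteMap.face_apply, rot_symm_vadd, rot_symm_vadd]

theorem iterate_vadd {p : Equiv.Perm E} (hp : ∀ (z : ℤ × ℤ) e, p (z +ᵥ e) = z +ᵥ p e) (n : ℕ)
    (z : ℤ × ℤ) (e : E) : p^[n] (z +ᵥ e) = z +ᵥ p^[n] e := by
  induction n with
  | zero => rfl
  | succ n ih => rw [Function.iterate_succ_apply', ih, hp, Function.iterate_succ_apply']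

theorem vadd_left_injective (z : ℤ × ℤ) {e e' : E} (h : z +ᵥ e = z +ᵥ e') : e = e' := by
  rw [← neg_vadd_vadd z e, h, neg_vadd_vadd]

theorem vadd_right_injective (G : PeriodicPlaneGraph E) {z z' : ℤ × ℤ} {e : E}
    (h : z +ᵥ e = z' +ᵥ e) : z = z' := by
  have : (-z' + z) +ᵥ e = e := by rw [add_vadd, h, neg_vadd_vadd]
  exact (neg_add_eq_zero.1 (G.free _ _ this)).symm

theorem minimalPeriod_vadd {p : Equiv.Perm E} (hp : ∀ (z : ℤ × ℤ) e, p (z +ᵥ e) = z +ᵥ p e)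
    (z : ℤ × ℤ) (e : E) : Function.minimalPeriod p (z +ᵥ e) = Function.minimalPeriod p e := by
  rw [Function.minimalPeriod_eq_minimalPeriod_iff]
  intro n
  rw [Function.IsPeriodicPt, Function.IsFixedPt, iterate_vadd hp]
  exact ⟨fun h => vadd_left_injective z h, fun h => congrArg (z +ᵥ ·) h⟩

/-- A translation-invariant function of edges averages to its values along the cycles of `p`. -/
theorem sum_average_edges [Fintype (AddAction.orbitRel.Quotient (ℤ × ℤ) E)] {p : Equiv.Perm E}
    (hp : ∀ (z : ℤ × ℤ) e, p (z +ᵥ e) = z +ᵥ p e) (hper : ∀ e, e ∈ Function.periodicPts p)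
    (T : E → ℝ) (hT : ∀ (z : ℤ × ℤ) e, T (z +ᵥ e) = T e) :
    ∑ o : AddAction.orbitRel.Quotient (ℤ × ℤ) E,
      (∑ i ∈ Finset.range (Function.minimalPeriod p (Quotient.out o)),
        T (p^[i] (Quotient.out o))) / (Function.minimalPeriod p (Quotient.out o) : ℝ) =
      ∑ o : AddAction.orbitRel.Quotient (ℤ × ℤ) E, T (Quotient.out o) := by
  refine sum_average_of_invariant (fun e => Quotient.mk _ e) Quotient.out
    (fun q => Quotient.out_eq q) p ?_ T ?_ (fun e => Function.minimalPeriod p e)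
    (fun e => Function.minimalPeriod_pos_of_mem_periodicPts (hper e)) ?_
    (minimalPeriod_perm_apply p)
  all_goals
    intro x y hxy
    obtain ⟨z, rfl⟩ := (quotient_mk_eq_iff x y).1 hxy
  · exact (quotient_mk_eq_iff _ _).2 ⟨z, hp z y⟩
  · exact hT z y
  · exact minimalPeriod_vadd hp z y

theorem sum_eq_zero_of_cycle_sum_eq_zero [Fintype (AddAction.orbitRel.Quotient (ℤ × ℤ) E)]
    {p : Equiv.Perm E} (hp : ∀ (z : ℤ × ℤ) e, p (z +ᵥ e) = z +ᵥ p e)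
    (hper : ∀ e, e ∈ Function.periodicPts p)
    (T : E → ℝ) (hT : ∀ (z : ℤ × ℤ) e, T (z +ᵥ e) = T e)
    (h0 : ∀ e, ∑ i ∈ Finset.range (Function.minimalPeriod p e), T (p^[i] e) = 0) :
    ∑ o : AddAction.orbitRel.Quotient (ℤ × ℤ) E, T (Quotient.out o) = 0 := by
  rw [← sum_average_edges hp hper T hT]
  exact Finset.sum_eq_zero fun o _ => by rw [h0, zero_div]

theorem strandPeriod_pos (s : E × VertexColor) : 0 < G.strandPeriod s := by
  classical
  exact (Nat.find_spec (G.exists_period s)).1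

theorem iterate_strandPeriod (s : E × VertexColor) :
    G.step^[G.strandPeriod s] s = translate (G.strandClass s) s := by
  classical
  exact (Nat.find_spec (G.exists_period s)).2.choose_spec

theorem translate_injective (z : ℤ × ℤ) : Function.Injective (translate (E := E) z) := by
  rintro ⟨e, c⟩ ⟨e', c'⟩ h
  obtain ⟨h1, rfl⟩ := Prod.mk.inj h
  exact Prod.ext (vadd_left_injective z h1) rfl

theorem translate_translate (z z' : ℤ × ℤ) (s : E × VertexColor) :
    translate z (translate z' s) = translate (z + z') s :=
  Prod.ext (add_vadd z z' s.1).symm rfl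

theorem translate_zero (s : E × VertexColor) : translate 0 s = s :=
  Prod.ext (zero_vadd _ s.1) rfl

theorem translate_right_injective (G : PeriodicPlaneGraph E) {z z' : ℤ × ℤ}
    {s : E × VertexColor} (h : translate z s = translate z' s) : z = z' :=
  G.vadd_right_injective (congrArg Prod.fst h)

theorem iterate_eq_translate_step (n : ℕ) (z : ℤ × ℤ) (s : E × VertexColor) :
    G.step^[n] (G.step s) = translate z (G.step s) ↔ G.step^[n] s = translate z s := by
  rw [← Function.iterate_succ_apply, Function.iterate_succ_apply', ← step_translate]
  exact G.step.injective.eq_iff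

theorem iterate_eq_translate_translate (n : ℕ) (z z' : ℤ × ℤ) (s : E × VertexColor) :
    G.step^[n] (translate z' s) = translate z (translate z' s) ↔
      G.step^[n] s = translate z s := by
  rw [iterate_step_translate, translate_translate, add_comm, ← translate_translate]
  exact (translate_injective z').eq_iff

theorem strandPeriod_step (s : E × VertexColor) :
    G.strandPeriod (G.step s) = G.strandPeriod s := by
  classical
  exact Nat.find_congr' (by intro n; simp_rw [iterate_eq_translate_step])

theorem strandPeriod_translate (z : ℤ × ℤ) (s : E × VertexColor) :
    G.strandPeriod (translate z s) = G.strandPeriod s := by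
  classical
  exact Nat.find_congr' (by intro n; simp_rw [iterate_eq_translate_translate])

theorem strandClass_translate (z : ℤ × ℤ) (s : E × VertexColor) :
    G.strandClass (translate z s) = G.strandClass s := by
  have h := G.iterate_strandPeriod (translate z s)
  rw [strandPeriod_translate, iterate_eq_translate_translate, iterate_strandPeriod] at h
  exact (G.translate_right_injective h).symm

theorem iterate_mul_strandPeriod (s : E × VertexColor) (q : ℕ) :
    G.step^[q * G.strandPeriod s] s = translate (q • G.strandClass s) s := by
  induction q with
  | zero => simp [translate_zero]
  | succ q ih =>
    rw [Nat.succ_mul, Nat.add_comm, Function.iterate_add_apply, ih, iterate_step_translate,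
      iterate_strandPeriod, translate_translate, succ_nsmul]

instance instFintypeVertexColor : Fintype VertexColor where
  elems := Finset.cons .white {.black} (by simp)
  complete := by rintro (_ | _) <;> simp

theorem sum_vertexColor (f : VertexColor → ℝ) : ∑ c, f c = f .white + f .black := by
  show ∑ c ∈ Finset.cons VertexColor.white {.black} (by simp), f c = _
  rw [Finset.sum_cons, Finset.sum_singleton]

/-- A translation-invariant function of strands averages to its values along the train-tracks. -/
theorem sum_average_strands [Fintype (AddAction.orbitRel.Quotient (ℤ × ℤ) E)]
    (T : E × VertexColor → ℝ) (hT : ∀ z s, T (translate z s) = T s) :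
    ∑ q : AddAction.orbitRel.Quotient (ℤ × ℤ) E × VertexColor,
      (∑ i ∈ Finset.range (G.strandPeriod (Quotient.out q.1, q.2)),
        T (G.step^[i] (Quotient.out q.1, q.2))) / (G.strandPeriod (Quotient.out q.1, q.2) : ℝ) =
      ∑ q : AddAction.orbitRel.Quotient (ℤ × ℤ) E × VertexColor, T (Quotient.out q.1, q.2) := by
  have key : ∀ x y : E × VertexColor, ((Quotient.mk _ x.1, x.2) :
      AddAction.orbitRel.Quotient (ℤ × ℤ) E × VertexColor) = (Quotient.mk _ y.1, y.2) →
      ∃ z, x = translate z y := by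
    intro x y h
    obtain ⟨h1, h2⟩ := Prod.mk.inj h
    obtain ⟨z, hz⟩ := (quotient_mk_eq_iff x.1 y.1).1 h1
    exact ⟨z, Prod.ext hz h2⟩
  refine sum_average_of_invariant
    (fun s : E × VertexColor => ((Quotient.mk _ s.1, s.2) :
      AddAction.orbitRel.Quotient (ℤ × ℤ) E × VertexColor))
    (fun q => (Quotient.out q.1, q.2))
    (fun q => Prod.ext (Quotient.out_eq q.1) rfl) G.step ?_ T ?_ G.strandPeriod
    G.strandPeriod_pos ?_ G.strandPeriod_step
  all_goals
    intro x y hxy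
    obtain ⟨z, rfl⟩ := key x y hxy
  · rw [step_translate]
    exact Prod.ext ((quotient_mk_eq_iff _ _).2 ⟨z, rfl⟩) rfl
  · exact hT z y
  · exact G.strandPeriod_translate z y

/-! ### The area pairing -/

/-- Twice the contribution of two consecutive sides of a face to the shoelace formula. -/
def shoelace (f g : VertexColor → E → ℝ) (e : E) : ℝ :=
  (f .white e * g .black e - f .black e * g .white e) +
    (f .black e * g .white (G.face e) - f .white (G.face e) * g .black e)

/-- The sum over the faces of one period of twice the area in the coordinates `f`, `g`. -/
noncomputable def areaPairing [Fintype (AddAction.orbitRel.Quotient (ℤ × ℤ) E)]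
    (f g : VertexColor → E → ℝ) : ℝ :=
  ∑ o : AddAction.orbitRel.Quotient (ℤ × ℤ) E,
    (∑ i ∈ Finset.range (Function.minimalPeriod G.face (Quotient.out o)),
      G.shoelace f g (G.face^[i] (Quotient.out o))) /
      (Function.minimalPeriod G.face (Quotient.out o) : ℝ)

/-- The term in `U` telescopes around each face, and the invariant term may be summed once per edge
orbit instead of being averaged along faces. -/
theorem areaPairing_congr [Fintype (AddAction.orbitRel.Quotient (ℤ × ℤ) E)]
    {f g : VertexColor → E → ℝ} (T : E → ℝ) (hT : ∀ (z : ℤ × ℤ) e, T (z +ᵥ e) = T e) (U : E → ℝ)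
    (h : ∀ e, G.shoelace f g e = T e + (U (G.face e) - U e)) :
    G.areaPairing f g = ∑ o : AddAction.orbitRel.Quotient (ℤ × ℤ) E, T (Quotient.out o) := by
  rw [areaPairing, ← sum_average_edges G.face_vadd G.finite_face_degree T hT]
  refine Finset.sum_congr rfl fun o _ => ?_
  congr 1
  have := sum_range_telescope_cycle (p := G.face) (U := U) _ (Quotient.out o)
    (Function.iterate_minimalPeriod (f := G.face))
  rw [← add_zero (∑ i ∈ _, T _), ← this, ← Finset.sum_add_distrib]
  exact Finset.sum_congr rfl fun i _ => by rw [h, ← Function.iterate_succ_apply' G.face]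

/-- A periodic function is exact on the torus, so its area pairing vanishes. Regrouped by vertices,
the shoelace sum becomes the value of `D` at a vertex times the increments of `g` between its
successive neighbours; these telescope around the vertex. The functions `k₁` and `k₂` collect the
white and the black vertices. -/
theorem areaPairing_periodic [Fintype (AddAction.orbitRel.Quotient (ℤ × ℤ) E)]
    {D g : VertexColor → E → ℝ} (hD : ∀ c e, D c (G.rot c e) = D c e)
    (hg : ∀ c e, g c (G.rot c e) = g c e) (hDz : ∀ c (z : ℤ × ℤ) e, D c (z +ᵥ e) = D c e)
    (μ : ℤ × ℤ → ℝ) (hgz : ∀ c (z : ℤ × ℤ) e, g c (z +ᵥ e) = g c e + μ z) :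
    G.areaPairing D g = 0 := by
  have hsymm : ∀ c e, g c ((G.rot c).symm e) = g c e := fun c e => by
    rw [← hg, Equiv.apply_symm_apply]
  have hDrot : ∀ c e (i : ℕ), D c ((G.rot c)^[i] e) = D c e := fun c e i => by
    induction i with
    | zero => rfl
    | succ i ih => rw [Function.iterate_succ_apply', hD, ih]
  let k₁ : E → ℝ := fun e => D .white e * (g .black e - g .black (G.rot .white e))
  let k₂ : E → ℝ := fun e =>
    D .black (G.rot .black e) * (g .white e - g .white (G.rot .black e))
  have hk₂ : ∀ e, k₂ ((G.rot .black).symm e) =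
      D .black e * (g .white ((G.rot .black).symm e) - g .white e) := by
    intro e
    simp only [k₂, Equiv.apply_symm_apply]
  have hk₁z : ∀ (z : ℤ × ℤ) e, k₁ (z +ᵥ e) = k₁ e := by
    intro z e
    simp only [k₁, hDz, hgz, G.equivariant]
    ring
  have hk₂z : ∀ (z : ℤ × ℤ) e, k₂ (z +ᵥ e) = k₂ e := by
    intro z e
    simp only [k₂, hDz, hgz, G.equivariant]
    ring
  have h₁ : ∑ o : AddAction.orbitRel.Quotient (ℤ × ℤ) E, k₁ (Quotient.out o) = 0 := by
    refine sum_eq_zero_of_cycle_sum_eq_zero (G.equivariant .white) (G.finite_degree .white) k₁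
      hk₁z fun e => ?_
    have := sum_range_telescope_cycle (p := G.rot .white) (U := fun x => -(D .white e * g .black x))
      _ e (Function.iterate_minimalPeriod (f := G.rot .white))
    rw [← this]
    refine Finset.sum_congr rfl fun i _ => ?_
    simp only [k₁, hDrot, Function.iterate_succ_apply']
    ring
  have h₂ : ∑ o : AddAction.orbitRel.Quotient (ℤ × ℤ) E,
      k₂ ((G.rot .black).symm (Quotient.out o)) = 0 := by
    refine sum_eq_zero_of_cycle_sum_eq_zero (p := G.rot .black) (G.equivariant .black)
      (G.finite_degree .black) (fun e => k₂ ((G.rot .black).symm e))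
      (fun z e => by rw [rot_symm_vadd, hk₂z]) fun e => ?_
    have := sum_range_telescope_cycle (p := G.rot .black)
      (U := fun x => -(D .black e * g .white ((G.rot .black).symm x)))
      _ e (Function.iterate_minimalPeriod (f := G.rot .black))
    rw [← this]
    refine Finset.sum_congr rfl fun i _ => ?_
    simp only [hk₂, hDrot, Function.iterate_succ_apply', Equiv.symm_apply_apply]
    ring
  rw [G.areaPairing_congr (fun e => k₁ e + k₂ ((G.rot .black).symm e))
    (fun z e => by rw [rot_symm_vadd, hk₂z, hk₁z])
    (fun e => -(D .white e * g .black (G.rot .white e))), Finset.sum_add_distrib, h₁, h₂, add_zero]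
  intro e
  have h3 : g .white (G.face e) = g .white ((G.rot .black).symm e) := by
    rw [BipartiteMap.face_apply, hsymm]
  have h4 : g .black (G.rot .white (G.face e)) = g .black e := by
    rw [BipartiteMap.rot_white_face, hsymm]
  rw [hk₂, shoelace, h3, h4]
  simp only [k₁]
  ring

/-- Poincaré duality for a flow constant along train-tracks. The shoelace sum regroups into one term
per strand, the flow times the increment of `g .white + g .black` between its two edges. Along a
period of a train-track these increments add up to `2 * μ` of its class. -/
theorem areaPairing_potential [Fintype (AddAction.orbitRel.Quotient (ℤ × ℤ) E)]
    {a : E × VertexColor → ℝ} (ha : ∀ s, a (G.step s) = a s)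
    (haz : ∀ z s, a (translate z s) = a s) {h g : VertexColor → E → ℝ}
    (H : G.IsPotential (BipartiteMap.startSum a) h)
    (hg : ∀ c e, g c (G.rot c e) = g c e)
    (μ : ℤ × ℤ → ℝ) (hgz : ∀ c (z : ℤ × ℤ) e, g c (z +ᵥ e) = g c e + μ z) :
    G.areaPairing h g = -∑ q : AddAction.orbitRel.Quotient (ℤ × ℤ) E × VertexColor,
      a (Quotient.out q.1, q.2) * (2 * μ (G.strandClass (Quotient.out q.1, q.2))) /
        (G.strandPeriod (Quotient.out q.1, q.2) : ℝ) := by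
  have hsymm : ∀ c e, g c ((G.rot c).symm e) = g c e := fun c e => by
    rw [← hg, Equiv.apply_symm_apply]
  let m : E × VertexColor → ℝ := fun s => g .white s.1 + g .black s.1
  let T : E × VertexColor → ℝ := fun s => a s * (m (G.step s) - m s)
  have hmz : ∀ z s, m (translate z s) = m s + 2 * μ z := by
    intro z s
    simp only [m, translate, hgz]
    ring
  have hTz : ∀ z s, T (translate z s) = T s := by
    intro z s
    simp only [T, haz, step_translate, hmz]
    ring
  have hai : ∀ (i : ℕ) s, a (G.step^[i] s) = a s := by
    intro i s
    induction i with
    | zero => rfl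
    | succ i ih => rw [Function.iterate_succ_apply', ha, ih]
  have hrhs : ∑ q : AddAction.orbitRel.Quotient (ℤ × ℤ) E × VertexColor,
      a (Quotient.out q.1, q.2) * (2 * μ (G.strandClass (Quotient.out q.1, q.2))) /
        (G.strandPeriod (Quotient.out q.1, q.2) : ℝ) =
      ∑ q : AddAction.orbitRel.Quotient (ℤ × ℤ) E × VertexColor, T (Quotient.out q.1, q.2) := by
    rw [← G.sum_average_strands T hTz]
    refine Finset.sum_congr rfl fun q _ => ?_
    congr 1
    simp only [T, hai, ← Function.iterate_succ_apply' G.step]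
    rw [← Finset.mul_sum, Finset.sum_range_sub (fun i => m (G.step^[i] _)), iterate_strandPeriod,
      hmz, Function.iterate_zero_apply]
    ring
  rw [hrhs, Fintype.sum_prod_type]
  simp_rw [sum_vertexColor]
  rw [← Finset.sum_neg_distrib]
  refine G.areaPairing_congr (fun e => -(T (e, .white) + T (e, .black)))
    (fun z e => by
      have h1 := hTz z (e, .white)
      have h2 := hTz z (e, .black)
      simp only [translate] at h1 h2
      rw [h1, h2])
    (fun e => h .white e * g .white e - a (e, .white) * m (G.step (e, .white))) fun e => ?_
  have e1 : g .white (G.face e) = g .white ((G.rot .black).symm e) := by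
    rw [BipartiteMap.face_apply, hsymm]
  have e2 : h .white (G.face e) = h .white ((G.rot .black).symm e) := by
    rw [BipartiteMap.face_apply, H.rot_symm]
  have e3 := H.white_eq ((G.rot .black).symm e)
  rw [H.rot_symm] at e3
  have e4 := H.white_eq e
  simp only [BipartiteMap.startSum] at e3 e4
  have e5 : a ((G.rot .black).symm e, .white) = a (e, .black) := ha (e, .black)
  have e6 : a ((G.rot .black).symm e, .black) = a (G.face e, .white) := by
    rw [← G.rot_white_face]; exact ha (G.face e, .white)
  rw [shoelace, e1, e2, e3, e4]
  simp only [T, m, BipartiteMap.step_black, BipartiteMap.step_white, BipartiteMap.rot_white_face,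
    hg, hsymm, e5, e6]
  ring

/-- The increments of a periodic cocycle of train-tracks under translations are given by the
intersection pairing with the homology classes of the train-tracks. -/
theorem increment_eq [Fintype (AddAction.orbitRel.Quotient (ℤ × ℤ) E)]
    {a : E × VertexColor → ℝ} (ha : ∀ s, a (G.step s) = a s)
    (haz : ∀ z s, a (translate z s) = a s) {h : VertexColor → E → ℝ}
    (H : G.IsPotential (BipartiteMap.startSum a) h)
    (l : ℤ × ℤ → ℝ) (hl : ∀ c (z : ℤ × ℤ) e, h c (z +ᵥ e) = h c e + l z) (z : ℤ × ℤ) :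
    l z = ∑ q : AddAction.orbitRel.Quotient (ℤ × ℤ) E × VertexColor,
      a (Quotient.out q.1, q.2) * (latticeDet (G.strandClass (Quotient.out q.1, q.2)) z : ℝ) /
        (G.strandPeriod (Quotient.out q.1, q.2) : ℝ) := by
  obtain ⟨e₀⟩ := G.nonempty
  have hladd : ∀ z z', l (z + z') = l z + l z' := by
    intro z z'
    have h1 := hl .white (z + z') e₀
    rw [add_vadd, hl, hl] at h1
    linarith
  let L : ℤ × ℤ →+ ℝ := AddMonoidHom.mk' l hladd
  have hlz : ∀ z, l z = z.1 * l (1, 0) + z.2 * l (0, 1) := by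
    intro z
    have h1 : z = z.1 • ((1, 0) : ℤ × ℤ) + z.2 • ((0, 1) : ℤ × ℤ) := by ext <;> simp
    calc l z = L z := rfl
      _ = L (z.1 • ((1, 0) : ℤ × ℤ) + z.2 • ((0, 1) : ℤ × ℤ)) := by rw [← h1]
      _ = _ := by
        rw [map_add, map_zsmul, map_zsmul, zsmul_eq_mul, zsmul_eq_mul]; rfl
  obtain ⟨pos, hpos, hposz, harea⟩ := G.oriented
  let X : VertexColor → E → ℝ := fun c e => (pos c e).1
  let Y : VertexColor → E → ℝ := fun c e => (pos c e).2
  have hX : ∀ c e, X c (G.rot c e) = X c e := fun c e => by simp only [X, hpos]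
  have hY : ∀ c e, Y c (G.rot c e) = Y c e := fun c e => by simp only [Y, hpos]
  have hXz : ∀ c (z : ℤ × ℤ) e, X c (z +ᵥ e) = X c e + (z.1 : ℝ) := fun c z e => by
    simp only [X, hposz, Prod.fst_add]
  have hYz : ∀ c (z : ℤ × ℤ) e, Y c (z +ᵥ e) = Y c e + (z.2 : ℝ) := fun c z e => by
    simp only [Y, hposz, Prod.snd_add]
  -- The torus has area `1` by `oriented`, and the pairing counts twice the area.
  have hXY : G.areaPairing X Y = 2 := by
    rw [finsum_eq_sum_of_fintype] at harea
    rw [areaPairing, ← mul_one (2 : ℝ), ← harea, Finset.mul_sum]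
    refine Finset.sum_congr rfl fun o _ => ?_
    rw [BipartiteMap.faceArea, ← mul_div_assoc, mul_div_cancel₀ _ (two_ne_zero)]
    congr 1
    refine Finset.sum_congr rfl fun i _ => ?_
    simp only [shoelace, planeCross, X, Y, Function.iterate_succ_apply']
    ring
  -- Subtracting the linear function with the same increments leaves a periodic function, invisible
  -- to the pairing. Pairing `h` with each coordinate then determines `l`.
  let D : VertexColor → E → ℝ := fun c e => h c e - l (1, 0) * X c e - l (0, 1) * Y c e
  have hDr : ∀ c e, D c (G.rot c e) = D c e := fun c e => by simp only [D, H.rot, hX, hY]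
  have hDz : ∀ c (z : ℤ × ℤ) e, D c (z +ᵥ e) = D c e := fun c z e => by
    simp only [D, hl, hXz, hYz]
    rw [hlz z]
    ring
  have hlin : ∀ g : VertexColor → E → ℝ, G.areaPairing h g =
      l (1, 0) * G.areaPairing X g + l (0, 1) * G.areaPairing Y g + G.areaPairing D g := by
    intro g
    simp only [areaPairing, Finset.mul_sum, ← Finset.sum_add_distrib]
    refine Finset.sum_congr rfl fun o _ => ?_
    rw [← mul_div_assoc, ← mul_div_assoc, ← add_div, ← add_div, Finset.mul_sum, Finset.mul_sum,
      ← Finset.sum_add_distrib, ← Finset.sum_add_distrib]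
    congr 1
    refine Finset.sum_congr rfl fun i _ => ?_
    simp only [shoelace, D]
    ring
  have hself : ∀ g : VertexColor → E → ℝ, G.areaPairing g g = 0 := by
    intro g
    refine Finset.sum_eq_zero fun o _ => ?_
    rw [Finset.sum_eq_zero, zero_div]
    intro i _
    rw [shoelace]
    ring
  have hYX : G.areaPairing Y X = -2 := by
    rw [← hXY, areaPairing, areaPairing, ← Finset.sum_neg_distrib]
    refine Finset.sum_congr rfl fun o _ => ?_
    rw [← neg_div, ← Finset.sum_neg_distrib]
    congr 1
    refine Finset.sum_congr rfl fun i _ => ?_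
    simp only [shoelace]
    ring
  have h1 := G.areaPairing_potential ha haz H hX (fun z => (z.1 : ℝ)) hXz
  have h2 := G.areaPairing_potential ha haz H hY (fun z => (z.2 : ℝ)) hYz
  rw [hlin, hself, hYX, G.areaPairing_periodic hDr hX hDz _ hXz] at h1
  rw [hlin, hself, hXY, G.areaPairing_periodic hDr hY hDz _ hYz] at h2
  have h3 : l (0, 1) = ∑ q : AddAction.orbitRel.Quotient (ℤ × ℤ) E × VertexColor,
      a (Quotient.out q.1, q.2) * ((G.strandClass (Quotient.out q.1, q.2)).1 : ℝ) /
        (G.strandPeriod (Quotient.out q.1, q.2) : ℝ) := by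
    have h4 : ∀ x y : ℝ, l (1, 0) * 0 + l (0, 1) * -2 + 0 = -(2 * x) → l (0, 1) = x := by
      intro x _ hx; linarith
    refine h4 _ 0 (h1.trans ?_)
    rw [Finset.mul_sum]
    congr 1
    exact Finset.sum_congr rfl fun q _ => by ring
  have h4 : l (1, 0) = -∑ q : AddAction.orbitRel.Quotient (ℤ × ℤ) E × VertexColor,
      a (Quotient.out q.1, q.2) * ((G.strandClass (Quotient.out q.1, q.2)).2 : ℝ) /
        (G.strandPeriod (Quotient.out q.1, q.2) : ℝ) := by
    have h5 : ∀ x : ℝ, l (1, 0) * 2 + l (0, 1) * 0 + 0 = -(2 * x) → l (1, 0) = -x := by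
      intro x hx; linarith
    refine h5 _ (h2.trans ?_)
    rw [Finset.mul_sum]
    congr 1
    exact Finset.sum_congr rfl fun q _ => by ring
  rw [hlz, h3, h4, mul_neg, Finset.mul_sum, Finset.mul_sum, ← Finset.sum_neg_distrib,
    ← Finset.sum_add_distrib]
  refine Finset.sum_congr rfl fun q _ => ?_
  simp only [latticeDet]
  push_cast
  ring

/-- The homology classes of all train-tracks of the torus add up to zero. -/
theorem sum_latticeDet_eq_zero [Fintype (AddAction.orbitRel.Quotient (ℤ × ℤ) E)] (z : ℤ × ℤ) :
    ∑ q : AddAction.orbitRel.Quotient (ℤ × ℤ) E × VertexColor,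
      (latticeDet (G.strandClass (Quotient.out q.1, q.2)) z : ℝ) /
        (G.strandPeriod (Quotient.out q.1, q.2) : ℝ) = 0 := by
  -- With unit flow on every strand each edge carries `2`; the potential `2` on white and `0` on
  -- black vertices is periodic, so all its increments vanish.
  have H : G.IsPotential (BipartiteMap.startSum fun _ : E × VertexColor => (1 : ℝ))
      (fun c _ => match c with | .white => 2 | .black => 0) :=
    ⟨fun c e => rfl, fun e => by simp [BipartiteMap.startSum]; norm_num⟩
  have := G.increment_eq (fun _ => rfl) (fun _ _ => rfl) H (fun _ => 0) (fun _ _ _ => by simp) z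
  simpa using this.symm

end PeriodicPlaneGraph

section

open Filter

/-! ### Lines and rays of train-tracks at large scale -/

theorem latticeDet_add_right (p u v : ℤ × ℤ) :
    latticeDet p (u + v) = latticeDet p u + latticeDet p v := by
  simp only [latticeDet, Prod.fst_add, Prod.snd_add]; ring

theorem latticeDet_swap (u v : ℤ × ℤ) : latticeDet u v = -latticeDet v u := by
  simp only [latticeDet]; ring

theorem latticeDet_self (u : ℤ × ℤ) : latticeDet u u = 0 := by
  simp only [latticeDet]; ring

theorem latticeDet_neg_right (u v : ℤ × ℤ) : latticeDet u (-v) = -latticeDet u v := by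
  simp only [latticeDet, Prod.fst_neg, Prod.snd_neg]; ring

theorem latticeDet_neg_left (u v : ℤ × ℤ) : latticeDet (-u) v = -latticeDet u v := by
  simp only [latticeDet, Prod.fst_neg, Prod.snd_neg]; ring

theorem latticeDet_sub_left (u v w : ℤ × ℤ) :
    latticeDet (u - v) w = latticeDet u w - latticeDet v w := by
  simp only [latticeDet, Prod.fst_sub, Prod.snd_sub]; ring

/-- The linear form `latticeDet p`. -/
def latticeDetHom (p : ℤ × ℤ) : ℤ × ℤ →+ ℤ :=
  AddMonoidHom.mk' (latticeDet p) (latticeDet_add_right p)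

theorem latticeDetHom_apply (p u : ℤ × ℤ) : latticeDetHom p u = latticeDet p u := rfl

/-- A set of vectors on which a linear form is bounded above does not meet the far part of a cone
on which the form is positive. -/
theorem eventually_not_mem_cone {P : ℤ × ℤ → Prop} (l : ℤ × ℤ →+ ℤ) (hP : ∃ C, ∀ u, P u → l u ≤ C)
    {z z' : ℤ × ℤ} (hz : 0 < l z) (hz' : 0 < l z') :
    ∀ᶠ k : ℕ in atTop, ∀ a b : ℕ, a + b = k → ¬ P (a • z + b • z') := by
  obtain ⟨C, hC⟩ := hP
  filter_upwards [eventually_gt_atTop C.toNat] with k hk a b hab h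
  have h1 := hC _ h
  rw [map_add, map_nsmul, map_nsmul, nsmul_eq_mul, nsmul_eq_mul] at h1
  have h2 : (a : ℤ) * 1 ≤ a * l z := mul_le_mul_of_nonneg_left hz (by positivity)
  have h3 : (b : ℤ) * 1 ≤ b * l z' := mul_le_mul_of_nonneg_left hz' (by positivity)
  have h4 : (a : ℤ) + b = k := by exact_mod_cast hab
  omega

theorem eventually_not_mem_ray {P : ℤ × ℤ → Prop} (l : ℤ × ℤ →+ ℤ) (hP : ∃ C, ∀ u, P u → l u ≤ C)
    {z : ℤ × ℤ} (hz : 0 < l z) : ∀ᶠ k : ℕ in atTop, ¬ P (k • z) := by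
  filter_upwards [eventually_not_mem_cone l hP hz hz] with k hk
  simpa using hk k 0 (by simp)

namespace PeriodicPlaneGraph

variable {E : Type*} [AddAction (ℤ × ℤ) E] (G : PeriodicPlaneGraph E)

theorem track_eq_iff (s s' : E × VertexColor) :
    G.track s' = G.track s ↔ (∃ n : ℕ, G.step^[n] s = s') ∨ ∃ n : ℕ, G.step^[n] s' = s := by
  constructor
  · intro h
    obtain ⟨i, hi⟩ : G.step.SameCycle s s' := Quotient.exact h.symm
    obtain ⟨k, rfl | rfl⟩ := i.eq_nat_or_neg
    · exact .inl ⟨k, by rw [Equiv.Perm.iterate_eq_pow, ← hi, zpow_natCast]⟩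
    · refine .inr ⟨k, ?_⟩
      rw [Equiv.Perm.iterate_eq_pow, ← hi, zpow_neg, zpow_natCast, ← Equiv.Perm.mul_apply,
        mul_inv_cancel, Equiv.Perm.one_apply]
  · rintro (⟨n, rfl⟩ | ⟨n, rfl⟩)
    · exact Quotient.sound (Equiv.Perm.SameCycle.symm ⟨n, by
        rw [Equiv.Perm.iterate_eq_pow, zpow_natCast]⟩)
    · exact Quotient.sound (⟨n, by
        rw [Equiv.Perm.iterate_eq_pow, zpow_natCast]⟩ : G.step.SameCycle s' _)

theorem track_iterate (n : ℕ) (s : E × VertexColor) : G.track (G.step^[n] s) = G.track s :=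
  (G.track_eq_iff _ _).2 (.inl ⟨n, rfl⟩)

theorem track_step (s : E × VertexColor) : G.track (G.step s) = G.track s := G.track_iterate 1 s

theorem strandClass_eq_of_track_eq {s s' : E × VertexColor} (h : G.track s = G.track s') :
    G.strandClass s = G.strandClass s' := by
  rw [← homologyClass_track, h, homologyClass_track]

/-- Modulo the period there are finitely many strands ahead of `s`, so the vectors `u` are finitely
many vectors plus nonnegative multiples of the class, on which `l` is nonpositive. -/
theorem exists_future_bound (s s' : E × VertexColor) (l : ℤ × ℤ →+ ℤ)
    (hl : l (G.strandClass s) ≤ 0) :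
    ∃ C, ∀ (m : ℕ) (u : ℤ × ℤ), G.step^[m] s = translate u s' → l u ≤ C := by
  classical
  let f : ℕ → ℤ × ℤ := fun r =>
    if h : ∃ u, G.step^[r] s = translate u s' then h.choose else 0
  have hf : ∀ r u, G.step^[r] s = translate u s' → f r = u := by
    intro r u h
    have hex : ∃ u, G.step^[r] s = translate u s' := ⟨u, h⟩
    have h1 : G.step^[r] s = translate (f r) s' := by
      simp only [f, dif_pos hex]
      exact hex.choose_spec
    exact G.translate_right_injective (h1.symm.trans h)
  refine ⟨∑ r ∈ Finset.range (G.strandPeriod s), |l (f r)|, fun m u h => ?_⟩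
  set N := G.strandPeriod s
  have hN : 0 < N := G.strandPeriod_pos s
  have h1 : G.step^[m % N] s = translate (u - (m / N) • G.strandClass s) s' := by
    apply translate_injective ((m / N) • G.strandClass s)
    rw [translate_translate, add_sub_cancel, ← h, ← iterate_step_translate,
      ← iterate_mul_strandPeriod, ← Function.iterate_add_apply]
    congr 1
    rw [mul_comm]
    exact Nat.mod_add_div m N
  have h2 := hf _ _ h1
  have h3 : |l (f (m % N))| ≤ ∑ r ∈ Finset.range N, |l (f r)| :=
    Finset.single_le_sum (f := fun r => |l (f r)|) (fun _ _ => abs_nonneg _)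
      (Finset.mem_range.2 (Nat.mod_lt _ hN))
  have h4 := (le_abs_self _).trans h3
  rw [h2, map_sub, map_nsmul, nsmul_eq_mul] at h4
  have h5 : ((m / N : ℕ) : ℤ) * l (G.strandClass s) ≤ 0 :=
    mul_nonpos_of_nonneg_of_nonpos (by positivity) hl
  linarith

theorem exists_past_bound (s s' : E × VertexColor) (l : ℤ × ℤ →+ ℤ)
    (hl : 0 ≤ l (G.strandClass s)) :
    ∃ C, ∀ (m : ℕ) (u : ℤ × ℤ), G.step^[m] (translate u s') = s → l u ≤ C := by
  by_cases hs : G.strandClass s' = G.strandClass s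
  · obtain ⟨C, hC⟩ := G.exists_future_bound s' s (-l) (by
      rw [hs, AddMonoidHom.neg_apply]; linarith)
    refine ⟨C, fun m u h => ?_⟩
    have := hC m (-u) (by
      apply translate_injective u
      rw [← iterate_step_translate, h, translate_translate, add_neg_cancel, translate_zero])
    simpa using this
  · refine ⟨0, fun m u h => absurd ?_ hs⟩
    rw [← G.strandClass_translate u s', ← h]
    exact (G.strandClass_eq_of_track_eq (G.track_iterate m _)).symm

open Classical in
/-- The indicator function of the strands of a train-track. -/
noncomputable def lineIndicator (t : G.TrainTrack) (s : E × VertexColor) : ℤ :=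
  if G.track s = t then 1 else 0

open Classical in
/-- The indicator function of the strands that follow a strand `s` on its train-track. -/
noncomputable def rayIndicator (s s' : E × VertexColor) : ℤ :=
  if ∃ n : ℕ, G.step^[n + 1] s = s' then 1 else 0

theorem lineIndicator_step (t : G.TrainTrack) (s : E × VertexColor) :
    G.lineIndicator t (G.step s) = G.lineIndicator t s := by
  rw [lineIndicator, track_step, lineIndicator]

theorem exists_line_bound (t : G.TrainTrack) (s' : E × VertexColor) (l : ℤ × ℤ →+ ℤ)
    (hl : l (G.homologyClass t) = 0) :
    ∃ C, ∀ u : ℤ × ℤ, G.lineIndicator t (translate u s') ≠ 0 → l u ≤ C := by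
  obtain ⟨s, rfl⟩ : ∃ s, G.track s = t := ⟨Quotient.out t, Quotient.out_eq t⟩
  rw [homologyClass_track] at hl
  obtain ⟨C₁, h₁⟩ := G.exists_future_bound s s' l hl.le
  obtain ⟨C₂, h₂⟩ := G.exists_past_bound s s' l hl.ge
  refine ⟨max C₁ C₂, fun u hu => ?_⟩
  have hu : G.track (translate u s') = G.track s := by
    by_contra h
    exact hu (if_neg h)
  rcases (G.track_eq_iff _ _).1 hu with ⟨n, hn⟩ | ⟨n, hn⟩
  · exact (h₁ n u hn).trans (le_max_left _ _)
  · exact (h₂ n u hn).trans (le_max_right _ _)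

theorem exists_ray_bound (s s' : E × VertexColor) (l : ℤ × ℤ →+ ℤ)
    (hl : l (G.strandClass s) ≤ 0) :
    ∃ C, ∀ u : ℤ × ℤ, G.rayIndicator s (translate u s') ≠ 0 → l u ≤ C := by
  obtain ⟨C, hC⟩ := G.exists_future_bound s s' l hl
  refine ⟨C, fun u hu => ?_⟩
  obtain ⟨n, hn⟩ : ∃ n : ℕ, G.step^[n + 1] s = translate u s' := by
    by_contra h
    exact hu (if_neg h)
  exact hC _ u hn

/-- The ray and the whole train-track differ only by the past of `s`, including `s`, and `l` is
bounded above there. -/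
theorem exists_ray_line_bound (s s' : E × VertexColor) (l : ℤ × ℤ →+ ℤ)
    (hl : 0 ≤ l (G.strandClass s)) :
    ∃ C, ∀ u : ℤ × ℤ, G.rayIndicator s (translate u s') ≠
      G.lineIndicator (G.track s) (translate u s') → l u ≤ C := by
  obtain ⟨C, hC⟩ := G.exists_past_bound s s' l hl
  refine ⟨C, fun u hu => ?_⟩
  have h1 : ¬ ∃ n : ℕ, G.step^[n + 1] s = translate u s' := by
    rintro ⟨n, hn⟩
    apply hu
    rw [rayIndicator, if_pos ⟨n, hn⟩, lineIndicator, if_pos]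
    rw [← hn, track_iterate]
  have h2 : G.track (translate u s') = G.track s := by
    by_contra h
    apply hu
    rw [rayIndicator, if_neg h1, lineIndicator, if_neg h]
  rcases (G.track_eq_iff _ _).1 h2 with ⟨n, hn⟩ | ⟨n, hn⟩
  -- The ray starts strictly after `s`, so `n = 0` belongs to the past.
  · rcases n with _ | n
    · exact hC 0 u hn.symm
    · exact absurd ⟨n, hn⟩ h1
  · exact hC n u hn

/-- The potential `h` is constant along a path that avoids the support of its cocycle. -/
theorem exists_finset_path (e e' : E) : ∃ F : Finset E, ∀ (ω : E → ℤ) (h : VertexColor → E → ℤ),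
    G.IsPotential ω h → (∀ g ∈ F, ω g = 0) → h .white e = h .white e' := by
  classical
  refine G.induction_on_edges (P := fun e' => ∃ F : Finset E, ∀ (ω : E → ℤ)
    (h : VertexColor → E → ℤ), G.IsPotential ω h → (∀ g ∈ F, ω g = 0) →
      h .white e = h .white e') e ⟨∅, fun _ _ _ _ => rfl⟩ ?_ ?_ e'
  · rintro c e' ⟨F, hF⟩
    refine ⟨insert e' (insert (G.rot c e') F), fun ω h H hω => ?_⟩
    rw [hF ω h H fun g hg => hω g (by simp [hg])]
    cases c with
    | white => rw [H.rot]
    | black => rw [H.white_eq, H.white_eq (G.rot .black e'), H.rot, hω e' (by simp),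
        hω _ (by simp)]
  · rintro c e' ⟨F, hF⟩
    refine ⟨insert e' (insert ((G.rot c).symm e') F), fun ω h H hω => ?_⟩
    rw [hF ω h H fun g hg => hω g (by simp [hg])]
    cases c with
    | white => rw [H.rot_symm]
    | black => rw [H.white_eq, H.white_eq ((G.rot .black).symm e'), H.rot_symm, hω e' (by simp),
        hω _ (by simp)]

/-! ### Limits of potentials at infinity -/

theorem isPotential_vadd {G : PeriodicPlaneGraph E} {ω : E → ℤ} {h : VertexColor → E → ℤ}
    (H : G.IsPotential ω h) (z : ℤ × ℤ) :
    G.IsPotential (fun e => ω (z +ᵥ e)) (fun c e => h c (z +ᵥ e)) where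
  rot c e := by rw [← G.equivariant, H.rot]
  sub e := H.sub _

/-- `v` is the limit of the function `h` at infinity in direction `z`. -/
def LimitAt (h : VertexColor → E → ℤ) (z : ℤ × ℤ) (v : ℤ) : Prop :=
  ∀ e, ∀ᶠ k : ℕ in atTop, h .white (k • z +ᵥ e) = v

theorem LimitAt.unique {h : VertexColor → E → ℤ} {z : ℤ × ℤ} {v v' : ℤ} (e : E)
    (H : LimitAt h z v) (H' : LimitAt h z v') : v = v' := by
  obtain ⟨k, h1, h2⟩ := ((H e).and (H' e)).exists
  exact h1.symm.trans h2

/-- Once the support of `ω` has been left behind, paths joining `k • z +ᵥ e` to `k • z +ᵥ e'` and to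
the next translate avoid it, so the potential no longer changes. -/
theorem exists_limitAt {ω : E → ℤ} {h : VertexColor → E → ℤ} (H : G.IsPotential ω h) {z : ℤ × ℤ}
    (hω : ∀ e, ∀ᶠ k : ℕ in atTop, ω (k • z +ᵥ e) = 0) : ∃ v, LimitAt h z v := by
  obtain ⟨e₀⟩ := G.nonempty
  have key : ∀ e e', ∀ᶠ k : ℕ in atTop, h .white (k • z +ᵥ e) = h .white (k • z +ᵥ e') := by
    intro e e'
    obtain ⟨F, hF⟩ := G.exists_finset_path e e'
    have : ∀ᶠ k : ℕ in atTop, ∀ g ∈ F, ω (k • z +ᵥ g) = 0 :=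
      (eventually_all_finset F).2 fun g _ => hω g
    filter_upwards [this] with k hk
    exact hF _ _ (isPotential_vadd H (k • z)) hk
  obtain ⟨k₀, hk₀⟩ := eventually_atTop.1 (key e₀ (z +ᵥ e₀))
  refine ⟨h .white (k₀ • z +ᵥ e₀), fun e => ?_⟩
  filter_upwards [key e e₀, eventually_ge_atTop k₀] with k hk hge
  rw [hk]
  clear hk
  induction k, hge using Nat.le_induction with
  | base => rfl
  | succ k hk ih =>
    rw [← ih, hk₀ k hk, ← add_vadd, succ_nsmul]

/-- One goes from `k • z` to `k • z'` by replacing one summand `z` by `z'` at a time. Each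
replacement follows a translate of one fixed finite path, which for large `k` stays in the part of
the cone where `ω` vanishes. -/
theorem eventually_eq_of_cone {ω : E → ℤ} {h : VertexColor → E → ℤ} (H : G.IsPotential ω h)
    {z z' : ℤ × ℤ}
    (hω : ∀ e, ∀ᶠ k : ℕ in atTop, ∀ a b : ℕ, a + b = k → ω ((a • z + b • z') +ᵥ e) = 0) (e : E) :
    ∀ᶠ k : ℕ in atTop, h .white (k • z +ᵥ e) = h .white (k • z' +ᵥ e) := by
  obtain ⟨F, hF⟩ := G.exists_finset_path (z +ᵥ e) (z' +ᵥ e)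
  have : ∀ᶠ k : ℕ in atTop, ∀ g ∈ F, ∀ a b : ℕ, a + b = k → ω ((a • z + b • z') +ᵥ g) = 0 :=
    (eventually_all_finset F).2 fun g _ => hω g
  obtain ⟨k₀, hk₀⟩ := eventually_atTop.1 this
  filter_upwards [eventually_ge_atTop (k₀ + 1)] with k hk
  obtain ⟨k, rfl⟩ : ∃ j, k = j + 1 := ⟨k - 1, by omega⟩
  have hk : k₀ ≤ k := by omega
  have hstep : ∀ a b : ℕ, a + b = k → h .white (((a + 1) • z + b • z') +ᵥ e) =
      h .white ((a • z + (b + 1) • z') +ᵥ e) := by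
    intro a b hab
    have := hF _ _ (isPotential_vadd H (a • z + b • z')) fun g hg => hk₀ k hk g hg a b hab
    simp only [← add_vadd] at this
    rw [succ_nsmul, succ_nsmul, ← add_assoc, add_right_comm]
    exact this
  have hall : ∀ b ≤ k + 1, h .white (((k + 1 - b) • z + b • z') +ᵥ e) =
      h .white ((k + 1) • z +ᵥ e) := by
    intro b hb
    induction b with
    | zero => simp
    | succ b ih =>
      rw [← ih (by omega)]
      have := hstep (k - b) b (by omega)
      rw [show k + 1 - (b + 1) = k - b by omega, show k + 1 - b = k - b + 1 by omega]
      exact this.symm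
  have := hall (k + 1) le_rfl
  rw [Nat.sub_self, zero_nsmul, zero_add] at this
  exact this.symm

theorem limitAt_congr {ω : E → ℤ} {h : VertexColor → E → ℤ} (H : G.IsPotential ω h)
    {z z' : ℤ × ℤ} {v : ℤ}
    (hω : ∀ e, ∀ᶠ k : ℕ in atTop, ∀ a b : ℕ, a + b = k → ω ((a • z + b • z') +ᵥ e) = 0)
    (hv : LimitAt h z v) : LimitAt h z' v := by
  intro e
  filter_upwards [hv e, G.eventually_eq_of_cone H hω e] with k h1 h2
  rw [← h2, h1]

end PeriodicPlaneGraph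

/-! ### Train-tracks are not closed -/

theorem VertexColor.other_other (c : VertexColor) : c.other.other = c := by cases c <;> rfl

theorem VertexColor.eq_or_eq_other (c d : VertexColor) : d = c ∨ d = c.other := by
  cases c <;> cases d <;> simp [VertexColor.other]

namespace PeriodicPlaneGraph

variable {E : Type*} [AddAction (ℤ × ℤ) E] (G : PeriodicPlaneGraph E)

theorem track_ne_track_other {G : PeriodicPlaneGraph E} (hG : G.IsMinimal) (e : E)
    (c : VertexColor) : G.track (e, c) ≠ G.track (e, c.other) := by
  intro h
  refine hG.1 ⟨e, ?_⟩
  cases c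
  exacts [h, h.symm]

theorem not_parallel_bigon {G : PeriodicPlaneGraph E} (hG : G.IsMinimal) {x y : E} (hxy : x ≠ y)
    {c d : VertexColor} {m n : ℕ} (h1 : G.step^[m] (x, c) = (y, d))
    (h2 : G.step^[n] (x, c.other) = (y, d.other)) : False := by
  cases c with
  | white => exact hG.2 ⟨x, y, d, m, n, hxy, track_ne_track_other hG x .white, h1, h2⟩
  | black => exact hG.2 ⟨x, y, d.other, n, m, hxy, track_ne_track_other hG x .white, h2, by
      rw [d.other_other]; exact h1⟩

theorem strandClass_eq_zero_of_iterate {s : E × VertexColor} {d : ℕ} (hd : 0 < d)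
    (h : G.step^[d] s = s) : G.strandClass s = 0 := by
  have h1 := G.iterate_mul_strandPeriod s d
  rw [mul_comm, Function.iterate_mul] at h1
  have h2 : (G.step^[G.strandPeriod s])^[d] s = s := by
    rw [← Function.iterate_mul, mul_comm, Function.iterate_mul]
    exact Function.iterate_fixed h _
  have h3 : (G.step^[d])^[G.strandPeriod s] s = s := Function.iterate_fixed h _
  rw [← Function.iterate_mul, mul_comm, Function.iterate_mul] at h3
  have h4 : translate (d • G.strandClass s) s = translate 0 s := by
    rw [translate_zero, ← iterate_mul_strandPeriod, mul_comm, Function.iterate_mul, h2]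
  have h5 := G.translate_right_injective h4
  exact (smul_eq_zero.1 h5).resolve_left hd.ne'

theorem iterate_step_injective {s : E × VertexColor} (hs : G.strandClass s ≠ 0) {a b : ℕ}
    (h : G.step^[a] s = G.step^[b] s) : a = b := by
  wlog hab : a ≤ b generalizing a b
  · exact (this h.symm (by omega)).symm
  by_contra hne
  refine hs (G.strandClass_eq_zero_of_iterate (d := b - a) (by omega) ?_)
  apply G.step.injective.iterate a
  rw [← Function.iterate_add_apply, Nat.add_sub_cancel' hab, h]

/-- The value of `h` at the vertex around which a strand turns. -/
def strandValue (h : VertexColor → E → ℤ) (s : E × VertexColor) : ℤ := h s.2 s.1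

/-- The sign of the crossings at the beginning of the strands around vertices of a given colour. -/
def colorSign : VertexColor → ℤ
  | .white => 1
  | .black => -1

theorem colorSign_ne_zero (c : VertexColor) : colorSign c ≠ 0 := by cases c <;> simp [colorSign]

theorem strandValue_step {ω : E → ℤ} {h : VertexColor → E → ℤ} (H : G.IsPotential ω h)
    (s : E × VertexColor) : strandValue h (G.step s) =
      strandValue h s + colorSign (G.step s).2 * ω (G.step s).1 := by
  obtain ⟨e, _ | _⟩ := s
  · simp only [strandValue, BipartiteMap.step_white, colorSign]
    rw [H.black_eq, H.rot]; ring
  · simp only [strandValue, BipartiteMap.step_black, colorSign]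
    rw [H.white_eq, H.rot_symm]; ring

theorem strandValue_iterate {ω : E → ℤ} {h : VertexColor → E → ℤ} (H : G.IsPotential ω h)
    (s : E × VertexColor) (n : ℕ) : strandValue h (G.step^[n] s) = strandValue h s +
      ∑ j ∈ Finset.range n, colorSign (G.step^[j + 1] s).2 * ω (G.step^[j + 1] s).1 := by
  induction n with
  | zero => simp
  | succ n ih =>
    rw [Finset.sum_range_succ, ← add_assoc, ← ih, Function.iterate_succ_apply' _ n,
      G.strandValue_step H]

/-- Signed crossings add up to the change of the potential. If this change is zero, a nonzero
crossing cannot be the only one. -/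
theorem exists_second_crossing {ω : E → ℤ} {h : VertexColor → E → ℤ} (H : G.IsPotential ω h)
    {s : E × VertexColor} {n j₀ : ℕ} (heq : strandValue h (G.step^[n] s) = strandValue h s)
    (hj₀ : j₀ < n) (hω : ω (G.step^[j₀ + 1] s).1 ≠ 0) :
    ∃ j < n, j ≠ j₀ ∧ ω (G.step^[j + 1] s).1 ≠ 0 := by
  by_contra! hcon
  rw [G.strandValue_iterate H, Finset.sum_eq_single j₀] at heq
  · have := mul_ne_zero (colorSign_ne_zero (G.step^[j₀ + 1] s).2) hω
    omega
  · intro j hj hne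
    rw [hcon j (Finset.mem_range.1 hj) hne, mul_zero]
  · intro h; exact absurd (Finset.mem_range.2 hj₀) h

theorem exists_linePotential (t : G.TrainTrack) :
    ∃ h, G.IsPotential (BipartiteMap.startSum (G.lineIndicator t)) h :=
  G.exists_potential_startSum _ fun e => by rw [lineIndicator_step, lineIndicator_step]

theorem startSum_lineIndicator_ne_zero {t : G.TrainTrack} {e : E}
    (h : BipartiteMap.startSum (G.lineIndicator t) e ≠ 0) : ∃ c, G.track (e, c) = t := by
  by_contra! hcon
  refine h ?_
  rw [BipartiteMap.startSum, lineIndicator, lineIndicator, if_neg (hcon _), if_neg (hcon _),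
    add_zero]

theorem startSum_lineIndicator_of_track {G : PeriodicPlaneGraph E} (hG : G.IsMinimal)
    {t : G.TrainTrack} {e : E} {c : VertexColor} (h : G.track (e, c) = t) :
    BipartiteMap.startSum (G.lineIndicator t) e = 1 := by
  have h1 := track_ne_track_other hG e c
  rw [BipartiteMap.startSum, lineIndicator, lineIndicator]
  cases c with
  | white => rw [if_pos h, if_neg fun h' => h1 (h.trans h'.symm), add_zero]
  | black => rw [if_pos h, if_neg fun h' => h1 (h.trans h'.symm), zero_add]

theorem startSum_lineIndicator_ne_zero_cone {t : G.TrainTrack} {l : ℤ × ℤ →+ ℤ}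
    (hl : l (G.homologyClass t) = 0) {z z' : ℤ × ℤ} (hz : 0 < l z) (hz' : 0 < l z') (e : E) :
    ∀ᶠ k : ℕ in atTop, ∀ a b : ℕ, a + b = k →
      BipartiteMap.startSum (G.lineIndicator t) ((a • z + b • z') +ᵥ e) = 0 := by
  have h1 := eventually_not_mem_cone l (G.exists_line_bound t (e, .white) l hl) hz hz'
  have h2 := eventually_not_mem_cone l (G.exists_line_bound t (e, .black) l hl) hz hz'
  filter_upwards [h1, h2] with k h1 h2 a b hab
  have h3 := h1 a b hab
  have h4 := h2 a b hab
  rw [ne_eq, not_not] at h3 h4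
  rw [BipartiteMap.startSum]
  exact (congrArg₂ (· + ·) h3 h4).trans (add_zero 0)

/-- A closed train-track runs forward from `e` to the edge of `σ` and also from there back to `e`.
Whichever of the two edges the other train-track meets earlier, this gives a parallel bigon. -/
theorem closed_track_not_crossed_twice {G : PeriodicPlaneGraph E} (hG : G.IsMinimal) {e : E}
    {c : VertexColor} {N : ℕ} (hN : 0 < N) (hclosed : G.step^[N] (e, c) = (e, c))
    {σ : E × VertexColor} (hne : σ.1 ≠ e) (hcross : G.track (σ.1, σ.2.other) = G.track (e, c))
    (hσ : ∃ m : ℕ, G.step^[m] (e, c.other) = σ ∨ G.step^[m] σ = (e, c.other)) : False := by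
  have hclosed' : ∀ q : ℕ, G.step^[q * N] (e, c) = (e, c) := fun q => by
    rw [mul_comm, Function.iterate_mul]
    exact Function.iterate_fixed hclosed q
  have hfwd : ∃ n : ℕ, G.step^[n] (e, c) = (σ.1, σ.2.other) := by
    rcases (G.track_eq_iff _ _).1 hcross with h | ⟨n, hn⟩
    · exact h
    · refine ⟨n * N - n, G.step.injective.iterate n ?_⟩
      have : n ≤ n * N := Nat.le_mul_of_pos_right n hN
      rw [← Function.iterate_add_apply, Nat.add_sub_cancel' this, hclosed', hn]
  obtain ⟨n, hn⟩ := hfwd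
  have hbwd : G.step^[n * N - n] (σ.1, σ.2.other) = (e, c) := by
    have : n ≤ n * N := Nat.le_mul_of_pos_right n hN
    rw [← hn, ← Function.iterate_add_apply, Nat.sub_add_cancel this, hclosed']
  obtain ⟨m, hm | hm⟩ := hσ
  · exact not_parallel_bigon hG hne.symm (c := c) (d := σ.2.other) hn
      (by rw [VertexColor.other_other]; exact hm)
  · exact not_parallel_bigon hG hne (c := σ.2.other) (d := c) hbwd
      (by rw [VertexColor.other_other]; exact hm)

/-- A class zero means a closed train-track. A train-track that crosses it must cross it again: if
it is closed too, because the potential returns to its value after a period, and otherwise because a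
closed train-track is bounded, so the potential has the same limit at both ends. A second crossing
is excluded by `closed_track_not_crossed_twice`. -/
theorem strandClass_ne_zero {G : PeriodicPlaneGraph E} (hG : G.IsMinimal)
    (s : E × VertexColor) : G.strandClass s ≠ 0 := by
  intro hs
  obtain ⟨e, c⟩ := s
  have hclosed : G.step^[G.strandPeriod (e, c)] (e, c) = (e, c) := by
    rw [iterate_strandPeriod, hs, translate_zero]
  have hN := G.strandPeriod_pos (e, c)
  obtain ⟨h, H⟩ := G.exists_linePotential (G.track (e, c))
  set ω := BipartiteMap.startSum (G.lineIndicator (G.track (e, c))) with hω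
  have hωe : ω e = 1 := startSum_lineIndicator_of_track hG rfl
  have hcross : ∀ σ : E × VertexColor, G.track σ = G.track (e, c.other) → ω σ.1 ≠ 0 →
      G.track (σ.1, σ.2.other) = G.track (e, c) := by
    intro σ hσ hne
    obtain ⟨d, hd⟩ := G.startSum_lineIndicator_ne_zero hne
    rcases VertexColor.eq_or_eq_other σ.2 d with rfl | rfl
    · exact absurd (hd.symm.trans hσ) (track_ne_track_other hG e c)
    · exact hd
  have hsame : ∀ σ : E × VertexColor, G.track σ = G.track (e, c.other) → σ.1 = e →
      σ = (e, c.other) := by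
    rintro ⟨e', d⟩ hσ rfl
    rcases VertexColor.eq_or_eq_other c d with rfl | rfl
    · exact absurd hσ (track_ne_track_other hG e' d)
    · rfl
  set s' : E × VertexColor := (e, c.other) with hs'
  by_cases hp : G.strandClass s' = 0
  · have hper : G.step^[G.strandPeriod s'] s' = s' := by
      rw [iterate_strandPeriod, hp, translate_zero]
    have hN' := G.strandPeriod_pos s'
    -- The last crossing of the period, of index one less than the period, is the crossing at `e`
    -- itself.
    obtain ⟨j, hj, hjne, hωj⟩ := G.exists_second_crossing H (s := s')
      (n := G.strandPeriod s') (j₀ := G.strandPeriod s' - 1) (by rw [hper]) (by omega) (by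
        rw [Nat.sub_add_cancel hN', hper]; simp [hs', hωe])
    refine closed_track_not_crossed_twice hG hN hclosed (σ := G.step^[j + 1] s') ?_
      (hcross _ (G.track_iterate _ _) hωj) ⟨j + 1, .inl rfl⟩
    intro heq
    have h1 := hsame _ (G.track_iterate _ _) heq
    classical
    exact Nat.find_min (G.exists_period s') (m := j + 1)
      (show j + 1 < G.strandPeriod s' by omega) ⟨Nat.succ_pos j, 0, by rw [translate_zero, h1]⟩
  · set p := G.strandClass s' with hpdef
    have hzero : ∀ l : ℤ × ℤ →+ ℤ, l (G.homologyClass (G.track (e, c))) = 0 := fun l => by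
      rw [homologyClass_track, hs, map_zero]
    -- The quarter turn of `p`. The cones from `p` to `y` and from `y` to `-p` form a half-plane,
    -- and the linear forms below are positive on one cone each; the bounded closed train-track
    -- leaves both cones, so the limits at `p` and `-p` agree.
    let y : ℤ × ℤ := (-p.2, p.1)
    have hdet : 0 < latticeDet p y := by
      have : latticeDet p y = p.1 * p.1 + p.2 * p.2 := by simp only [latticeDet, y]; ring
      rw [this]
      by_contra hle
      have h1 : p.1 * p.1 = 0 := by nlinarith [mul_self_nonneg p.1, mul_self_nonneg p.2]
      have h2 : p.2 * p.2 = 0 := by nlinarith [mul_self_nonneg p.1, mul_self_nonneg p.2]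
      exact hp (Prod.ext (mul_self_eq_zero.1 h1) (mul_self_eq_zero.1 h2))
    have ha1 : 0 < latticeDetHom (p - y) p := by
      rw [latticeDetHom_apply, latticeDet_sub_left, latticeDet_self, latticeDet_swap y p]
      linarith
    have ha2 : 0 < latticeDetHom (p - y) y := by
      rw [latticeDetHom_apply, latticeDet_sub_left, latticeDet_self]
      linarith
    have ha3 : 0 < latticeDetHom (p - -y) y := by
      rw [latticeDetHom_apply, latticeDet_sub_left, latticeDet_neg_left, latticeDet_self]
      linarith
    have ha4 : 0 < latticeDetHom (p - -y) (-p) := by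
      rw [latticeDetHom_apply, latticeDet_sub_left, latticeDet_neg_left, latticeDet_neg_right,
        latticeDet_self, latticeDet_neg_right, latticeDet_swap y p]
      linarith
    have hfar : ∀ (l : ℤ × ℤ →+ ℤ) (z : ℤ × ℤ), 0 < l z → ∀ g, ∀ᶠ k : ℕ in atTop,
        ω (k • z +ᵥ g) = 0 := by
      intro l z hz g
      filter_upwards [G.startSum_lineIndicator_ne_zero_cone (hzero l) hz hz g] with k hk
      simpa using hk k 0 (by simp)
    obtain ⟨v, hv⟩ := G.exists_limitAt H (hfar _ p ha1)
    have hv2 : LimitAt h y v := G.limitAt_congr H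
      (G.startSum_lineIndicator_ne_zero_cone (hzero _) ha1 ha2) hv
    have hv3 : LimitAt h (-p) v := G.limitAt_congr H
      (G.startSum_lineIndicator_ne_zero_cone (hzero _) ha3 ha4) hv2
    have hval : ∀ (k : ℕ) (z : ℤ × ℤ), h .white (k • z +ᵥ e) = v → ω (k • z +ᵥ e) = 0 →
        strandValue h (translate (k • z) s') = v := by
      intro k z h1 h2
      simp only [strandValue, translate, hs']
      cases c.other with
      | white => exact h1
      | black => rw [H.black_eq, h1, h2, sub_zero]
    obtain ⟨K, ⟨⟨⟨hK1, hK2⟩, hK3⟩, hK4⟩, hK0⟩ := ((((hv e).and (hfar _ p ha1 e)).and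
      (hv3 e)).and (hfar _ (-p) ha4 e) |>.and (eventually_gt_atTop 0)).exists
    set s'' := translate (K • -p) s' with hs''
    have hfirst : G.step^[K * G.strandPeriod s'] s'' = s' := by
      rw [hs'', iterate_step_translate, iterate_mul_strandPeriod, translate_translate, ← hpdef,
        ← smul_add, neg_add_cancel, smul_zero, translate_zero]
    have hlast : G.step^[K * G.strandPeriod s' + K * G.strandPeriod s'] s'' =
        translate (K • p) s' := by
      rw [Function.iterate_add_apply, hfirst, iterate_mul_strandPeriod]
    have hpos : 0 < K * G.strandPeriod s' := Nat.mul_pos hK0 (G.strandPeriod_pos s')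
    set M := K * G.strandPeriod s'
    have hs''t : G.track s'' = G.track s' := by rw [← hfirst, track_iterate]
    have hp'' : G.strandClass s'' ≠ 0 := by rw [hs'', strandClass_translate]; exact hp
    -- From the translate by `-K p`, `M` steps lead to `s'` and `M` more to the translate by `K p`;
    -- the crossing of index `M - 1` is the one at `e`.
    obtain ⟨j, hj, hjne, hωj⟩ := G.exists_second_crossing H (s := s'') (n := M + M)
      (j₀ := M - 1) (by rw [hlast, hval K p hK1 hK2, hs'', hval K (-p) hK3 hK4]) (by omega) (by
        rw [Nat.sub_add_cancel hpos, hfirst]; simp [hs', hωe])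
    have hσt : G.track (G.step^[j + 1] s'') = G.track s' := by rw [track_iterate, hs''t]
    refine closed_track_not_crossed_twice hG hN hclosed (σ := G.step^[j + 1] s'') ?_
      (hcross _ hσt hωj) ?_
    · intro heq
      have h1 := hsame _ hσt heq
      rw [← hfirst] at h1
      have := G.iterate_step_injective hp'' h1
      omega
    · rcases Nat.lt_or_ge j M with hlt | hge
      · refine ⟨M - (j + 1), .inr ?_⟩
        rw [← Function.iterate_add_apply, Nat.sub_add_cancel hlt, hfirst]
      · refine ⟨j + 1 - M, .inl ?_⟩
        show G.step^[j + 1 - M] s' = _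
        rw [← hfirst, ← Function.iterate_add_apply, Nat.sub_add_cancel (by omega)]

/-- Train-tracks with the same direction do not cross. -/
theorem not_same_direction_of_cross {G : PeriodicPlaneGraph E} (hG : G.IsMinimal) (e : E)
    {a b : ℕ} (ha : 0 < a) :
    a • G.strandClass (e, .white) ≠ b • G.strandClass (e, .black) := by
  intro heq
  have h1 := G.iterate_mul_strandPeriod (e, .white) a
  have h2 := G.iterate_mul_strandPeriod (e, .black) b
  rw [← heq] at h2
  -- The two train-tracks cross again at the translate of `e` by the common multiple of their
  -- classes.
  refine not_parallel_bigon hG (x := e) (y := (a • G.strandClass (e, .white)) +ᵥ e) ?_ h1 h2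
  intro h
  have h3 : (a • G.strandClass (e, .white)) = 0 := G.free _ _ h.symm
  exact strandClass_ne_zero hG _ ((smul_eq_zero.1 h3).resolve_left ha.ne')

end PeriodicPlaneGraph

/-! ### The two sides of a train-track -/

theorem finsum_int_telescope {f : ℤ → ℤ} {u v : ℤ}
    (hu : ∀ᶠ k : ℕ in atTop, f k = u) (hv : ∀ᶠ k : ℕ in atTop, f (-k) = v) :
    ∑ᶠ k : ℤ, (f (k + 1) - f k) = u - v := by
  classical
  obtain ⟨K, hK⟩ := eventually_atTop.1 (hu.and hv)
  rw [finsum_eq_sum_of_support_subset (s := (Finset.range (K + K)).image fun i : ℕ => -(K : ℤ) + i)]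
  · rw [Finset.sum_image (fun i _ j _ h => by simpa using h)]
    have h1 := Finset.sum_range_sub (fun i : ℕ => f (-(K : ℤ) + i)) (K + K)
    push_cast at h1
    simp only [← add_assoc] at h1
    rw [h1, add_zero, (hK K le_rfl).2]
    congr 1
    rw [neg_add_cancel, zero_add, (hK K le_rfl).1]
  · intro k hk
    rw [Function.mem_support] at hk
    simp only [Finset.coe_image, Finset.coe_range, Set.mem_image, Set.mem_Iio]
    have h1 : k < K := by
      by_contra hge
      obtain ⟨m, rfl⟩ := Int.eq_ofNat_of_zero_le (show 0 ≤ k by omega)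
      refine hk ?_
      have h2 := (hK (m + 1) (by omega)).1
      have h3 := (hK m (by omega)).1
      push_cast at h2
      rw [h2, h3, sub_self]
    have h2 : -(K : ℤ) ≤ k := by
      by_contra hlt
      obtain ⟨m, hm⟩ := Int.eq_ofNat_of_zero_le (show 0 ≤ -k by omega)
      obtain rfl : k = -(m : ℤ) := by omega
      refine hk ?_
      have h2 := (hK (m - 1) (by omega)).2
      have h3 := (hK m (by omega)).2
      rw [show -((m - 1 : ℕ) : ℤ) = -(m : ℤ) + 1 by omega] at h2
      rw [h2, h3, sub_self]
    exact ⟨(k + K).toNat, by omega, by omega⟩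

/-- The coefficient `n` of `y` is positive, so the vectors `k • z + j • y` with `0 ≤ j < n`
represent `ℤ²` modulo `p`, even if `p` is not primitive. -/
theorem exists_adapted_basis {p : ℤ × ℤ} (hp : p ≠ 0) : ∃ (z y : ℤ × ℤ) (α : ℤ) (n : ℕ), 0 < n ∧
    p = α • z + (n : ℤ) • y ∧ 0 < latticeDet p z ∧ ∀ u : ℤ × ℤ, ∃ k j : ℤ, u = k • z + j • y := by
  obtain ⟨p1, p2⟩ := p
  rcases lt_trichotomy p2 0 with h | rfl | h
  · refine ⟨(1, 0), (0, -1), p1, p2.natAbs, by omega, ?_, ?_, fun u => ⟨u.1, -u.2, ?_⟩⟩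
    · ext <;> simp [abs_of_neg h]
    · simpa [latticeDet] using h
    · ext <;> simp
  · have h1 : p1 ≠ 0 := fun h => hp (by rw [h]; rfl)
    rcases lt_or_gt_of_ne h1 with h | h
    · refine ⟨(0, -1), (-1, 0), 0, p1.natAbs, by omega, ?_, ?_, fun u => ⟨-u.2, -u.1, ?_⟩⟩
      · ext <;> simp [abs_of_neg h]
      · simpa [latticeDet] using h
      · ext <;> simp
    · refine ⟨(0, 1), (1, 0), 0, p1.natAbs, by omega, ?_, ?_, fun u => ⟨u.2, u.1, ?_⟩⟩
      · ext <;> simp [abs_of_pos h]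
      · simpa [latticeDet] using h
      · ext <;> simp
  · refine ⟨(-1, 0), (0, 1), -p1, p2.natAbs, by omega, ?_, ?_, fun u => ⟨-u.1, u.2, ?_⟩⟩
    · ext <;> simp [abs_of_pos h]
    · simpa [latticeDet] using h
    · ext <;> simp

namespace PeriodicPlaneGraph

variable {E : Type*} [AddAction (ℤ × ℤ) E] (G : PeriodicPlaneGraph E)

/-- A potential takes its values in `V` if it does so at one vertex and along the support of its
cocycle. -/
theorem potential_mem {ω : E → ℤ} {h : VertexColor → E → ℤ} (H : G.IsPotential ω h) {V : Set ℤ}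
    (hω : ∀ e, ω e ≠ 0 → h .white e ∈ V ∧ h .black e ∈ V) {c₀ : VertexColor} {e₀ : E}
    (h₀ : h c₀ e₀ ∈ V) (c : VertexColor) (e : E) : h c e ∈ V := by
  have key : ∀ (d : VertexColor) (e : E), h d e ∈ V → ∀ c, h c e ∈ V := by
    intro d e hd c
    by_cases h0 : ω e = 0
    · have := H.sub e
      rw [h0, sub_eq_zero] at this
      cases c <;> cases d <;> first | exact hd | rwa [this] | rwa [← this]
    · cases c
      exacts [(hω e h0).1, (hω e h0).2]
  refine G.induction_on_edges (P := fun e => ∀ c, h c e ∈ V) e₀ (key c₀ e₀ h₀) ?_ ?_ e c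
  · intro d e he
    exact key d _ (by rw [H.rot]; exact he d)
  · intro d e he
    exact key d _ (by rw [H.rot_symm]; exact he d)

/-- The indicator function of the left side. A train-track keeps the white ends of its edges on its
left and the black ends on its right, and the potential changes only across it; so the normalisation
at one edge of the train-track forces the values `0` and `1` everywhere. -/
theorem exists_sidePotential {G : PeriodicPlaneGraph E} (hG : G.IsMinimal) (t : G.TrainTrack) :
    ∃ h, G.IsPotential (BipartiteMap.startSum (G.lineIndicator t)) h ∧
      (∀ c e, h c e = 0 ∨ h c e = 1) ∧
      ∀ s, G.track s = t → h .white s.1 = 1 ∧ h .black s.1 = 0 := by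
  obtain ⟨s, rfl⟩ : ∃ s, G.track s = t := ⟨Quotient.out t, Quotient.out_eq t⟩
  obtain ⟨h, H⟩ := G.exists_linePotential (G.track s)
  have H' := H.add_const (1 - h .white s.1)
  set h' : VertexColor → E → ℤ := fun c e => h c e + (1 - h .white s.1) with hh'
  have hs : h' .white s.1 = 1 := by simp [hh']
  have hstep : ∀ σ, G.track σ = G.track s → h' .white (G.step σ).1 = h' .white σ.1 := by
    rintro ⟨e, _ | _⟩ hσ
    · exact H'.rot _ _
    · have h1 := startSum_lineIndicator_of_track hG hσ
      have h2 := startSum_lineIndicator_of_track hG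
        (show G.track ((G.rot .black).symm e, .white) = G.track s by
          rw [← hσ]; exact G.track_step (e, .black))
      rw [BipartiteMap.step_black]
      rw [H'.white_eq, H'.white_eq e, h1, h2, H'.rot_symm]
  have hline : ∀ σ, G.track σ = G.track s → h' .white σ.1 = 1 := by
    intro σ hσ
    have hit : ∀ (n : ℕ) σ, G.track σ = G.track s →
        h' .white (G.step^[n] σ).1 = h' .white σ.1 := by
      intro n σ hσ
      induction n with
      | zero => rfl
      | succ n ih => rw [Function.iterate_succ_apply', hstep _ (by rw [track_iterate, hσ]), ih]
    rcases (G.track_eq_iff _ _).1 hσ with ⟨n, rfl⟩ | ⟨n, hn⟩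
    · rw [hit n s rfl, hs]
    · rw [← hit n σ hσ, hn, hs]
  have hboth : ∀ σ, G.track σ = G.track s → h' .white σ.1 = 1 ∧ h' .black σ.1 = 0 := by
    intro σ hσ
    refine ⟨hline σ hσ, ?_⟩
    rw [H'.black_eq, hline σ hσ, startSum_lineIndicator_of_track (c := σ.2) hG hσ, sub_self]
  refine ⟨h', H', fun c e => ?_, hboth⟩
  have := G.potential_mem H' (V := {0, 1}) (fun e he => ?_) (c₀ := .white) (e₀ := s.1)
    (by simp [hs]) c e
  · simpa using this
  · obtain ⟨d, hd⟩ := G.startSum_lineIndicator_ne_zero he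
    obtain ⟨h1, h2⟩ := hboth _ hd
    simp only at h1 h2
    rw [h1, h2]
    simp

theorem lineIndicator_translate_homologyClass (t : G.TrainTrack) (s : E × VertexColor) :
    G.lineIndicator t (translate (G.homologyClass t) s) = G.lineIndicator t s := by
  have h1 : G.track (translate (G.strandClass s) s) = G.track s := by
    rw [← iterate_strandPeriod, track_iterate]
  by_cases h : G.strandClass s = G.homologyClass t
  · rw [lineIndicator, ← h, h1, lineIndicator]
  · rw [lineIndicator, lineIndicator, if_neg, if_neg]
    · rintro rfl
      exact h (G.homologyClass_track s).symm
    · intro h2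
      refine h ?_
      rw [← h2, homologyClass_track, strandClass_translate]

theorem finite_lineIndicator_support (t : G.TrainTrack) {z : ℤ × ℤ}
    (hz : 0 < latticeDet (G.homologyClass t) z) (y : ℤ × ℤ) (s : E × VertexColor) :
    {k : ℤ | G.lineIndicator t (translate (k • z + y) s) ≠ 0}.Finite := by
  set l := latticeDetHom (G.homologyClass t)
  have hl : l (G.homologyClass t) = 0 := latticeDet_self _
  obtain ⟨C, hC⟩ := G.exists_line_bound t s l hl
  obtain ⟨C', hC'⟩ := G.exists_line_bound t s (-l) (by rw [AddMonoidHom.neg_apply, hl, neg_zero])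
  have hz : 0 < l z := hz
  refine (Set.finite_Icc (-(|C'| + |l y|)) (|C| + |l y|)).subset fun k hk => ?_
  have h1 := hC _ hk
  have h2 := hC' _ hk
  rw [AddMonoidHom.neg_apply] at h2
  rw [map_add, map_zsmul, smul_eq_mul] at h1 h2
  have h3 := neg_abs_le (l y)
  have h4 := le_abs_self (l y)
  have h5 := le_abs_self C
  have h6 := le_abs_self C'
  rw [Set.mem_Icc]
  constructor
  · by_contra hlt
    have : k * l z ≤ k * 1 := mul_le_mul_of_nonpos_left hz (by
      have := abs_nonneg C'; have := abs_nonneg (l y); linarith)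
    linarith
  · by_contra hlt
    have : k * 1 ≤ k * l z := mul_le_mul_of_nonneg_left hz (by
      have := abs_nonneg C; have := abs_nonneg (l y); linarith)
    linarith

/-- All translates of `t` are superposed, one for each element of `ℤ²` modulo its class. This gives
a periodic flow whose potential increases along `z` by `n * (u - v)`; by `increment_eq` the same
increment is a sum of nonnegative multiples of the determinant of the class with `z`, not all zero.
-/
theorem side_limits_of_basis {G : PeriodicPlaneGraph E} {t : G.TrainTrack}
    {h : VertexColor → E → ℤ} (H : G.IsPotential (BipartiteMap.startSum (G.lineIndicator t)) h)
    {z y : ℤ × ℤ} {α : ℤ} {n : ℕ} (hp : G.homologyClass t = α • z + (n : ℤ) • y)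
    (hz : 0 < latticeDet (G.homologyClass t) z) (hbasis : ∀ u : ℤ × ℤ, ∃ k j : ℤ, u = k • z + j • y)
    (hn : 0 < n)
    {u v : ℤ} (hu : LimitAt h z u) (hv : LimitAt h (-z) v) : v < u := by
  classical
  have := G.finite_quotient
  let _ := Fintype.ofFinite (AddAction.orbitRel.Quotient (ℤ × ℤ) E)
  let I : ℤ → ℤ → E × VertexColor → ℤ := fun j k s =>
    G.lineIndicator t (translate (k • z + j • y) s)
  have hI0 : ∀ j k s, 0 ≤ I j k s := fun j k s => by
    simp only [I, lineIndicator]; split_ifs <;> simp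
  have hIfin : ∀ j s, (Function.support fun k => I j k s).Finite := fun j s =>
    G.finite_lineIndicator_support t hz (j • y) s
  let g : ℤ → E × VertexColor → ℤ := fun j s => ∑ᶠ k : ℤ, I j k s
  let a : E × VertexColor → ℤ := fun s => ∑ j ∈ Finset.range n, g j s
  have hastep : ∀ s, a (G.step s) = a s := by
    intro s
    simp only [a, g, I, ← step_translate, lineIndicator_step]
  have hgz : ∀ (j m : ℤ) s, g j (translate (m • z) s) = g j s := by
    intro j m s
    simp only [g]
    rw [← finsum_comp_equiv (Equiv.addRight m) (f := fun k => I j k s)]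
    refine finsum_congr fun k => ?_
    simp only [I, translate_translate, Equiv.coe_addRight, add_smul]
    congr 2
    abel
  have hgy : ∀ (j m : ℤ) s, g j (translate (m • y) s) = g (j + m) s := by
    intro j m s
    simp only [g]
    refine finsum_congr fun k => ?_
    simp only [I, translate_translate, add_smul, add_assoc]
  have hgn : ∀ j s, g (j + n) s = g j s := by
    intro j s
    simp only [g]
    rw [← finsum_comp_equiv (Equiv.addRight α) (f := fun k => I (j + n) k s)]
    refine finsum_congr fun k => ?_
    simp only [I]
    rw [← G.lineIndicator_translate_homologyClass t (translate (k • z + j • y) s),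
      translate_translate, hp, Equiv.coe_addRight]
    congr 2
    simp only [add_smul]
    abel
  have hay1 : ∀ s, a (translate y s) = a s := by
    intro s
    have h1 : ∀ j : ℤ, g j (translate y s) = g (j + 1) s := fun j => by
      rw [← hgy j 1 s, one_smul]
    have h2 := Finset.sum_range_sub (fun j : ℕ => g j s) n
    have h3 := hgn 0 s
    rw [zero_add] at h3
    rw [Nat.cast_zero, h3, sub_self, Finset.sum_sub_distrib, sub_eq_zero] at h2
    simp only [a, h1]
    rw [← h2]
    exact Finset.sum_congr rfl fun j _ => by push_cast; rfl
  have hay : ∀ (m : ℤ) s, a (translate (m • y) s) = a s := by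
    intro m
    induction m using Int.induction_on with
    | zero => intro s; rw [zero_smul, translate_zero]
    | succ m ih => intro s; rw [add_smul, one_smul, ← translate_translate, ih, hay1]
    | pred m ih =>
      intro s
      rw [← hay1 (translate ((-(m : ℤ) - 1) • y) s), translate_translate, sub_smul, one_smul,
        add_sub_cancel, ih]
  have haz : ∀ w s, a (translate w s) = a s := by
    intro w s
    obtain ⟨k, j, rfl⟩ := hbasis w
    rw [← translate_translate]
    have : ∀ s, a (translate (k • z) s) = a s := fun s => by simp only [a, hgz]
    rw [this, hay]
  obtain ⟨e₀⟩ := G.nonempty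
  have hωfin : ∀ (j : ℤ) (e : E), {k : ℤ |
      BipartiteMap.startSum (G.lineIndicator t) ((k • z + j • y) +ᵥ e) ≠ 0}.Finite := by
    intro j e
    refine ((hIfin j (e, .white)).union (hIfin j (e, .black))).subset fun k hk => ?_
    by_contra hcon
    rw [Set.mem_union, not_or, Function.notMem_support, Function.notMem_support] at hcon
    exact hk (by
      rw [BipartiteMap.startSum]
      exact (congrArg₂ (· + ·) hcon.1 hcon.2).trans (add_zero 0))
  -- The value at a base point is subtracted so that only finitely many translates contribute.
  let d : ℤ → ℤ → VertexColor → E → ℤ := fun j k c e =>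
    h c ((k • z + j • y) +ᵥ e) - h .white ((k • z + j • y) +ᵥ e₀)
  have hdfin : ∀ j c e, (Function.support fun k => d j k c e).Finite := by
    intro j c e
    obtain ⟨F, hF⟩ := G.exists_finset_path e e₀
    refine (Set.Finite.biUnion (insert e F).finite_toSet fun g _ => hωfin j g).subset fun k hk => ?_
    by_contra hcon
    simp only [Set.mem_iUnion, not_exists, Set.mem_ofPred_eq, not_not] at hcon
    refine hk ?_
    have h1 := hF _ _ (isPotential_vadd H (k • z + j • y)) fun g hg => hcon g (by simp [hg])
    have h2 := hcon e (by simp)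
    simp only [d]
    cases c with
    | white => rw [h1, sub_self]
    | black => rw [H.black_eq, h2, h1]; ring
  let S : VertexColor → E → ℤ := fun c e => ∑ j ∈ Finset.range n, ∑ᶠ k : ℤ, d j k c e
  have HS : G.IsPotential (BipartiteMap.startSum a) S := by
    constructor
    · intro c e
      simp only [S, d, ← G.equivariant, H.rot]
    · intro e
      simp only [S, BipartiteMap.startSum, a, g]
      rw [← Finset.sum_sub_distrib, ← Finset.sum_add_distrib]
      refine Finset.sum_congr rfl fun j _ => ?_
      rw [← finsum_sub_distrib (hdfin _ _ _) (hdfin _ _ _),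
        ← finsum_add_distrib (hIfin _ _) (hIfin _ _)]
      refine finsum_congr fun k => ?_
      simp only [d, I]
      rw [sub_sub_sub_cancel_right, H.sub]
      rfl
  let L : ℤ × ℤ → ℤ := fun w => S .white (w +ᵥ e₀) - S .white e₀
  have hL : ∀ c w e, S c (w +ᵥ e) = S c e + L w := by
    intro c w e
    have H2 : G.IsPotential (BipartiteMap.startSum a) fun c e => S c (w +ᵥ e) :=
      (isPotential_vadd HS w).congr fun e =>
        congrArg₂ (· + ·) (haz w (e, .white)) (haz w (e, .black))
    have := G.potential_unique H2 HS c .white e e₀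
    simp only [L]
    linarith
  have hLz : L z = n * (u - v) := by
    have h1 : ∀ j : ℕ, ∑ᶠ k : ℤ, d j k .white (z +ᵥ e₀) = u - v := by
      intro j
      rw [← finsum_int_telescope (f := fun k => h .white ((k • z + (j : ℤ) • y) +ᵥ e₀))]
      · refine finsum_congr fun k => ?_
        simp only [d]
        rw [← add_vadd]
        congr 3
        rw [add_smul, one_smul]
        abel
      · filter_upwards [hu (((j : ℤ) • y) +ᵥ e₀)] with k hk
        rw [add_vadd, natCast_zsmul, hk]
      · filter_upwards [hv (((j : ℤ) • y) +ᵥ e₀)] with k hk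
        rw [add_vadd, neg_smul, natCast_zsmul, ← smul_neg, hk]
    have h2 : ∀ j : ℕ, ∑ᶠ k : ℤ, d j k .white e₀ = 0 := fun j => by simp [d]
    simp only [L, S, h1, h2]
    simp only [Finset.sum_const, Finset.card_range, nsmul_eq_mul, mul_zero, sub_zero]
  have hreal := G.increment_eq (a := fun s => (a s : ℝ)) (fun s => by rw [hastep])
    (fun w s => by rw [haz]) (h := fun c e => (S c e : ℝ))
    ⟨fun c e => by rw [HS.rot], fun e => by
      rw [← Int.cast_sub, HS.sub]
      simp [BipartiteMap.startSum]⟩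
    (fun w => (L w : ℝ)) (fun c w e => by rw [hL, Int.cast_add]) z
  have ha0 : ∀ s, 0 ≤ a s := fun s =>
    Finset.sum_nonneg fun j _ => finsum_nonneg fun k => hI0 _ _ _
  have haclass : ∀ s, a s ≠ 0 → G.strandClass s = G.homologyClass t := by
    intro s hs
    obtain ⟨j, _, hj⟩ := Finset.exists_ne_zero_of_sum_ne_zero hs
    obtain ⟨k, hk⟩ : ∃ k, I j k s ≠ 0 := by
      by_contra! hcon
      exact hj (by simp only [g, hcon, finsum_zero])
    have h1 : G.track (translate (k • z + (j : ℤ) • y) s) = t := by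
      by_contra hcon
      exact hk (if_neg hcon)
    rw [← h1, homologyClass_track, strandClass_translate]
  have hpos : 0 < L z := by
    have : (0 : ℝ) < L z := by
      rw [hreal]
      have hterm : ∀ s, 0 ≤ (a s : ℝ) * (latticeDet (G.strandClass s) z : ℝ) /
          (G.strandPeriod s : ℝ) := by
        intro s
        by_cases hs : a s = 0
        · simp [hs]
        · rw [haclass s hs]
          have h1 : (0 : ℝ) ≤ a s := by exact_mod_cast ha0 s
          have h2 : (0 : ℝ) ≤ latticeDet (G.homologyClass t) z := by exact_mod_cast hz.le
          positivity
      obtain ⟨s, hs⟩ : ∃ s, G.track s = t := ⟨Quotient.out t, Quotient.out_eq t⟩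
      refine Finset.sum_pos' (fun q _ => hterm _) ⟨(Quotient.mk _ s.1, s.2), Finset.mem_univ _, ?_⟩
      obtain ⟨w, hw⟩ := (quotient_mk_eq_iff _ _).1
        (Quotient.out_eq (Quotient.mk _ s.1 : AddAction.orbitRel.Quotient (ℤ × ℤ) E))
      have hw' : ((Quotient.out (Quotient.mk _ s.1 : AddAction.orbitRel.Quotient (ℤ × ℤ) E), s.2) :
          E × VertexColor) = translate w s := Prod.ext hw rfl
      show 0 < (a (Quotient.out (Quotient.mk _ s.1 : AddAction.orbitRel.Quotient (ℤ × ℤ) E), s.2) :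
        ℝ) * _ / _
      have has : 0 < a s := by
        have h1 : 1 ≤ g (0 : ℕ) s := by
          have h2 := single_le_finsum (f := fun k => I (0 : ℕ) k s) 0 (hIfin _ s)
            (fun k => hI0 _ _ _)
          have h3 : I (0 : ℕ) 0 s = 1 := by
            simp [I, translate_zero, lineIndicator, hs]
          rw [h3] at h2
          exact h2
        have h2 := Finset.single_le_sum (f := fun j : ℕ => g j s)
          (fun j _ => finsum_nonneg fun k => hI0 _ _ _) (Finset.mem_range.2 hn)
        linarith
      simp only [hw']
      rw [haz, haclass _ (by rw [haz]; exact has.ne')]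
      have h1 : (0 : ℝ) < a s := by exact_mod_cast has
      have h2 : (0 : ℝ) < latticeDet (G.homologyClass t) z := by exact_mod_cast hz
      have h3 : (0 : ℝ) < G.strandPeriod (translate w s) := by
        exact_mod_cast G.strandPeriod_pos _
      positivity
    exact_mod_cast this
  rw [hLz] at hpos
  have := pos_of_mul_pos_right hpos (Int.natCast_nonneg n)
  linarith

/-- The left side of a train-track contains the points at infinity on the left of its homology
class. -/
theorem limitAt_side {G : PeriodicPlaneGraph E} (hG : G.IsMinimal) {t : G.TrainTrack}
    {h : VertexColor → E → ℤ} (H : G.IsPotential (BipartiteMap.startSum (G.lineIndicator t)) h)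
    (h01 : ∀ c e, h c e = 0 ∨ h c e = 1) {z : ℤ × ℤ}
    (hz : 0 < latticeDet (G.homologyClass t) z) : LimitAt h z 1 ∧ LimitAt h (-z) 0 := by
  have hp : G.homologyClass t ≠ 0 := by
    obtain ⟨s, rfl⟩ : ∃ s, G.track s = t := ⟨Quotient.out t, Quotient.out_eq t⟩
    rw [homologyClass_track]
    exact strandClass_ne_zero hG s
  set l := latticeDetHom (G.homologyClass t)
  have hl : l (G.homologyClass t) = 0 := latticeDet_self _
  have hl' : (-l) (G.homologyClass t) = 0 := by rw [AddMonoidHom.neg_apply, hl, neg_zero]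
  have hneg : ∀ w, 0 < l w → 0 < (-l) (-w) := fun w hw => by simpa using hw
  obtain ⟨w, y, α, n, hn, hpe, hw, hbasis⟩ := exists_adapted_basis hp
  have hvanish : ∀ (m : ℤ × ℤ →+ ℤ), m (G.homologyClass t) = 0 → ∀ w, 0 < m w → ∀ g,
      ∀ᶠ k : ℕ in atTop, BipartiteMap.startSum (G.lineIndicator t) (k • w +ᵥ g) = 0 := by
    intro m hm w hw g
    filter_upwards [G.startSum_lineIndicator_ne_zero_cone hm hw hw g] with k hk
    simpa using hk k 0 (by simp)
  obtain ⟨u, hu⟩ := G.exists_limitAt H (hvanish l hl w hw)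
  obtain ⟨v, hv⟩ := G.exists_limitAt H (hvanish (-l) hl' (-w) (hneg w hw))
  have hlt := side_limits_of_basis H hpe hw hbasis hn hu hv
  obtain ⟨e₀⟩ := G.nonempty
  obtain ⟨k, hk1, hk2⟩ := ((hu e₀).and (hv e₀)).exists
  have h1 := h01 .white (k • w +ᵥ e₀)
  have h2 := h01 .white (k • -w +ᵥ e₀)
  rw [hk1] at h1
  rw [hk2] at h2
  -- Both limits are `0` or `1`, and `v < u`.
  obtain rfl : u = 1 := by omega
  obtain rfl : v = 0 := by omega
  exact ⟨G.limitAt_congr H (G.startSum_lineIndicator_ne_zero_cone hl hw hz) hu,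
    G.limitAt_congr H (G.startSum_lineIndicator_ne_zero_cone hl' (hneg w hw) (hneg z hz)) hv⟩

theorem limitAt_side_right {G : PeriodicPlaneGraph E} (hG : G.IsMinimal) {t : G.TrainTrack}
    {h : VertexColor → E → ℤ} (H : G.IsPotential (BipartiteMap.startSum (G.lineIndicator t)) h)
    (h01 : ∀ c e, h c e = 0 ∨ h c e = 1) {z : ℤ × ℤ}
    (hz : latticeDet (G.homologyClass t) z < 0) : LimitAt h z 0 := by
  have := (limitAt_side hG H h01 (z := -z) (by rw [latticeDet_neg_right]; linarith)).2
  rwa [neg_neg] at this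

theorem intersect_symm {t t' : G.TrainTrack} (h : G.Intersect t t') : G.Intersect t' t := by
  obtain ⟨e, c, h1, h2⟩ := h
  exact ⟨e, c.other, h2, by rw [c.other_other]; exact h1⟩

/-- Train-tracks that are neither parallel nor anti-parallel intersect. -/
theorem intersect_of_latticeDet_ne_zero {G : PeriodicPlaneGraph E} (hG : G.IsMinimal)
    {t t' : G.TrainTrack} (hdet : latticeDet (G.homologyClass t) (G.homologyClass t') ≠ 0) :
    G.Intersect t t' := by
  by_contra hcon
  obtain ⟨h, H, h01, -⟩ := exists_sidePotential hG t
  obtain ⟨s, rfl⟩ : ∃ s, G.track s = t' := ⟨Quotient.out t', Quotient.out_eq t'⟩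
  have hω : ∀ σ, G.track σ = G.track s →
      BipartiteMap.startSum (G.lineIndicator t) σ.1 = 0 := by
    intro σ hσ
    by_contra hne
    obtain ⟨c, hc⟩ := G.startSum_lineIndicator_ne_zero hne
    rcases VertexColor.eq_or_eq_other σ.2 c with rfl | rfl
    · refine hdet ?_
      rw [← hc, ← hσ, latticeDet_self]
    · exact hcon ⟨σ.1, σ.2.other, hc.symm, by rw [σ.2.other_other]; exact hσ.symm⟩
  -- Without crossings, `t'` stays on one side of `t`, whereas its two ends lie at infinity on
  -- opposite sides.
  have hconst : ∀ (n : ℕ) σ, G.track σ = G.track s →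
      strandValue h (G.step^[n] σ) = strandValue h σ := by
    intro n σ hσ
    rw [G.strandValue_iterate H, Finset.sum_eq_zero, add_zero]
    intro j _
    rw [hω _ (by rw [track_iterate, hσ]), mul_zero]
  have htr : ∀ k : ℕ, strandValue h (translate (k • G.strandClass s) s) = strandValue h s := by
    intro k
    rw [← iterate_mul_strandPeriod, hconst _ _ rfl]
  have htr' : ∀ k : ℕ, strandValue h (translate (k • -G.strandClass s) s) = strandValue h s := by
    intro k
    have h1 : G.step^[k * G.strandPeriod s] (translate (k • -G.strandClass s) s) = s := by
      rw [iterate_step_translate, iterate_mul_strandPeriod, translate_translate,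
        ← smul_add, neg_add_cancel, smul_zero, translate_zero]
    have h2 : G.track (translate (k • -G.strandClass s) s) = G.track s := by
      rw [← G.track_iterate (k * G.strandPeriod s), h1]
    rw [← hconst (k * G.strandPeriod s) _ h2, h1]
  have hwhite : ∀ z, strandValue h (translate z s) = h .white (z +ᵥ s.1) ∨
      BipartiteMap.startSum (G.lineIndicator t) (z +ᵥ s.1) ≠ 0 := by
    intro z
    by_cases h0 : BipartiteMap.startSum (G.lineIndicator t) (z +ᵥ s.1) = 0
    · left
      simp only [strandValue, translate]
      cases s.2 with
      | white => rfl
      | black => rw [H.black_eq, h0, sub_zero]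
    · exact .inr h0
  have hw0 : ∀ k : ℕ, h .white (k • G.strandClass s +ᵥ s.1) = strandValue h s := by
    intro k
    rcases hwhite (k • G.strandClass s) with h1 | h1
    · rw [← h1, htr]
    · exact absurd (hω (translate (k • G.strandClass s) s) (by
        rw [← iterate_mul_strandPeriod, track_iterate])) h1
  have hw1 : ∀ k : ℕ, h .white (k • -G.strandClass s +ᵥ s.1) = strandValue h s := by
    intro k
    rcases hwhite (k • -G.strandClass s) with h1 | h1
    · rw [← h1, htr']
    · refine absurd (hω (translate (k • -G.strandClass s) s) ?_) h1
      rw [← G.track_iterate (k * G.strandPeriod s), iterate_step_translate,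
        iterate_mul_strandPeriod, translate_translate, ← smul_add, neg_add_cancel, smul_zero,
        translate_zero]
  rw [homologyClass_track] at hdet
  rcases lt_or_gt_of_ne hdet with hneg | hpos
  · have h1 := limitAt_side hG H h01 (z := -G.strandClass s) (by
      rw [latticeDet_neg_right]; linarith)
    rw [neg_neg] at h1
    obtain ⟨k, hk1, hk2⟩ := ((h1.1 s.1).and (h1.2 s.1)).exists
    rw [hw1] at hk1
    rw [hw0] at hk2
    omega
  · have h1 := limitAt_side hG H h01 hpos
    obtain ⟨k, hk1, hk2⟩ := ((h1.1 s.1).and (h1.2 s.1)).exists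
    rw [hw0] at hk1
    rw [hw1] at hk2
    omega

end PeriodicPlaneGraph

/-! ### Sectors -/

namespace PeriodicPlaneGraph

variable {E : Type*} [AddAction (ℤ × ℤ) E] (G : PeriodicPlaneGraph E)

theorem rayIndicator_of_not {s σ : E × VertexColor} (h : ¬ ∃ n : ℕ, G.step^[n + 1] s = σ) :
    G.rayIndicator s σ = 0 := if_neg h

theorem rayIndicator_iterate (s : E × VertexColor) (n : ℕ) :
    G.rayIndicator s (G.step^[n + 1] s) = 1 := if_pos ⟨n, rfl⟩

theorem rayIndicator_of_track_ne {s σ : E × VertexColor} (h : G.track σ ≠ G.track s) :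
    G.rayIndicator s σ = 0 :=
  if_neg fun ⟨n, hn⟩ => h (by rw [← hn, track_iterate])

open Classical in
theorem rayIndicator_apply_step {G : PeriodicPlaneGraph E} (hG : G.IsMinimal)
    (s σ : E × VertexColor) :
    G.rayIndicator s (G.step σ) = G.rayIndicator s σ + if σ = s then 1 else 0 := by
  have hself : ¬ ∃ n : ℕ, G.step^[n + 1] s = s := fun ⟨n, hn⟩ =>
    strandClass_ne_zero hG s (G.strandClass_eq_zero_of_iterate (Nat.succ_pos n) hn)
  by_cases hσ : σ = s
  · subst hσ
    rw [G.rayIndicator_of_not hself, if_pos rfl]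
    exact G.rayIndicator_iterate σ 0
  · rw [if_neg hσ, add_zero, rayIndicator, rayIndicator]
    congr 1
    rw [eq_iff_iff]
    constructor
    · rintro ⟨n, hn⟩
      rw [Function.iterate_succ_apply'] at hn
      have := G.step.injective hn
      rcases n with _ | n
      · exact absurd this.symm hσ
      · exact ⟨n, this⟩
    · rintro ⟨n, rfl⟩
      exact ⟨n + 1, by rw [Function.iterate_succ_apply' _ (n + 1)]⟩

open Classical in
theorem rayIndicator_step_apply {G : PeriodicPlaneGraph E} (hG : G.IsMinimal)
    (s σ : E × VertexColor) :
    G.rayIndicator s σ = G.rayIndicator (G.step s) σ + if σ = G.step s then 1 else 0 := by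
  have hself : ¬ ∃ n : ℕ, G.step^[n + 1] (G.step s) = G.step s := fun ⟨n, hn⟩ =>
    strandClass_ne_zero hG _ (G.strandClass_eq_zero_of_iterate (Nat.succ_pos n) hn)
  by_cases hσ : σ = G.step s
  · subst hσ
    rw [G.rayIndicator_of_not hself, if_pos rfl]
    exact G.rayIndicator_iterate s 0
  · rw [if_neg hσ, add_zero, rayIndicator, rayIndicator]
    congr 1
    rw [eq_iff_iff]
    constructor
    · rintro ⟨n, rfl⟩
      rcases n with _ | n
      · exact absurd rfl hσ
      · exact ⟨n, rfl⟩
    · rintro ⟨n, rfl⟩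
      exact ⟨n + 1, rfl⟩

/-- The strands at the boundary of the sector that the two train-tracks crossing at `e` enter when
they leave `e`, counted positively on the right and negatively on the left. -/
noncomputable def sectorBoundary (e : E) (σ : E × VertexColor) : ℤ :=
  G.rayIndicator (e, .black) σ - G.rayIndicator (e, .white) σ

theorem rayIndicator_eq_zero_of_track_eq_other {G : PeriodicPlaneGraph E} (hG : G.IsMinimal)
    {s σ : E × VertexColor} (hσ : G.track σ = G.track s) :
    G.rayIndicator s (σ.1, σ.2.other) = 0 :=
  G.rayIndicator_of_track_ne fun h => track_ne_track_other hG σ.1 σ.2 (hσ.trans h.symm)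

/-- Two train-tracks do not cross again in their future. -/
theorem rayIndicator_other_eq_zero {G : PeriodicPlaneGraph E} (hG : G.IsMinimal) (e : E)
    (c : VertexColor) (n : ℕ) (d : VertexColor) :
    G.rayIndicator (e, c.other) ((G.step^[n + 1] (e, c)).1, d) = 0 := by
  set σ := G.step^[n + 1] (e, c) with hσ
  have hσt : G.track σ = G.track (e, c) := G.track_iterate _ _
  rcases VertexColor.eq_or_eq_other σ.2 d with rfl | rfl
  · exact G.rayIndicator_of_track_ne fun h => track_ne_track_other hG e c (hσt.symm.trans h)
  · refine G.rayIndicator_of_not ?_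
    rintro ⟨m, hm⟩
    refine not_parallel_bigon hG (x := e) (y := σ.1) ?_ hσ.symm hm
    intro he
    rcases VertexColor.eq_or_eq_other c σ.2 with h | h
    · have h1 : G.step^[n + 1] (e, c) = (e, c) := hσ.symm.trans (Prod.ext he.symm h)
      exact strandClass_ne_zero hG _ (G.strandClass_eq_zero_of_iterate (Nat.succ_pos n) h1)
    · have h1 : σ = (e, c.other) := Prod.ext he.symm h
      rw [h1] at hσt
      exact track_ne_track_other hG e c hσt.symm

theorem startSum_sectorBoundary_left {G : PeriodicPlaneGraph E} (hG : G.IsMinimal) (e : E)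
    (n : ℕ) : BipartiteMap.startSum (G.sectorBoundary e) (G.step^[n + 1] (e, .white)).1 = -1 := by
  set σ := G.step^[n + 1] (e, .white) with hσ
  have h1 := rayIndicator_other_eq_zero hG e .white n .white
  have h2 := rayIndicator_other_eq_zero hG e .white n .black
  have h3 : G.rayIndicator (e, .white) σ = 1 := G.rayIndicator_iterate _ n
  have h4 : G.rayIndicator (e, .white) (σ.1, σ.2.other) = 0 :=
    rayIndicator_eq_zero_of_track_eq_other hG (G.track_iterate _ _)
  rw [← hσ] at h1 h2
  simp only [VertexColor.other] at h1 h2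
  rw [BipartiteMap.startSum, sectorBoundary, sectorBoundary, h1, h2]
  rcases hc : σ with ⟨g, _ | _⟩ <;> rw [hc] at h3 h4 <;> simp only [VertexColor.other] at h4 <;>
    simp [h3, h4]

theorem startSum_sectorBoundary_right {G : PeriodicPlaneGraph E} (hG : G.IsMinimal) (e : E)
    (n : ℕ) : BipartiteMap.startSum (G.sectorBoundary e) (G.step^[n + 1] (e, .black)).1 = 1 := by
  set σ := G.step^[n + 1] (e, .black) with hσ
  have h1 := rayIndicator_other_eq_zero hG e .black n .white
  have h2 := rayIndicator_other_eq_zero hG e .black n .black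
  have h3 : G.rayIndicator (e, .black) σ = 1 := G.rayIndicator_iterate _ n
  have h4 : G.rayIndicator (e, .black) (σ.1, σ.2.other) = 0 :=
    rayIndicator_eq_zero_of_track_eq_other hG (G.track_iterate _ _)
  rw [← hσ] at h1 h2
  simp only [VertexColor.other] at h1 h2
  rw [BipartiteMap.startSum, sectorBoundary, sectorBoundary, h1, h2]
  rcases hc : σ with ⟨g, _ | _⟩ <;> rw [hc] at h3 h4 <;> simp only [VertexColor.other] at h4 <;>
    simp [h3, h4]

theorem startSum_sectorBoundary_self {G : PeriodicPlaneGraph E} (hG : G.IsMinimal) (e : E) :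
    BipartiteMap.startSum (G.sectorBoundary e) e = 0 := by
  have key : ∀ c d : VertexColor, G.rayIndicator (e, c) (e, d) = 0 := by
    intro c d
    rcases VertexColor.eq_or_eq_other c d with rfl | rfl
    · exact G.rayIndicator_of_not fun ⟨n, hn⟩ =>
        strandClass_ne_zero hG _ (G.strandClass_eq_zero_of_iterate (Nat.succ_pos n) hn)
    · exact rayIndicator_eq_zero_of_track_eq_other hG (σ := (e, c)) rfl
  simp [BipartiteMap.startSum, sectorBoundary, key]

/-- The indicator function of the vertices in the sector of `e`. -/
theorem exists_sectorPotential {G : PeriodicPlaneGraph E} (hG : G.IsMinimal) (e : E) :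
    ∃ h, G.IsPotential (BipartiteMap.startSum (G.sectorBoundary e)) h ∧
      (∀ c e', h c e' = 0 ∨ h c e' = 1) ∧ ∀ c, h c e = 0 := by
  classical
  -- Both rays begin in the face on the left of `e`, with opposite signs, so the flow is conserved
  -- there.
  obtain ⟨h₀, H₀⟩ := G.exists_potential_startSum (G.sectorBoundary e) fun e' => by
    simp only [sectorBoundary, rayIndicator_apply_step hG]
    by_cases he : e' = e
    · simp [he]; ring
    · simp [he]
  have H := H₀.add_const (-h₀ .white e)
  set h : VertexColor → E → ℤ := fun c e' => h₀ c e' + -h₀ .white e with hh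
  have hw : h .white e = 0 := by simp [hh]
  have hb : h .black e = 0 := by rw [H.black_eq, hw, startSum_sectorBoundary_self hG, sub_zero]
  -- The ray starting with `(e, .white)` bounds the sector on the left: the white ends of its edges
  -- are outside and the black ends inside. The other ray behaves in the opposite way.
  have hA : ∀ n : ℕ, h .white (G.step^[n + 1] (e, .white)).1 = 0 ∧
      h .black (G.step^[n + 1] (e, .white)).1 = 1 := by
    intro n
    suffices h1 : h .white (G.step^[n + 1] (e, .white)).1 = 0 by
      refine ⟨h1, ?_⟩
      rw [H.black_eq, h1, startSum_sectorBoundary_left hG]; norm_num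
    induction n with
    | zero => exact (H.rot _ _).trans hw
    | succ n ih =>
      have h1 := startSum_sectorBoundary_left hG e n
      have h2 := startSum_sectorBoundary_left hG e (n + 1)
      rw [Function.iterate_succ_apply' _ (n + 1)] at h2 ⊢
      rcases hσ : G.step^[n + 1] (e, .white) with ⟨g, _ | _⟩
      · rw [hσ] at ih
        exact (H.rot _ _).trans ih
      · rw [hσ] at ih h1 h2
        rw [BipartiteMap.step_black] at h2 ⊢
        simp only at ih h1 h2 ⊢
        rw [H.white_eq, h2, H.rot_symm, H.black_eq, h1, ih]; norm_num
  have hB : ∀ n : ℕ, h .white (G.step^[n + 1] (e, .black)).1 = 1 ∧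
      h .black (G.step^[n + 1] (e, .black)).1 = 0 := by
    intro n
    suffices h1 : h .black (G.step^[n + 1] (e, .black)).1 = 0 by
      refine ⟨?_, h1⟩
      rw [H.white_eq, h1, startSum_sectorBoundary_right hG]; norm_num
    induction n with
    | zero => exact (H.rot_symm _ _).trans hb
    | succ n ih =>
      have h1 := startSum_sectorBoundary_right hG e n
      have h2 := startSum_sectorBoundary_right hG e (n + 1)
      rw [Function.iterate_succ_apply' _ (n + 1)] at h2 ⊢
      rcases hσ : G.step^[n + 1] (e, .black) with ⟨g, _ | _⟩
      · rw [hσ] at ih h1 h2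
        rw [BipartiteMap.step_white] at h2 ⊢
        simp only at ih h1 h2 ⊢
        rw [H.black_eq, h2, H.rot, H.white_eq, h1, ih]; norm_num
      · rw [hσ] at ih
        exact (H.rot_symm _ _).trans ih
  refine ⟨h, H, fun c e' => ?_, by rintro (_ | _); exacts [hw, hb]⟩
  have := G.potential_mem H (V := {0, 1}) (fun g hg => ?_) (c₀ := .white) (e₀ := e)
    (by simp [hw]) c e'
  · simpa using this
  · have : ∃ (c d : VertexColor), G.rayIndicator (e, c) (g, d) ≠ 0 := by
      by_contra! hcon
      exact hg (by simp [BipartiteMap.startSum, sectorBoundary, hcon])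
    obtain ⟨c, d, hcd⟩ := this
    obtain ⟨n, hn⟩ : ∃ n : ℕ, G.step^[n + 1] (e, c) = (g, d) := by
      by_contra hcon
      exact hcd (if_neg hcon)
    cases c with
    | white => have := hA n; rw [hn] at this; simp [this.1, this.2]
    | black => have := hB n; rw [hn] at this; simp [this.1, this.2]

/-! ### Sectors at infinity -/

/-- The form `latticeDetHom (z - z')` is positive on the cone from `z` to `z'`. According to its
sign at the class of `s`, either the past of `s` leaves the cone and the ray looks like its
train-track (`ε = 1`), or the future leaves it and the ray is invisible (`ε = 0`). The last equation
says that going from `z` to `z'` one crosses the ray exactly if its direction lies between them. -/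
theorem rayIndicator_cone (s : E × VertexColor) {z z' : ℤ × ℤ} (hzz : 0 < latticeDet z z')
    (hz : latticeDet z (G.strandClass s) ≠ 0) (hz' : latticeDet (G.strandClass s) z' ≠ 0) :
    ∃ ε : ℤ, (∀ e, ∀ᶠ k : ℕ in atTop, ∀ a b : ℕ, a + b = k →
        BipartiteMap.startSum (G.rayIndicator s) ((a • z + b • z') +ᵥ e) =
          ε * BipartiteMap.startSum (G.lineIndicator (G.track s)) ((a • z + b • z') +ᵥ e)) ∧
      ε * ((if 0 < latticeDet (G.strandClass s) z' then 1 else 0) -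
          if 0 < latticeDet (G.strandClass s) z then 1 else 0) =
        if 0 < latticeDet z (G.strandClass s) ∧ 0 < latticeDet (G.strandClass s) z' then 1
          else 0 := by
  set p := G.strandClass s
  have hlz : 0 < latticeDetHom (z - z') z := by
    rw [latticeDetHom_apply, latticeDet_sub_left, latticeDet_self, latticeDet_swap z' z]; linarith
  have hlz' : 0 < latticeDetHom (z - z') z' := by
    rw [latticeDetHom_apply, latticeDet_sub_left, latticeDet_self]; linarith
  have hlp : latticeDetHom (z - z') p = latticeDet z p + latticeDet p z' := by
    rw [latticeDetHom_apply, latticeDet_sub_left, latticeDet_swap z' p]; ring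
  rcases le_or_gt 0 (latticeDetHom (z - z') p) with h | h
  · refine ⟨1, fun e => ?_, ?_⟩
    · have h1 := fun c => eventually_not_mem_cone (latticeDetHom (z - z'))
        (G.exists_ray_line_bound s (e, c) _ h) hlz hlz'
      filter_upwards [h1 .white, h1 .black] with k hk1 hk2 a b hab
      have h2 := not_not.1 (hk1 a b hab)
      have h3 := not_not.1 (hk2 a b hab)
      rw [one_mul]
      exact congrArg₂ (· + ·) h2 h3
    · rw [hlp] at h
      have h4 := latticeDet_swap p z
      split_ifs <;> omega
  · refine ⟨0, fun e => ?_, ?_⟩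
    · have h1 := fun c => eventually_not_mem_cone (latticeDetHom (z - z'))
        (G.exists_ray_bound s (e, c) _ h.le) hlz hlz'
      filter_upwards [h1 .white, h1 .black] with k hk1 hk2 a b hab
      have h2 := not_not.1 (hk1 a b hab)
      have h3 := not_not.1 (hk2 a b hab)
      rw [zero_mul]
      exact (congrArg₂ (· + ·) h2 h3).trans (add_zero 0)
    · rw [hlp] at h
      split_ifs <;> omega

theorem limitAt_side_ite {G : PeriodicPlaneGraph E} (hG : G.IsMinimal) {t : G.TrainTrack}
    {h : VertexColor → E → ℤ} (H : G.IsPotential (BipartiteMap.startSum (G.lineIndicator t)) h)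
    (h01 : ∀ c e, h c e = 0 ∨ h c e = 1) {z : ℤ × ℤ}
    (hz : latticeDet (G.homologyClass t) z ≠ 0) :
    LimitAt h z (if 0 < latticeDet (G.homologyClass t) z then 1 else 0) := by
  split_ifs with hpos
  · exact (limitAt_side hG H h01 hpos).1
  · exact limitAt_side_right hG H h01 (lt_of_le_of_ne (not_lt.1 hpos) hz)

/-- In the cone each ray may be replaced by `ε` times its train-track. The potential corrected by
the side potentials then has no increments far out, so its limits at `z` and `z'` agree. -/
theorem sector_limit_sub {G : PeriodicPlaneGraph E} (hG : G.IsMinimal) {s₁ s₂ : E × VertexColor}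
    {h : VertexColor → E → ℤ}
    (H : G.IsPotential (fun e => BipartiteMap.startSum (G.rayIndicator s₂) e -
      BipartiteMap.startSum (G.rayIndicator s₁) e) h) {z z' : ℤ × ℤ} (hzz : 0 < latticeDet z z')
    (h1 : latticeDet z (G.strandClass s₁) ≠ 0) (h1' : latticeDet (G.strandClass s₁) z' ≠ 0)
    (h2 : latticeDet z (G.strandClass s₂) ≠ 0) (h2' : latticeDet (G.strandClass s₂) z' ≠ 0)
    {v v' : ℤ} (hv : LimitAt h z v) (hv' : LimitAt h z' v') :
    v' - v = (if 0 < latticeDet z (G.strandClass s₂) ∧ 0 < latticeDet (G.strandClass s₂) z'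
        then 1 else 0) -
      if 0 < latticeDet z (G.strandClass s₁) ∧ 0 < latticeDet (G.strandClass s₁) z'
        then 1 else 0 := by
  obtain ⟨ε₁, hε₁, he₁⟩ := G.rayIndicator_cone s₁ hzz h1 h1'
  obtain ⟨ε₂, hε₂, he₂⟩ := G.rayIndicator_cone s₂ hzz h2 h2'
  obtain ⟨f₁, F₁, f₁01, -⟩ := exists_sidePotential hG (G.track s₁)
  obtain ⟨f₂, F₂, f₂01, -⟩ := exists_sidePotential hG (G.track s₂)
  have hne : ∀ p w : ℤ × ℤ, latticeDet w p ≠ 0 → latticeDet p w ≠ 0 := fun p w hw => by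
    rw [latticeDet_swap]; simpa using hw
  have l1 := limitAt_side_ite hG F₁ f₁01 (z := z) (by
    rw [homologyClass_track]; exact hne _ _ h1)
  have l1' := limitAt_side_ite hG F₁ f₁01 (z := z') (by rw [homologyClass_track]; exact h1')
  have l2 := limitAt_side_ite hG F₂ f₂01 (z := z) (by
    rw [homologyClass_track]; exact hne _ _ h2)
  have l2' := limitAt_side_ite hG F₂ f₂01 (z := z') (by rw [homologyClass_track]; exact h2')
  rw [homologyClass_track] at l1 l1' l2 l2'
  have K := (H.add (F₁.zsmul ε₁)).diff (F₂.zsmul ε₂)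
  obtain ⟨e₀⟩ := G.nonempty
  have hcone := G.eventually_eq_of_cone K (z := z) (z' := z') (fun e => by
    filter_upwards [hε₁ e, hε₂ e] with k hk1 hk2 a b hab
    rw [hk1 a b hab, hk2 a b hab, smul_eq_mul, smul_eq_mul]
    ring) e₀
  obtain ⟨k, hk, a1, a2, a3, a4, a5, a6⟩ := (hcone.and ((hv e₀).and ((hv' e₀).and ((l1 e₀).and
    ((l1' e₀).and ((l2 e₀).and (l2' e₀))))))).exists
  rw [a1, a2, a3, a4, a5, a6, smul_eq_mul, smul_eq_mul, smul_eq_mul, smul_eq_mul] at hk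
  rw [← he₁, ← he₂, mul_sub, mul_sub]
  linarith

theorem exists_sector_limit (s₁ s₂ : E × VertexColor) {h : VertexColor → E → ℤ}
    (H : G.IsPotential (fun e => BipartiteMap.startSum (G.rayIndicator s₂) e -
      BipartiteMap.startSum (G.rayIndicator s₁) e) h) {z : ℤ × ℤ}
    (h1 : latticeDet (G.strandClass s₁) z ≠ 0) (h2 : latticeDet (G.strandClass s₂) z ≠ 0) :
    ∃ v, LimitAt h z v := by
  have key : ∀ s, latticeDet (G.strandClass s) z ≠ 0 → ∀ σ : E × VertexColor,
      ∀ᶠ k : ℕ in atTop, G.rayIndicator s (translate (k • z) σ) = 0 := by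
    intro s hs σ
    rcases lt_or_gt_of_ne hs with hneg | hpos
    · filter_upwards [eventually_not_mem_ray (-latticeDetHom (G.strandClass s)) (z := z)
        (G.exists_ray_bound s σ _ (by
          rw [AddMonoidHom.neg_apply, latticeDetHom_apply, latticeDet_self, neg_zero]))
        (by rw [AddMonoidHom.neg_apply, latticeDetHom_apply]; linarith)] with k hk
      exact not_not.1 hk
    · filter_upwards [eventually_not_mem_ray (latticeDetHom (G.strandClass s)) (z := z)
        (G.exists_ray_bound s σ _ (by rw [latticeDetHom_apply, latticeDet_self])) hpos] with k hk
      exact not_not.1 hk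
  refine G.exists_limitAt H fun e => ?_
  filter_upwards [key s₁ h1 (e, .white), key s₁ h1 (e, .black), key s₂ h2 (e, .white),
    key s₂ h2 (e, .black)] with k a1 a2 a3 a4
  have b1 : BipartiteMap.startSum (G.rayIndicator s₁) (k • z +ᵥ e) = 0 :=
    (congrArg₂ (· + ·) a1 a2).trans (add_zero 0)
  have b2 : BipartiteMap.startSum (G.rayIndicator s₂) (k • z +ᵥ e) = 0 :=
    (congrArg₂ (· + ·) a3 a4).trans (add_zero 0)
  rw [b1, b2, sub_zero]

theorem latticeDet_nsmul_sub_right (N : ℕ) (p q z : ℤ × ℤ) :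
    latticeDet q (N • p - z) = N * latticeDet q p - latticeDet q z := by
  simp [latticeDet]; ring

theorem latticeDet_nsmul_sub_left (N : ℕ) (p q z : ℤ × ℤ) :
    latticeDet (N • p - z) q = N * latticeDet p q - latticeDet z q := by
  simp [latticeDet]; ring

/-- The direction `z` is compared with one just outside the sector. Exactly one boundary ray lies
between them, so the limits differ by `1`; being `0` or `1`, they are then determined. -/
theorem sector_limit_eq_one {G : PeriodicPlaneGraph E} (hG : G.IsMinimal)
    {s₁ s₂ : E × VertexColor} {h : VertexColor → E → ℤ}
    (H : G.IsPotential (fun e => BipartiteMap.startSum (G.rayIndicator s₂) e -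
      BipartiteMap.startSum (G.rayIndicator s₁) e) h)
    (h01 : ∀ c e, h c e = 0 ∨ h c e = 1) {z : ℤ × ℤ}
    (h1 : latticeDet (G.strandClass s₁) z ≠ 0) (h2 : latticeDet (G.strandClass s₂) z ≠ 0)
    (horder : directionOrder (G.strandClass s₂) z (G.strandClass s₁)) : LimitAt h z 1 := by
  obtain ⟨e₀⟩ := G.nonempty
  have hval : ∀ {w v}, LimitAt h w v → v = 0 ∨ v = 1 := by
    intro w v hv
    obtain ⟨k, hk⟩ := (hv e₀).exists
    rw [← hk]
    exact h01 _ _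
  set p := G.strandClass s₁ with hp
  set q := G.strandClass s₂ with hq
  obtain ⟨v, hv⟩ := G.exists_sector_limit s₁ s₂ H h1 h2
  have hzp := latticeDet_swap p z
  have hzq := latticeDet_swap q z
  have hpq := latticeDet_swap p q
  suffices v = 1 by rwa [this] at hv
  rcases lt_or_gt_of_ne h1 with hneg | hpos
  -- Here `z` is on the right of `p`. The vector `N • p - z` lies beyond `p`, and `N` is large
  -- enough, given the cyclic order, for `q` not to be crossed as well.
  · set N := (latticeDet z q).natAbs + 1 with hN
    have e1 := latticeDet_nsmul_sub_right N p z z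
    have e2 := latticeDet_nsmul_sub_right N p p z
    have e3 := latticeDet_nsmul_sub_right N p q z
    rw [latticeDet_self] at e1 e2
    have hNdet : (N : ℤ) ≤ N * latticeDet z p := le_mul_of_one_le_right (by positivity) (by omega)
    have h3 : latticeDet q (N • p - z) ≠ 0 ∧
        ¬ (0 < latticeDet z q ∧ 0 < latticeDet q (N • p - z)) := by
      rw [e3]
      rcases lt_trichotomy (latticeDet q p) 0 with h | h | h
      · have : (N : ℤ) * latticeDet q p ≤ N * (-1) :=
          mul_le_mul_of_nonneg_left (by omega) (by positivity)
        omega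
      · rw [h, mul_zero]
        rcases horder with h' | h' | h' <;> omega
      · have : (N : ℤ) * 1 ≤ N * latticeDet q p :=
          mul_le_mul_of_nonneg_left (by omega) (by positivity)
        rcases horder with h' | h' | h' <;> omega
    obtain ⟨v', hv'⟩ := G.exists_sector_limit s₁ s₂ H (z := N • p - z) (by rw [← hp]; omega)
      (by rw [← hq]; exact h3.1)
    have h4 := sector_limit_sub hG H (z := z) (z' := N • p - z) (by omega) (by rw [← hp]; omega)
      (by rw [← hp]; omega) (by rw [← hq]; omega) (by rw [← hq]; exact h3.1) hv hv'
    rw [← hp, ← hq, if_neg h3.2, if_pos (by omega)] at h4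
    rcases hval hv with h | h <;> rcases hval hv' with h' | h' <;> omega
  · have horder' : 0 < latticeDet p q ∧ 0 < latticeDet q z := by
      rcases horder with h' | h' | h' <;> omega
    -- Now `z` is on the left of `q`, and `N • q - z` lies before `q`, close enough to it for `p`
    -- not to be crossed.
    set N := (latticeDet z p).natAbs + 1 with hN
    have e1 := latticeDet_nsmul_sub_left N q z z
    have e2 := latticeDet_nsmul_sub_left N q p z
    have e3 := latticeDet_nsmul_sub_left N q q z
    rw [latticeDet_self] at e1 e3
    have hNdet : (N : ℤ) ≤ N * latticeDet q z := le_mul_of_one_le_right (by positivity) (by omega)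
    have hNdet' : (N : ℤ) * latticeDet q p ≤ N * (-1) :=
      mul_le_mul_of_nonneg_left (by omega) (by positivity)
    have e4 := latticeDet_swap (N • q - z) p
    have e5 := latticeDet_swap (N • q - z) q
    obtain ⟨v', hv'⟩ := G.exists_sector_limit s₁ s₂ H (z := N • q - z) (by rw [← hp]; omega)
      (by rw [← hq]; omega)
    have h4 := sector_limit_sub hG H (z := N • q - z) (z' := z) (by omega) (by rw [← hp]; omega)
      (by rw [← hp]; omega) (by rw [← hq]; omega) (by rw [← hq]; omega) hv' hv
    rw [← hp, ← hq, if_pos (by omega), if_neg (by omega)] at h4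
    rcases hval hv with h | h <;> rcases hval hv' with h' | h' <;> omega

theorem nsmul_eq_nsmul_of_latticeDet {p q z : ℤ × ℤ} (hpq : latticeDet p q = 0)
    (h : (0 < latticeDet p z ∧ 0 < latticeDet q z) ∨ (latticeDet p z < 0 ∧ latticeDet q z < 0)) :
    ∃ a b : ℕ, 0 < a ∧ 0 < b ∧ a • p = b • q := by
  refine ⟨(latticeDet q z).natAbs, (latticeDet p z).natAbs, by omega, by omega, ?_⟩
  rw [← natCast_zsmul, ← natCast_zsmul]
  have key : latticeDet q z • p = latticeDet p z • q := by
    simp only [latticeDet] at hpq ⊢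
    ext
    · simp only [Prod.smul_fst, smul_eq_mul]
      linear_combination (-z.1) * hpq
    · simp only [Prod.smul_snd, smul_eq_mul]
      linear_combination (-z.2) * hpq
  rcases h with h | h
  · rwa [Int.natAbs_of_nonneg h.2.le, Int.natAbs_of_nonneg h.1.le]
  · rw [Int.ofNat_natAbs_of_nonpos h.2.le, Int.ofNat_natAbs_of_nonpos h.1.le, neg_smul, neg_smul,
      key]

/-- The directions of the train-tracks crossing at `e` are met in the order black, `z`, white. -/
def IsDescent (z : ℤ × ℤ) (e : E) : Prop :=
  directionOrder (G.strandClass (e, .black)) z (G.strandClass (e, .white))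

/-- Train-tracks crossing at an edge never have the same direction, so their directions cut the
circle into two arcs, one of which contains `z`. -/
theorem isDescent_or {G : PeriodicPlaneGraph E} (hG : G.IsMinimal) {z : ℤ × ℤ}
    (hz : ∀ s, latticeDet (G.strandClass s) z ≠ 0) (e : E) : G.IsDescent z e ∨
      directionOrder (G.strandClass (e, .white)) z (G.strandClass (e, .black)) := by
  set p := G.strandClass (e, .white) with hp
  set q := G.strandClass (e, .black) with hq
  have h1 : latticeDet p z ≠ 0 := hz _
  have h2 : latticeDet q z ≠ 0 := hz _
  have hpz := latticeDet_swap p z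
  have hqz := latticeDet_swap q z
  have hpq := latticeDet_swap p q
  have h3 : latticeDet p q = 0 → ¬ ((0 < latticeDet p z ∧ 0 < latticeDet q z) ∨
      (latticeDet p z < 0 ∧ latticeDet q z < 0)) := by
    intro h0 h
    obtain ⟨a, b, ha, -, hab⟩ := nsmul_eq_nsmul_of_latticeDet h0 h
    have : b ≠ 0 := by
      rintro rfl
      rw [zero_smul] at hab
      exact strandClass_ne_zero hG _ ((smul_eq_zero.1 hab).resolve_left ha.ne')
    exact not_same_direction_of_cross hG e ha hab
  simp only [IsDescent, directionOrder, ← hp, ← hq]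
  omega

open Classical in
/-- The indicator function of the edges whose two train-tracks are met in the order black, `z`,
white. -/
noncomputable def descent (z : ℤ × ℤ) (e : E) : ℤ := if G.IsDescent z e then 1 else 0

theorem limitAt_sector {G : PeriodicPlaneGraph E} (hG : G.IsMinimal) {z : ℤ × ℤ}
    (hz : ∀ s, latticeDet (G.strandClass s) z ≠ 0) {e : E} {h : VertexColor → E → ℤ}
    (H : G.IsPotential (BipartiteMap.startSum (G.sectorBoundary e)) h)
    (h01 : ∀ c e', h c e' = 0 ∨ h c e' = 1) : LimitAt h z (G.descent z e) := by
  classical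
  have H1 := H.congr (ω' := fun g => BipartiteMap.startSum (G.rayIndicator (e, .black)) g -
      BipartiteMap.startSum (G.rayIndicator (e, .white)) g) fun g => by
    simp only [BipartiteMap.startSum, sectorBoundary]; ring
  -- The complement of the sector is treated as a sector with its two boundary rays exchanged.
  have H2 := (H.neg.add_const 1).congr (ω' := fun g =>
      BipartiteMap.startSum (G.rayIndicator (e, .white)) g -
      BipartiteMap.startSum (G.rayIndicator (e, .black)) g) fun g => by
    simp only [BipartiteMap.startSum, sectorBoundary]; ring
  by_cases hd : G.IsDescent z e
  · rw [descent, if_pos hd]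
    exact sector_limit_eq_one hG H1 h01 (hz _) (hz _) hd
  · rw [descent, if_neg hd]
    have := sector_limit_eq_one hG H2 (fun c e' => by rcases h01 c e' with h | h <;> simp [h])
      (hz _) (hz _) ((isDescent_or hG hz e).resolve_left hd)
    intro e'
    filter_upwards [this e'] with k hk
    linarith

end PeriodicPlaneGraph

/-! ### Descents around vertices and faces -/

namespace PeriodicPlaneGraph

variable {E : Type*} [AddAction (ℤ × ℤ) E] (G : PeriodicPlaneGraph E)

theorem LimitAt.add {h h' : VertexColor → E → ℤ} {z : ℤ × ℤ} {v v' : ℤ} (H : LimitAt h z v)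
    (H' : LimitAt h' z v') : LimitAt (fun c e => h c e + h' c e) z (v + v') := fun e => by
  filter_upwards [H e, H' e] with k h1 h2
  rw [h1, h2]

theorem LimitAt.sum {ι : Type*} (s : Finset ι) {h : ι → VertexColor → E → ℤ} {z : ℤ × ℤ}
    {v : ι → ℤ} (H : ∀ i ∈ s, LimitAt (h i) z (v i)) :
    LimitAt (fun c e => ∑ i ∈ s, h i c e) z (∑ i ∈ s, v i) := fun e => by
  filter_upwards [(eventually_all_finset s).2 fun i hi => H i hi e] with k hk
  exact Finset.sum_congr rfl hk

theorem eventually_vadd_ne (G : PeriodicPlaneGraph E) {z : ℤ × ℤ} (hz : z ≠ 0) (x e : E) :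
    ∀ᶠ k : ℕ in atTop, k • z +ᵥ e ≠ x := by
  by_cases h : ∃ k : ℕ, k • z +ᵥ e = x
  · obtain ⟨k, rfl⟩ := h
    filter_upwards [eventually_gt_atTop k] with n hn h
    have := G.vadd_right_injective h
    have h2 : ((n : ℤ) - k) • z = 0 := by
      rw [sub_smul, natCast_zsmul, natCast_zsmul, this, sub_self]
    rcases smul_eq_zero.1 h2 with h3 | h3
    · omega
    · exact hz h3
  · exact Eventually.of_forall fun k hk => h ⟨k, hk⟩

open Classical in
/-- The indicator function of a cycle of `p`, as a sum. -/
noncomputable def cycleIndicator {S : Type*} (p : Equiv.Perm S) (x y : S) : ℤ :=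
  ∑ j ∈ Finset.range (Function.minimalPeriod p x), if y = p^[j] x then 1 else 0

theorem cycleIndicator_apply {S : Type*} (p : Equiv.Perm S) (x y : S) :
    cycleIndicator p x (p y) = cycleIndicator p x y := by
  classical
  rw [cycleIndicator, ← sum_range_iterate_shift (fun w => if p y = w then (1 : ℤ) else 0) _ x
    Function.iterate_minimalPeriod]
  refine Finset.sum_congr rfl fun j _ => ?_
  rw [Function.iterate_succ_apply', p.injective.eq_iff]

theorem cycleIndicator_self {S : Type*} {p : Equiv.Perm S} {x : S}
    (hx : x ∈ Function.periodicPts p) : cycleIndicator p x x = 1 := by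
  classical
  have hpos := Function.minimalPeriod_pos_of_mem_periodicPts hx
  rw [cycleIndicator, Finset.sum_eq_single_of_mem 0 (Finset.mem_range.2 hpos)]
  · simp
  · intro j hj hj0
    rw [if_neg]
    intro h
    exact hj0 (Function.iterate_injOn_Iio_minimalPeriod (Finset.mem_range.1 hj) hpos h.symm)

theorem ne_zero_of_latticeDet_ne_zero {z : ℤ × ℤ}
    (hz : ∀ s, latticeDet (G.strandClass s) z ≠ 0) : z ≠ 0 := by
  rintro rfl
  obtain ⟨e⟩ := G.nonempty
  exact hz (e, .white) (by simp [latticeDet])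

/-- Exactly one edge is a descent around each vertex. -/
theorem sum_descent_rot {G : PeriodicPlaneGraph E} (hG : G.IsMinimal) {z : ℤ × ℤ}
    (hz : ∀ s, latticeDet (G.strandClass s) z ≠ 0) (c : VertexColor) (e : E) :
    ∑ j ∈ Finset.range (Function.minimalPeriod (G.rot c) e), G.descent z ((G.rot c)^[j] e) = 1 := by
  classical
  choose χ H h01 h0 using fun e => exists_sectorPotential hG e
  have hper : (G.rot c)^[Function.minimalPeriod (G.rot c) e] e = e :=
    Function.iterate_minimalPeriod
  have hN : cycleIndicator (G.rot c) e e = 1 := cycleIndicator_self (G.finite_degree c e)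
  have HF := BipartiteMap.IsPotential.sum (Finset.range (Function.minimalPeriod (G.rot c) e))
    fun j _ => H ((G.rot c)^[j] e)
  have L := LimitAt.sum (Finset.range (Function.minimalPeriod (G.rot c) e))
    fun j _ => limitAt_sector hG hz (H ((G.rot c)^[j] e)) (h01 _)
  have hF0 : ∑ j ∈ Finset.range (Function.minimalPeriod (G.rot c) e),
      χ ((G.rot c)^[j] e) c e = 0 := by
    refine Finset.sum_eq_zero fun j _ => ?_
    rw [← (H _).iterate_rot c e j, h0]
  cases c with
  | white =>
    set p := G.rot .white
    -- The left boundary of one sector is, up to its first strand, the right boundary of the sector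
    -- at the next edge. In the sum only the strands starting at edges of the vertex survive, so the
    -- sectors cover everything once, except the vertex itself.
    have K : G.IsPotential (fun g => ∑ j ∈ Finset.range (Function.minimalPeriod p e),
        BipartiteMap.startSum (G.sectorBoundary (p^[j] e)) g)
        (fun c g => match c with
          | .white => 1 - cycleIndicator p e g
          | .black => 1) := by
      refine ⟨?_, fun g => ?_⟩
      · rintro (_ | _) g
        · show 1 - _ = 1 - _
          rw [cycleIndicator_apply]
        · rfl
      · show 1 - cycleIndicator p e g - 1 = _
        have h1 : ∀ σ, ∑ j ∈ Finset.range (Function.minimalPeriod p e),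
            G.sectorBoundary (p^[j] e) σ = -∑ j ∈ Finset.range (Function.minimalPeriod p e),
              if σ = (p^[j] e, VertexColor.black) then 1 else 0 := by
          intro σ
          rw [← sum_range_iterate_shift
            (fun w => if σ = (w, VertexColor.black) then (1 : ℤ) else 0) _ e hper]
          have h2 := sum_range_telescope_cycle (U := fun w => -G.rayIndicator (w, .black) σ) _ e hper
          rw [← sub_eq_zero, ← Finset.sum_neg_distrib, ← Finset.sum_sub_distrib]
          refine (Finset.sum_congr rfl fun j _ => ?_).trans h2
          rw [sectorBoundary, rayIndicator_step_apply hG (p^[j] e, .white),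
            Function.iterate_succ_apply', show G.step (p^[j] e, .white) = (p (p^[j] e), .black) from rfl]
          ring
        simp only [BipartiteMap.startSum]
        rw [Finset.sum_add_distrib, h1, h1]
        simp [cycleIndicator]
    have heq : ∀ g, ∑ j ∈ Finset.range (Function.minimalPeriod p e), χ (p^[j] e) .white g =
        1 - cycleIndicator p e g := by
      intro g
      have := G.potential_unique HF K .white .white g e
      simp only [hF0, hN] at this
      linarith
    refine LimitAt.unique e L fun g => ?_
    have : ∀ᶠ k : ℕ in atTop, ∀ j ∈ Finset.range (Function.minimalPeriod p e),
        k • z +ᵥ g ≠ p^[j] e :=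
      (eventually_all_finset _).2 fun j _ =>
        G.eventually_vadd_ne (G.ne_zero_of_latticeDet_ne_zero hz) _ _
    filter_upwards [this] with k hk
    rw [heq, cycleIndicator, Finset.sum_eq_zero fun j hj => if_neg (hk j hj), sub_zero]
  | black =>
    set p := G.rot .black with hp
    have K : G.IsPotential (fun g => ∑ j ∈ Finset.range (Function.minimalPeriod p e),
        BipartiteMap.startSum (G.sectorBoundary (p^[j] e)) g)
        (fun c g => match c with
          | .white => 1
          | .black => 1 - cycleIndicator p e g) := by
      refine ⟨?_, fun g => ?_⟩
      · rintro (_ | _) g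
        · rfl
        · show 1 - _ = 1 - _
          rw [cycleIndicator_apply]
      · show 1 - (1 - cycleIndicator p e g) = _
        have h1 : ∀ σ, ∑ j ∈ Finset.range (Function.minimalPeriod p e),
            G.sectorBoundary (p^[j] e) σ = ∑ j ∈ Finset.range (Function.minimalPeriod p e),
              if σ = (p^[j] e, VertexColor.white) then 1 else 0 := by
          intro σ
          have h2 := sum_range_telescope_cycle (U := fun w => -G.rayIndicator (w, .black) σ) _ e hper
          rw [← sub_eq_zero, ← Finset.sum_sub_distrib]
          refine (Finset.sum_congr rfl fun j _ => ?_).trans h2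
          rw [sectorBoundary, Function.iterate_succ_apply',
            rayIndicator_step_apply hG (p (p^[j] e), .black), BipartiteMap.step_black,
            Equiv.symm_apply_apply p]
          ring
        simp only [BipartiteMap.startSum]
        rw [Finset.sum_add_distrib, h1, h1]
        simp [cycleIndicator]
    have heq : ∀ g, ∑ j ∈ Finset.range (Function.minimalPeriod p e), χ (p^[j] e) .white g = 1 := by
      intro g
      have := G.potential_unique HF K .white .black g e
      simp only [hF0, hN] at this
      linarith
    exact LimitAt.unique e L fun g => Eventually.of_forall fun k => heq _

theorem black_face {G : PeriodicPlaneGraph E} {a : E × VertexColor → ℤ}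
    {h : VertexColor → E → ℤ} (H : G.IsPotential (BipartiteMap.startSum a) h) (y : E) :
    h .black (G.face y) = h .black y + a (G.step (y, .black)) + a (G.step (G.face y, .white)) -
      a (G.face y, .white) - a (G.face y, .black) := by
  have h1 : h .white (G.face y) = h .white ((G.rot .black).symm y) := by
    rw [BipartiteMap.face_apply, H.rot_symm]
  rw [H.black_eq, h1, H.white_eq, H.rot_symm, BipartiteMap.step_black, BipartiteMap.step_white,
    BipartiteMap.rot_white_face, BipartiteMap.startSum, BipartiteMap.startSum]
  ring

/-- A train-track turns around vertices of one colour in each face. -/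
theorem track_white_ne_track_black_of_face {G : PeriodicPlaneGraph E} (hG : G.IsMinimal) (e : E)
    (n : ℕ) : G.track (e, .white) ≠ G.track (G.face^[n] e, .black) := by
  obtain ⟨h, H, h01, hs⟩ := exists_sidePotential hG (G.track (e, .white))
  intro heq
  set t := G.track (e, .white)
  -- This sum is the side on which the centre of the face lies, as seen from a corner at a black
  -- vertex; it is the same at all corners. A strand around a white vertex has the centre on its
  -- right (`0`), a strand around a black vertex on its left (`1`).
  have key : ∀ n : ℕ, h .black (G.face^[n] e) + G.lineIndicator t (G.face^[n] e, .black) =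
      h .black e + G.lineIndicator t (e, .black) := by
    intro n
    induction n with
    | zero => rfl
    | succ n ih =>
      rw [← ih, Function.iterate_succ_apply', black_face H, lineIndicator_step, lineIndicator_step]
      ring
  have h1 := (hs _ rfl).2
  have h2 := (hs _ heq.symm).2
  have h3 : G.lineIndicator t (e, .black) = 0 := if_neg (track_ne_track_other hG e .white).symm
  have h4 : G.lineIndicator t (G.face^[n] e, .black) = 1 := if_pos heq.symm
  have := key n
  rw [h1, h2, h3, h4] at this
  omega

/-- The number of descents around a face is its number of edges of each kind minus one. -/
theorem sum_descent_face {G : PeriodicPlaneGraph E} (hG : G.IsMinimal) {z : ℤ × ℤ}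
    (hz : ∀ s, latticeDet (G.strandClass s) z ≠ 0) (e : E) :
    ∑ j ∈ Finset.range (Function.minimalPeriod G.face e),
      (G.descent z (G.face^[j] e) + G.descent z ((G.rot .black).symm (G.face^[j] e))) =
        Function.minimalPeriod G.face e - 1 := by
  classical
  choose χ H h01 h0 using fun e => exists_sectorPotential hG e
  set x' : E → E := fun x => (G.rot .black).symm x
  have hper : G.face^[Function.minimalPeriod G.face e] e = e := Function.iterate_minimalPeriod
  -- The sectors at the two edges `x` and `x' x` meeting at a black corner of the face have a
  -- boundary ray in common. The two remaining corrections sit at the same edge with opposite signs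
  -- and cancel.
  have Hξ : ∀ x, G.IsPotential (BipartiteMap.startSum fun σ =>
      G.rayIndicator (G.face x, .white) σ - G.rayIndicator (x, .white) σ)
      (fun c g => χ x c g + χ (x' x) c g) := by
    intro x
    refine ((H x).add (H (x' x))).congr fun g => ?_
    have h1 : ∀ σ, G.sectorBoundary x σ + G.sectorBoundary (x' x) σ =
        (G.rayIndicator (G.face x, .white) σ - G.rayIndicator (x, .white) σ) +
          ((if σ = (x' x, VertexColor.white) then 1 else 0) -
            if σ = (x' x, VertexColor.black) then 1 else 0) := by
      intro σ
      rw [sectorBoundary, sectorBoundary, rayIndicator_step_apply hG (x, .black),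
        rayIndicator_step_apply hG (G.face x, .white), BipartiteMap.step_black,
        BipartiteMap.step_white, BipartiteMap.rot_white_face]
      ring
    have h2 := h1 (g, .white)
    have h3 := h1 (g, .black)
    simp only [BipartiteMap.startSum]
    simp only [Prod.mk.injEq, reduceCtorEq, and_true, and_false, if_false] at h2 h3
    linarith
  have HF := BipartiteMap.IsPotential.sum (Finset.range (Function.minimalPeriod G.face e))
    fun j _ => Hξ (G.face^[j] e)
  have L := LimitAt.sum (Finset.range (Function.minimalPeriod G.face e))
    fun j _ => (limitAt_sector hG hz (H (G.face^[j] e)) (h01 _)).add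
      (limitAt_sector hG hz (H (x' (G.face^[j] e))) (h01 _))
  have hzero : ∀ σ, ∑ j ∈ Finset.range (Function.minimalPeriod G.face e),
      (G.rayIndicator (G.face (G.face^[j] e), .white) σ -
        G.rayIndicator (G.face^[j] e, .white) σ) = 0 := by
    intro σ
    have := sum_range_telescope_cycle (U := fun w => G.rayIndicator (w, .white) σ) _ e hper
    rw [← this]
    exact Finset.sum_congr rfl fun j _ => by rw [Function.iterate_succ_apply']
  -- The remaining rays telescope around the face, so the number of sectors containing a vertex does
  -- not depend on the vertex.
  have K : G.IsPotential (fun g => ∑ j ∈ Finset.range (Function.minimalPeriod G.face e),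
      BipartiteMap.startSum (fun σ => G.rayIndicator (G.face (G.face^[j] e), .white) σ -
        G.rayIndicator (G.face^[j] e, .white) σ) g)
      (fun _ _ => (0 : ℤ)) := by
    refine ⟨fun _ _ => rfl, fun g => ?_⟩
    simp only [BipartiteMap.startSum]
    rw [Finset.sum_add_distrib, hzero, hzero]
    rfl
  -- The pair of sectors at a black corner contains each black corner of the face exactly once,
  -- except that corner itself. Evaluating the constant at a black vertex of the face thus gives the
  -- degree minus one.
  have hin : ∀ (x : E) (n : ℕ), χ x .black (G.face^[n] x) + χ (x' x) .black (G.face^[n] x) =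
      1 - if G.face^[n] x = x then 1 else 0 := by
    intro x n
    have ha : ∀ n : ℕ, G.rayIndicator (G.face x, .white) (G.face^[n] x, .black) -
        G.rayIndicator (x, .white) (G.face^[n] x, .black) = 0 := by
      intro n
      rw [G.rayIndicator_of_track_ne, G.rayIndicator_of_track_ne, sub_zero]
      · exact (track_white_ne_track_black_of_face hG x n).symm
      · rcases n with _ | n
        · obtain ⟨m, -, hm⟩ := exists_iterate_eq_of_sameCycle G.finite_face_degree
            (x := G.face x) (y := x) (Equiv.Perm.sameCycle_apply_left.2 (.refl _ _))
          have := (track_white_ne_track_black_of_face hG (G.face x) m).symm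
          rw [hm] at this
          exact this
        · exact (track_white_ne_track_black_of_face hG (G.face x) n).symm
    induction n with
    | zero =>
      have h1 : χ (x' x) .black x = 0 := by
        rw [← (H (x' x)).rot_symm]; exact h0 _ _
      simp [h0, h1]
    | succ n ih =>
      have h1 := black_face (Hξ x) (G.face^[n] x)
      simp only [rayIndicator_apply_step hG] at h1
      have h2 := ha n
      have h3 := ha (n + 1)
      rw [Function.iterate_succ_apply'] at h3 ⊢
      simp only [Prod.mk.injEq, reduceCtorEq, and_true, and_false, if_false,
        G.face.injective.eq_iff] at h1
      linarith
  have hval : ∑ j ∈ Finset.range (Function.minimalPeriod G.face e),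
      (χ (G.face^[j] e) .black e + χ (x' (G.face^[j] e)) .black e) =
        Function.minimalPeriod G.face e - 1 := by
    have h1 : ∀ j ∈ Finset.range (Function.minimalPeriod G.face e),
        χ (G.face^[j] e) .black e + χ (x' (G.face^[j] e)) .black e =
          1 - if e = G.face^[j] e then 1 else 0 := by
      intro j _
      obtain ⟨m, -, hm⟩ := exists_iterate_eq_of_sameCycle G.finite_face_degree
        (x := G.face^[j] e) (y := e) (by
          rw [Equiv.Perm.iterate_eq_pow]
          exact Equiv.Perm.sameCycle_pow_left.2 (.refl _ _))
      have := hin (G.face^[j] e) m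
      rwa [hm] at this
    rw [Finset.sum_congr rfl h1, Finset.sum_sub_distrib]
    have := cycleIndicator_self (G.finite_face_degree e)
    rw [cycleIndicator] at this
    rw [this]
    simp
  refine LimitAt.unique e L fun g => Eventually.of_forall fun k => ?_
  have := G.potential_unique HF K .white .black (k • z +ᵥ g) e
  linarith

end PeriodicPlaneGraph

end

/-! ### Directions seen from a reference direction -/

/-- The strict cyclic order on the real line. -/
def CyclicLt (x y z : ℝ) : Prop := (x < y ∧ y < z) ∨ (y < z ∧ z < x) ∨ (z < x ∧ x < y)

/-- The oriented angle from `z` to `p`, counted from `-π / 2` to `3 * π / 2`. -/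
noncomputable def directionKey (z p : ℤ × ℤ) : ℝ :=
  (if 0 < latticeDet z p then 0 else Real.pi) -
    Real.arctan (((z.1 * p.1 + z.2 * p.2 : ℤ) : ℝ) / (latticeDet z p : ℝ))

theorem directionKey_lt (z p : ℤ × ℤ) : directionKey z p < 3 * Real.pi / 2 := by
  have h1 := Real.neg_pi_div_two_lt_arctan
    (((z.1 * p.1 + z.2 * p.2 : ℤ) : ℝ) / (latticeDet z p : ℝ))
  rw [directionKey]
  split_ifs <;> linarith [Real.pi_pos]

theorem lt_directionKey (z p : ℤ × ℤ) : -Real.pi / 2 < directionKey z p := by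
  have h1 := Real.arctan_lt_pi_div_two
    (((z.1 * p.1 + z.2 * p.2 : ℤ) : ℝ) / (latticeDet z p : ℝ))
  rw [directionKey]
  split_ifs <;> linarith [Real.pi_pos]

/-- On each side of the line of `z` the angle is a decreasing function of its cotangent, the
quotient in the definition of the key. The identity `hdet` expresses the difference of two
cotangents by `latticeDet p q`. -/
theorem directionKey_lt_iff {z p q : ℤ × ℤ} (hp : latticeDet z p ≠ 0) (hq : latticeDet z q ≠ 0) :
    directionKey z p < directionKey z q ↔ (0 < latticeDet z p ∧ latticeDet z q < 0) ∨
      (((0 < latticeDet z p ∧ 0 < latticeDet z q) ∨ (latticeDet z p < 0 ∧ latticeDet z q < 0)) ∧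
        0 < latticeDet p q) := by
  have hz : 0 < z.1 * z.1 + z.2 * z.2 := by
    by_contra h
    have h1 : z.1 = 0 := by nlinarith [mul_self_nonneg z.1, mul_self_nonneg z.2]
    have h2 : z.2 = 0 := by nlinarith [mul_self_nonneg z.1, mul_self_nonneg z.2]
    exact hp (by simp [latticeDet, h1, h2])
  have hdet : (z.1 * p.1 + z.2 * p.2) * latticeDet z q - (z.1 * q.1 + z.2 * q.2) * latticeDet z p =
      (z.1 * z.1 + z.2 * z.2) * latticeDet p q := by
    simp only [latticeDet]; ring
  have bp := Real.arctan_lt_pi_div_two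
    (((z.1 * p.1 + z.2 * p.2 : ℤ) : ℝ) / (latticeDet z p : ℝ))
  have bp' := Real.neg_pi_div_two_lt_arctan
    (((z.1 * p.1 + z.2 * p.2 : ℤ) : ℝ) / (latticeDet z p : ℝ))
  have bq := Real.arctan_lt_pi_div_two
    (((z.1 * q.1 + z.2 * q.2 : ℤ) : ℝ) / (latticeDet z q : ℝ))
  have bq' := Real.neg_pi_div_two_lt_arctan
    (((z.1 * q.1 + z.2 * q.2 : ℤ) : ℝ) / (latticeDet z q : ℝ))
  have hsame : 0 < latticeDet z p * latticeDet z q →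
      (((z.1 * q.1 + z.2 * q.2 : ℤ) : ℝ) / (latticeDet z q : ℝ) <
        ((z.1 * p.1 + z.2 * p.2 : ℤ) : ℝ) / (latticeDet z p : ℝ) ↔ 0 < latticeDet p q) := by
    intro hpos
    have hpR : (latticeDet z p : ℝ) ≠ 0 := by exact_mod_cast hp
    have hqR : (latticeDet z q : ℝ) ≠ 0 := by exact_mod_cast hq
    rw [← sub_pos, div_sub_div _ _ hpR hqR, div_pos_iff_of_pos_right (by exact_mod_cast hpos)]
    have : ((z.1 * p.1 + z.2 * p.2 : ℤ) : ℝ) * latticeDet z q -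
        latticeDet z p * ((z.1 * q.1 + z.2 * q.2 : ℤ) : ℝ) =
        (((z.1 * z.1 + z.2 * z.2) * latticeDet p q : ℤ) : ℝ) := by
      rw [← hdet]; push_cast; ring
    rw [this, Int.cast_pos, mul_pos_iff_of_pos_left hz]
  rw [directionKey, directionKey]
  rcases lt_or_gt_of_ne hp with h1 | h1 <;> rcases lt_or_gt_of_ne hq with h2 | h2
  · rw [if_neg (by omega), if_neg (by omega), sub_lt_sub_iff_left, Real.arctan_strictMono.lt_iff_lt,
      hsame (mul_pos_of_neg_of_neg h1 h2)]
    omega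
  · rw [if_neg (by omega), if_pos h2]
    constructor
    · intro h; linarith
    · omega
  · rw [if_pos h1, if_neg (by omega)]
    constructor
    · omega
    · intro; linarith
  · rw [if_pos h1, if_pos h2, sub_lt_sub_iff_left, Real.arctan_strictMono.lt_iff_lt, hsame (mul_pos h1 h2)]
    omega

theorem latticeDet_plucker (z p q r : ℤ × ℤ) : latticeDet p q * latticeDet z r +
    latticeDet q r * latticeDet z p + latticeDet r p * latticeDet z q = 0 := by
  simp only [latticeDet]; ring

theorem CyclicLt.rotate {x y z : ℝ} (h : CyclicLt x y z) : CyclicLt y z x := by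
  unfold CyclicLt at *; tauto

theorem cyclicLt_rotate {x y z : ℝ} : CyclicLt y z x ↔ CyclicLt x y z :=
  ⟨fun h => h.rotate.rotate, CyclicLt.rotate⟩

theorem directionOrder_rotate {p q r : ℤ × ℤ} : directionOrder q r p ↔ directionOrder p q r := by
  unfold directionOrder; tauto

theorem directionOrder_iff {z p q r : ℤ × ℤ} (hp : latticeDet z p ≠ 0) (hq : latticeDet z q ≠ 0)
    (hr : latticeDet z r ≠ 0) : directionOrder p q r ↔
      CyclicLt (directionKey z p) (directionKey z q) (directionKey z r) := by
  -- Two of the three vectors are on the same side of the line of `z`; after a cyclic rotation they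
  -- are the first two. The Plücker relation settles the signs.
  have key : ∀ {p q r : ℤ × ℤ}, latticeDet z r ≠ 0 →
      (0 < latticeDet z p ∧ 0 < latticeDet z q) ∨ (latticeDet z p < 0 ∧ latticeDet z q < 0) →
      (directionOrder p q r ↔
        CyclicLt (directionKey z p) (directionKey z q) (directionKey z r)) := by
    intro p q r hr h
    have hp : latticeDet z p ≠ 0 := by omega
    have hq : latticeDet z q ≠ 0 := by omega
    have hpl := latticeDet_plucker z p q r
    simp only [CyclicLt, directionKey_lt_iff hp hq, directionKey_lt_iff hq hr,
      directionKey_lt_iff hr hp, directionOrder]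
    rcases lt_or_gt_of_ne hr with h3 | h3 <;> rcases h with ⟨h1, h2⟩ | ⟨h1, h2⟩
    · have e1 : 0 < latticeDet p q → 0 < latticeDet q r ∨ 0 < latticeDet r p := by
        intro h; by_contra! hcon; nlinarith
      have e2 : ¬ 0 < latticeDet p q → ¬ (0 < latticeDet q r ∧ 0 < latticeDet r p) := by
        intro h hcon; nlinarith
      omega
    · omega
    · omega
    · have e1 : 0 < latticeDet p q → 0 < latticeDet q r ∨ 0 < latticeDet r p := by
        intro h; by_contra! hcon; nlinarith
      have e2 : ¬ 0 < latticeDet p q → ¬ (0 < latticeDet q r ∧ 0 < latticeDet r p) := by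
        intro h hcon; nlinarith
      omega
  rcases lt_or_gt_of_ne hp with h1 | h1 <;> rcases lt_or_gt_of_ne hq with h2 | h2 <;>
    rcases lt_or_gt_of_ne hr with h3 | h3
  all_goals first
    | exact key hr (by omega)
    | (rw [← directionOrder_rotate, ← cyclicLt_rotate]; exact key hp (by omega))
    | (rw [directionOrder_rotate.symm.trans directionOrder_rotate.symm,
        cyclicLt_rotate.symm.trans cyclicLt_rotate.symm]; exact key hq (by omega))

/-! ### The order of train-tracks -/

namespace PeriodicPlaneGraph

variable {E : Type*} [AddAction (ℤ × ℤ) E] (G : PeriodicPlaneGraph E)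

theorem finite_range_strandClass : (Set.range G.strandClass).Finite := by
  have := G.finite_quotient
  refine (Set.finite_range fun q : AddAction.orbitRel.Quotient (ℤ × ℤ) E × VertexColor =>
    G.strandClass (Quotient.out q.1, q.2)).subset ?_
  rintro _ ⟨⟨e, c⟩, rfl⟩
  obtain ⟨z, hz⟩ := (quotient_mk_eq_iff (Quotient.out (Quotient.mk _ e :
    AddAction.orbitRel.Quotient (ℤ × ℤ) E)) e).1 (Quotient.out_eq _)
  refine ⟨(Quotient.mk _ e, c), ?_⟩
  simp only [hz]
  exact G.strandClass_translate z (e, c)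

theorem exists_generic {G : PeriodicPlaneGraph E} (hG : G.IsMinimal) :
    ∃ z, ∀ s, latticeDet (G.strandClass s) z ≠ 0 := by
  obtain ⟨N, hN⟩ := (G.finite_range_strandClass.image fun p => |p.2|).bddAbove
  -- A nonvertical vector steeper than every nonvertical class.
  refine ⟨(1, |N| + 1), fun s h => ?_⟩
  have h1 : |(G.strandClass s).2| ≤ N := hN ⟨_, ⟨s, rfl⟩, rfl⟩
  have h2 := le_abs_self N
  simp only [latticeDet, mul_one] at h
  rcases eq_or_ne (G.strandClass s).1 0 with h0 | h0
  · exact strandClass_ne_zero hG s (Prod.ext h0 (by rw [h0] at h; simpa using h.symm))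
  · have h3 : (G.strandClass s).2 = (G.strandClass s).1 * (|N| + 1) := by linarith
    rw [h3, abs_mul, abs_of_pos (by positivity : 0 < |N| + 1)] at h1
    have h4 := Int.one_le_abs h0
    nlinarith [abs_nonneg N]

/-- The direction of a train-track, seen from `z`. -/
noncomputable def key (z : ℤ × ℤ) (t : G.TrainTrack) : ℝ := directionKey z (G.homologyClass t)

/-- A direction that is not the direction of a train-track. -/
def IsGeneric (z : ℤ × ℤ) : Prop := ∀ s, latticeDet (G.strandClass s) z ≠ 0

variable {G} {z : ℤ × ℤ}

theorem IsGeneric.latticeDet_ne_zero (hz : G.IsGeneric z) (t : G.TrainTrack) :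
    latticeDet z (G.homologyClass t) ≠ 0 := by
  rw [latticeDet_swap]
  exact neg_ne_zero.2 (hz _)

theorem globalOrder_iff (hz : G.IsGeneric z) (t₁ t₂ t₃ : G.TrainTrack) :
    G.globalOrder t₁ t₂ t₃ ↔ CyclicLt (G.key z t₁) (G.key z t₂) (G.key z t₃) :=
  directionOrder_iff (hz.latticeDet_ne_zero _) (hz.latticeDet_ne_zero _) (hz.latticeDet_ne_zero _)

theorem key_lt_of_isDescent (hz : G.IsGeneric z) {t t' : G.TrainTrack}
    (h : directionOrder (G.homologyClass t') z (G.homologyClass t)) : G.key z t < G.key z t' := by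
  have h1 := hz.latticeDet_ne_zero t
  have h2 := hz.latticeDet_ne_zero t'
  have h3 := latticeDet_swap (G.homologyClass t') z
  rw [key, key, directionKey_lt_iff h1 h2]
  rcases h with h | h | h <;> omega

theorem descent_eq_zero_or (z : ℤ × ℤ) (e : E) : G.descent z e = 0 ∨ G.descent z e = 1 := by
  classical
  rw [descent]; split_ifs <;> simp

theorem key_lt_of_descent_eq_one (hz : G.IsGeneric z) {e : E} (h : G.descent z e = 1) :
    G.key z (G.track (e, .white)) < G.key z (G.track (e, .black)) := by
  classical
  refine key_lt_of_isDescent hz ?_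
  rw [homologyClass_track, homologyClass_track]
  by_contra hcon
  rw [descent, if_neg (show ¬ G.IsDescent z e from hcon)] at h
  exact zero_ne_one h

theorem key_lt_of_descent_eq_zero (hG : G.IsMinimal) (hz : G.IsGeneric z) {e : E}
    (h : G.descent z e = 0) :
    G.key z (G.track (e, .black)) < G.key z (G.track (e, .white)) := by
  classical
  refine key_lt_of_isDescent hz ?_
  rw [homologyClass_track, homologyClass_track]
  refine (isDescent_or hG hz e).resolve_left fun hcon => ?_
  rw [descent, if_pos (show G.IsDescent z e from hcon)] at h
  exact one_ne_zero h

theorem key_ne_of_intersect (hG : G.IsMinimal) (hz : G.IsGeneric z) {t t' : G.TrainTrack}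
    (h : G.Intersect t t') : G.key z t ≠ G.key z t' := by
  obtain ⟨e, c, rfl, rfl⟩ := h
  have : G.key z (G.track (e, .white)) ≠ G.key z (G.track (e, .black)) := by
    rcases descent_eq_zero_or (G := G) z e with h | h
    · exact (key_lt_of_descent_eq_zero hG hz h).ne'
    · exact (key_lt_of_descent_eq_one hz h).ne
  cases c
  exacts [this, this.symm]

theorem key_ne_of_antiParallel (hz : G.IsGeneric z) {t t' : G.TrainTrack}
    (h : G.AntiParallel t t') : G.key z t ≠ G.key z t' := by
  have h1 := hz.latticeDet_ne_zero t'
  have h2 : latticeDet z (G.homologyClass t) = -latticeDet z (G.homologyClass t') := by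
    rw [show G.homologyClass t = _ from h, latticeDet_neg_right]
  have h3 : latticeDet (G.homologyClass t) (G.homologyClass t') = 0 := by
    rw [show G.homologyClass t = _ from h, latticeDet_neg_left, latticeDet_self, neg_zero]
  rcases lt_or_gt_of_ne h1 with h4 | h4
  · exact ((directionKey_lt_iff (by omega) (by omega)).2 (by omega)).ne
  · exact ((directionKey_lt_iff (by omega) (by omega)).2 (by omega)).ne'

theorem finite_range_key (z : ℤ × ℤ) : (Set.range (G.key z)).Finite := by
  refine (G.finite_range_strandClass.image (directionKey z)).subset ?_
  rintro _ ⟨t, rfl⟩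
  exact ⟨_, ⟨_, rfl⟩, rfl⟩

theorem key_sub_key_lt (z : ℤ × ℤ) (t t' : G.TrainTrack) :
    G.key z t - G.key z t' < 2 * Real.pi := by
  have h1 := directionKey_lt z (G.homologyClass t)
  have h2 := lt_directionKey z (G.homologyClass t')
  rw [key, key]
  linarith

end PeriodicPlaneGraph

/-! ### Angles and their lifts -/

theorem exists_angle_lift (a : Real.Angle) : ∃ θ : ℝ, 0 ≤ θ ∧ θ < 2 * Real.pi ∧ (θ : Real.Angle) = a := by
  refine ⟨toIcoMod Real.two_pi_pos 0 a.toReal, left_le_toIcoMod _ _ _, ?_, ?_⟩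
  · simpa using toIcoMod_lt_right Real.two_pi_pos 0 a.toReal
  · rw [Real.Angle.coe_toIcoMod, Real.Angle.coe_toReal]

/-- The lift in `[0, 2π)` of an angle. -/
noncomputable def angleLift (a : Real.Angle) : ℝ := (exists_angle_lift a).choose

theorem angleLift_nonneg (a : Real.Angle) : 0 ≤ angleLift a := (exists_angle_lift a).choose_spec.1

theorem angleLift_lt (a : Real.Angle) : angleLift a < 2 * Real.pi :=
  (exists_angle_lift a).choose_spec.2.1

theorem coe_angleLift (a : Real.Angle) : (angleLift a : Real.Angle) = a :=
  (exists_angle_lift a).choose_spec.2.2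

theorem eq_of_coe_eq {x y : ℝ} (h : (x : Real.Angle) = y) (h1 : x - y < 2 * Real.pi)
    (h2 : y - x < 2 * Real.pi) : x = y := by
  obtain ⟨k, hk⟩ := Real.Angle.angle_eq_iff_two_pi_dvd_sub.1 h
  have hpi := Real.pi_pos
  have h3 : (k : ℝ) < 1 := by nlinarith
  have h4 : (-1 : ℝ) < k := by nlinarith
  have h5 : k = 0 := by
    have : k < 1 := by exact_mod_cast h3
    have : -1 < k := by exact_mod_cast h4
    omega
  rw [h5] at hk
  push_cast at hk
  linarith

theorem angleLift_coe {x : ℝ} (h0 : 0 ≤ x) (h1 : x < 2 * Real.pi) : angleLift x = x := by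
  have := angleLift_nonneg (x : Real.Angle)
  have := angleLift_lt (x : Real.Angle)
  exact eq_of_coe_eq (coe_angleLift _) (by linarith) (by linarith)

theorem angleLift_pos {a : Real.Angle} (h : a ≠ 0) : 0 < angleLift a := by
  refine lt_of_le_of_ne (angleLift_nonneg a) fun h0 => h ?_
  rw [← coe_angleLift a, ← h0, Real.Angle.coe_zero]

/-- Fewer than three points impose no condition; this disposes of short families, on which the
hypothesis of monotonicity is void. -/
theorem cyclicallyOrdered_of_le_two {n : ℕ} (hn : n ≤ 2) (x : Fin n → Real.Angle) :
    CyclicallyOrdered x := by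
  interval_cases n
  · exact ⟨fun i => i.elim0, fun i => i.elim0, fun i => i.elim0, fun i => i.elim0⟩
  · refine ⟨fun _ => angleLift (x 0), monotone_const, fun _ _ => by linarith [Real.pi_pos],
      fun i => ?_⟩
    rw [Fin.fin_one_eq_zero i, coe_angleLift]
  · have h0 := angleLift_nonneg (x 1 - x 0)
    have h1 := angleLift_lt (x 1 - x 0)
    refine ⟨![angleLift (x 0), angleLift (x 0) + angleLift (x 1 - x 0)], ?_, ?_, ?_⟩
    · rw [Fin.monotone_iff_le_succ]
      intro i
      fin_cases i
      simpa using h0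
    · intro i j
      fin_cases i <;> fin_cases j <;> simp <;> linarith [Real.pi_pos]
    · intro i
      fin_cases i <;> simp [coe_angleLift]

/-! ### Cycles with one break -/

/-- `b` is the indicator function of a set containing one element of each cycle of `p`. -/
def OneBreak {S : Type*} (p : Equiv.Perm S) (b : S → ℤ) : Prop :=
  (∀ x, b x = 0 ∨ b x = 1) ∧
    ∀ x, ∑ j ∈ Finset.range (Function.minimalPeriod p x), b (p^[j] x) = 1

namespace OneBreak

variable {S : Type*} {p : Equiv.Perm S} {b : S → ℤ}

/-- The range goes beyond one period in order to contain the whole turn that begins just after the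
break. -/
theorem exists_break (hb : OneBreak p b) (x : S) : ∃ r < Function.minimalPeriod p x,
    b (p^[r] x) = 1 ∧ ∀ j < Function.minimalPeriod p x + r, j ≠ r → b (p^[j] x) = 0 := by
  classical
  set d := Function.minimalPeriod p x with hd
  obtain ⟨r, hr, hr1⟩ : ∃ r < d, b (p^[r] x) = 1 := by
    by_contra! hcon
    have := hb.2 x
    rw [Finset.sum_eq_zero fun j hj =>
      (hb.1 _).resolve_right (hcon j (Finset.mem_range.1 hj))] at this
    exact zero_ne_one this
  have h2 : ∀ j < d, j ≠ r → b (p^[j] x) = 0 := by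
    have h := hb.2 x
    rw [← Finset.add_sum_erase _ _ (Finset.mem_range.2 hr), hr1] at h
    have h' := (Finset.sum_eq_zero_iff_of_nonneg (fun j _ => by
      rcases hb.1 (p^[j] x) with h | h <;> rw [h]; norm_num)).1 (add_eq_left.1 h)
    exact fun j hj hjr => h' j (Finset.mem_erase.2 ⟨hjr, Finset.mem_range.2 hj⟩)
  refine ⟨r, hr, hr1, fun j hj hjr => ?_⟩
  rcases lt_or_ge j d with h | h
  · exact h2 j h hjr
  · obtain ⟨k, rfl⟩ := Nat.exists_eq_add_of_le' h
    rw [Function.iterate_add_apply, hd, Function.iterate_minimalPeriod]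
    exact h2 k (by omega) (by omega)

theorem chain {T : Type*} {R : T → T → Prop} [IsTrans T R] {g : S → T}
    (hg : ∀ x, b x = 0 → R (g x) (g (p x))) (x : S) {i j : ℕ} (hij : i < j)
    (h : ∀ k, i ≤ k → k < j → b (p^[k] x) = 0) : R (g (p^[i] x)) (g (p^[j] x)) := by
  induction j, hij using Nat.le_induction with
  | base =>
    rw [Function.iterate_succ_apply']
    exact hg _ (h i le_rfl (Nat.lt_succ_self i))
  | succ j hij ih =>
    refine _root_.trans (ih fun k h1 h2 => h k h1 (by omega)) ?_
    rw [Function.iterate_succ_apply']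
    exact hg _ (h j (by omega) (by omega))

theorem ne_of_sameCycle (hb : OneBreak p b) (hp : ∀ x, x ∈ Function.periodicPts p) {k : S → ℝ}
    (hk : ∀ x, b x = 0 → k x < k (p x)) {x y : S} (hxy : p.SameCycle x y) (hne : x ≠ y) :
    k x ≠ k y := by
  obtain ⟨n, hn, rfl⟩ := exists_iterate_eq_of_sameCycle hp hxy
  have hn0 : 0 < n := Nat.pos_of_ne_zero fun h => hne (by rw [h]; rfl)
  obtain ⟨r, hr, -, h⟩ := hb.exists_break x
  rcases lt_or_ge r n with hrn | hrn
  · have := chain (R := (· < ·)) hk x hn fun k h1 h2 => h k (by omega) (by omega)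
    rw [Function.iterate_minimalPeriod] at this
    exact this.ne'
  · exact (chain (R := (· < ·)) hk x hn0 fun k h1 h2 => h k (by omega) (by omega)).ne

/-- Two consecutive steps contain at most one break. If they contain it, the rest of the cycle, from
`p (p y)` back to `y`, is without break; it is empty when the cycle has length two, whence the
reflexivity of `R`. -/
theorem two_step {T : Type*} {R : T → T → Prop} [IsTrans T R] [Std.Refl R] (hb : OneBreak p b)
    (hp : ∀ x, x ∈ Function.periodicPts p) {g : S → T}
    (hg : ∀ x, b x = 0 → R (g x) (g (p x))) {y : S} (hy : p y ≠ y) :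
    b y + b (p y) ≤ 1 ∧ (b y + b (p y) = 1 → R (g (p (p y))) (g y)) := by
  obtain ⟨r, hr, hr1, h⟩ := hb.exists_break y
  have hpos := Function.minimalPeriod_pos_of_mem_periodicPts (hp y)
  have hd : Function.minimalPeriod p y ≠ 1 := fun h => hy (Function.minimalPeriod_eq_one_iff_isFixedPt.1 h)
  have h0 : r ≠ 0 → b y = 0 := fun hr0 => h 0 (by omega) hr0.symm
  have h1 : r ≠ 1 → b (p y) = 0 := fun hr0 => h 1 (by omega) hr0.symm
  rcases hb.1 y with e0 | e0 <;> rcases hb.1 (p y) with e1 | e1 <;> rw [e0, e1]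
  · simp
  all_goals
    constructor
    · omega
    · intro _
      have hr2 : r < 2 := by
        by_contra hcon
        have := h0 (by omega)
        have := h1 (by omega)
        omega
      rcases eq_or_ne (Function.minimalPeriod p y) 2 with h2 | h2
      · have h3 : p^[2] y = y := by rw [← h2]; exact Function.iterate_minimalPeriod
        rw [show p (p y) = y from h3]
        exact refl _
      · have := chain (p := p) (R := R) hg y (i := 2) (j := Function.minimalPeriod p y) (by omega)
          fun k h1 h2 => h k (by omega) (by omega)
        rwa [Function.iterate_minimalPeriod] at this

end OneBreak

/-! ### Breaks of the directions around vertices and faces -/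

namespace PeriodicPlaneGraph

variable {E : Type*} [AddAction (ℤ × ℤ) E] {G : PeriodicPlaneGraph E} {z : ℤ × ℤ}

theorem rot_ne (hG : G.IsMinimal) (c : VertexColor) (e : E) : G.rot c e ≠ e := by
  intro h
  refine hG.1 ⟨e, ?_⟩
  cases c with
  | white =>
    rw [← G.track_step (e, .white), BipartiteMap.step_white, h]
  | black =>
    rw [← G.track_step (e, .black), BipartiteMap.step_black, (Equiv.symm_apply_eq _).2 h.symm]

theorem track_rot_white (e : E) : G.track (G.rot .white e, .black) = G.track (e, .white) :=
  G.track_step (e, .white)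

theorem track_rot_black (e : E) : G.track (G.rot .black e, .black) = G.track (e, .white) := by
  rw [← G.track_step (G.rot .black e, .black), BipartiteMap.step_black, Equiv.symm_apply_apply]

theorem track_rot_black_symm (e : E) :
    G.track ((G.rot .black).symm e, .white) = G.track (e, .black) :=
  G.track_step (e, .black)

theorem track_face_white (e : E) :
    G.track ((G.rot .black).symm e, .black) = G.track (G.face e, .white) := by
  rw [← BipartiteMap.rot_white_face, track_rot_white]

variable (G z) in
/-- The indicator function of the edges at which the directions of the train-tracks around a vertex
of colour `c` go through `z`. -/
noncomputable def vertexBreak : VertexColor → E → ℤ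
  | .white => fun e => G.descent z (G.rot .white e)
  | .black => fun e => G.descent z e

theorem oneBreak_vertexBreak (hG : G.IsMinimal) (hz : G.IsGeneric z) (c : VertexColor) :
    OneBreak (G.rot c) (G.vertexBreak z c) := by
  cases c with
  | white =>
    refine ⟨fun e => descent_eq_zero_or z _, fun e => ?_⟩
    rw [← sum_descent_rot hG hz .white e, ← sum_range_iterate_shift (G.descent z) _ e
      Function.iterate_minimalPeriod]
    exact Finset.sum_congr rfl fun j _ => by rw [Function.iterate_succ_apply']; rfl
  | black => exact ⟨fun e => descent_eq_zero_or z _, fun e => sum_descent_rot hG hz .black e⟩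

theorem key_lt_of_vertexBreak (hG : G.IsMinimal) (hz : G.IsGeneric z) (c : VertexColor) (e : E)
    (h : G.vertexBreak z c e = 0) :
    G.key z (G.track (e, c)) < G.key z (G.track (G.rot c e, c)) := by
  cases c with
  | white =>
    rw [← track_rot_white]
    exact key_lt_of_descent_eq_zero hG hz h
  | black =>
    rw [track_rot_black]
    exact key_lt_of_descent_eq_zero hG hz h

variable (G z) in
/-- The indicator function of the edges at which the directions of the train-tracks around the
vertices of colour `c` of a face go through `z`. -/
noncomputable def faceBreak : VertexColor → E → ℤ
  | .white => fun e => 1 - (G.descent z e + G.descent z ((G.rot .black).symm e))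
  | .black => fun e => 1 - (G.descent z (G.face e) + G.descent z ((G.rot .black).symm e))

variable (G z) in
/-- The order of train-tracks by direction, train-tracks of the same direction being related only if
they are equal. -/
def KeyLE (t t' : G.TrainTrack) : Prop := G.key z t < G.key z t' ∨ t = t'

instance : IsTrans G.TrainTrack (G.KeyLE z) where
  trans := by
    rintro a b c (h | rfl) (h' | rfl)
    exacts [.inl (h.trans h'), .inl h, .inl h', .inr rfl]

instance : Std.Refl (G.KeyLE z) where
  refl _ := .inr rfl

/-- Two successive strands of the face around vertices of colour `c` have a vertex of the other
colour between them. There their train-tracks carry the two extreme ones among three consecutive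
strands, so `two_step` at that vertex applies. -/
theorem faceBreak_spec (hG : G.IsMinimal) (hz : G.IsGeneric z) (c : VertexColor) (e : E) :
    0 ≤ G.faceBreak z c e ∧
      (G.faceBreak z c e = 0 → G.KeyLE z (G.track (e, c)) (G.track (G.face e, c))) := by
  cases c with
  | white =>
    have h := (oneBreak_vertexBreak hG hz .black).two_step (G.finite_degree _)
      (R := G.KeyLE z) (g := fun e => G.track (e, .black))
      (fun x hx => .inl (key_lt_of_vertexBreak hG hz _ x hx)) (rot_ne hG .black ((G.rot .black).symm e))
    rw [Equiv.apply_symm_apply, track_rot_black, track_face_white] at h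
    simp only [vertexBreak] at h
    simp only [faceBreak]
    exact ⟨by linarith [h.1], fun h0 => h.2 (by linarith)⟩
  | black =>
    have h := (oneBreak_vertexBreak hG hz .white).two_step (G.finite_degree _)
      (R := G.KeyLE z) (g := fun e => G.track (e, .white))
      (fun x hx => .inl (key_lt_of_vertexBreak hG hz _ x hx))
      (rot_ne hG .white ((G.rot .white).symm (G.face e)))
    rw [Equiv.apply_symm_apply, BipartiteMap.rot_white_face, track_rot_black_symm,
      ← track_rot_white, Equiv.apply_symm_apply] at h
    simp only [vertexBreak, BipartiteMap.rot_white_face, Equiv.apply_symm_apply] at h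
    simp only [faceBreak]
    exact ⟨by linarith [h.1], fun h0 => h.2 (by linarith)⟩

/-- A face of degree `2d` has `d` corners of each colour and `d - 1` descents among its edges. -/
theorem oneBreak_faceBreak (hG : G.IsMinimal) (hz : G.IsGeneric z) (c : VertexColor) :
    OneBreak G.face (G.faceBreak z c) := by
  constructor
  · intro e
    have h := (faceBreak_spec hG hz c e).1
    have h1 := descent_eq_zero_or (G := G) z e
    have h2 := descent_eq_zero_or (G := G) z (G.face e)
    have h3 := descent_eq_zero_or (G := G) z ((G.rot .black).symm e)
    cases c <;> simp only [faceBreak] at h ⊢ <;> omega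
  · intro e
    have h := sum_descent_face hG hz e
    cases c with
    | white =>
      simp only [faceBreak]
      rw [Finset.sum_sub_distrib, h]
      simp
    | black =>
      simp only [faceBreak]
      have h1 := sum_range_iterate_shift (G.descent z) _ e
        (Function.iterate_minimalPeriod (f := G.face) (x := e))
      simp only [Function.iterate_succ_apply'] at h1
      rw [Finset.sum_add_distrib] at h
      rw [Finset.sum_sub_distrib, Finset.sum_add_distrib, h1, h]
      simp

/-- At a break neither edge of the corner is a descent, so the key varies strictly in two steps.
This is what excludes constant angles around a face. -/
theorem key_lt_of_faceBreak (hG : G.IsMinimal) (hz : G.IsGeneric z) (c : VertexColor) (e : E)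
    (h : G.faceBreak z c e = 1) :
    G.key z (G.track (G.face e, c)) < G.key z (G.track (e, c)) := by
  have h1 := descent_eq_zero_or (G := G) z e
  have h2 := descent_eq_zero_or (G := G) z (G.face e)
  have h3 := descent_eq_zero_or (G := G) z ((G.rot .black).symm e)
  cases c with
  | white =>
    simp only [faceBreak] at h
    have h4 := key_lt_of_descent_eq_zero hG hz (e := e) (by omega)
    have h5 := key_lt_of_descent_eq_zero hG hz (e := (G.rot .black).symm e) (by omega)
    rw [track_rot_black_symm, track_face_white] at h5
    exact h5.trans h4
  | black =>
    simp only [faceBreak] at h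
    have h4 := key_lt_of_descent_eq_zero hG hz (e := G.face e) (by omega)
    have h5 := key_lt_of_descent_eq_zero hG hz (e := (G.rot .black).symm e) (by omega)
    rw [track_rot_black_symm, track_face_white] at h5
    exact h4.trans h5

/-! ### Monotone lifts -/

variable (G z) in
/-- `f` is a lift of `α` that is strictly monotone with respect to directions and whose increments
are less than `2π`. -/
structure IsLift (α : G.TrainTrack → Real.Angle) (f : G.TrainTrack → ℝ) : Prop where
  coe : ∀ t, (f t : Real.Angle) = α t
  lt : ∀ t t', G.key z t < G.key z t' → f t < f t'
  lt_add : ∀ t t', G.key z t < G.key z t' → f t' < f t + 2 * Real.pi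

namespace IsLift

variable {α : G.TrainTrack → Real.Angle} {f : G.TrainTrack → ℝ}

theorem ne (hf : G.IsLift z α f) {t t' : G.TrainTrack} (h : G.key z t ≠ G.key z t') :
    α t ≠ α t' := by
  wlog hlt : G.key z t < G.key z t' generalizing t t'
  · exact (this h.symm (lt_of_le_of_ne (not_lt.1 hlt) h.symm)).symm
  intro heq
  rw [← hf.coe, ← hf.coe] at heq
  have h1 := hf.lt _ _ hlt
  have h2 := hf.lt_add _ _ hlt
  have := eq_of_coe_eq heq (by linarith) (by linarith)
  linarith

/-- The integer `β i` counts the turns to be added to the lift at `x i`; it is enough to control the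
family pairwise. -/
theorem cyclicallyOrdered (hf : G.IsLift z α f) {n : ℕ} {x : Fin n → G.TrainTrack}
    (β : Fin n → ℤ) (h : ∀ i j, i < j → (β j = β i ∧ G.KeyLE z (x i) (x j)) ∨
      (β j = β i + 1 ∧ G.KeyLE z (x j) (x i))) : CyclicallyOrdered fun i => α (x i) := by
  have hle : ∀ {t t'}, G.KeyLE z t t' → f t ≤ f t' ∧ f t' ≤ f t + 2 * Real.pi := by
    rintro t t' (h | rfl)
    · exact ⟨(hf.lt _ _ h).le, (hf.lt_add _ _ h).le⟩
    · exact ⟨le_rfl, by linarith [Real.pi_pos]⟩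
  have hmono : Monotone fun i => f (x i) + β i * (2 * Real.pi) := by
    refine monotone_iff_forall_lt.2 fun i j hij => ?_
    rcases h i j hij with ⟨h1, h2⟩ | ⟨h1, h2⟩ <;> rw [h1] <;> push_cast <;>
      linarith [(hle h2).1, (hle h2).2]
  refine ⟨fun i => f (x i) + β i * (2 * Real.pi), hmono, fun i j => ?_, fun i => ?_⟩
  · beta_reduce
    rcases lt_or_ge i j with hij | hij
    · rcases h i j hij with ⟨h1, h2⟩ | ⟨h1, h2⟩ <;> rw [h1] <;> push_cast <;>
        linarith [(hle h2).1, (hle h2).2]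
    · have := hmono hij
      beta_reduce at this
      linarith [Real.pi_pos]
  · beta_reduce
    rw [← hf.coe, Real.Angle.angle_eq_iff_two_pi_dvd_sub]
    exact ⟨β i, by ring⟩

theorem cyclicMonotone (hz : G.IsGeneric z) (hf : G.IsLift z α f) :
    CyclicMonotone G.globalOrder α := by
  classical
  intro n x hx
  rcases Nat.lt_or_ge n 3 with hn | hn
  · exact cyclicallyOrdered_of_le_two (by omega) _
  have hx' : ∀ i j k, i < j → j < k →
      CyclicLt (G.key z (x i)) (G.key z (x j)) (G.key z (x k)) := fun i j k hij hjk =>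
    (globalOrder_iff hz _ _ _).1 (hx i j k hij hjk)
  set o : Fin n := ⟨0, by omega⟩ with ho
  have hne : ∀ j, o < j → G.key z (x j) ≠ G.key z (x o) := by
    intro j hj
    have hj0 : 0 < (j : ℕ) := hj
    rcases Nat.lt_or_ge (j : ℕ) 2 with h | h
    · have := hx' o j ⟨2, by omega⟩ hj (Fin.lt_def.2 h)
      unfold CyclicLt at this
      rcases this with h | h | h
      exacts [h.1.ne', (h.1.trans h.2).ne, h.2.ne']
    · have := hx' o ⟨1, by omega⟩ j (Fin.lt_def.2 Nat.zero_lt_one) (Fin.lt_def.2 h)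
      unfold CyclicLt at this
      rcases this with h | h | h
      exacts [(h.1.trans h.2).ne', h.2.ne, h.1.ne]
  -- One turn is added to the members of the family that come after the passage through `z`,
  -- recognised by a key below that of the first member.
  refine hf.cyclicallyOrdered (fun i => if G.key z (x i) < G.key z (x o) then 1 else 0) ?_
  intro i j hij
  rcases eq_or_ne i o with rfl | hi
  · rcases lt_or_gt_of_ne (hne j hij) with h | h
    · exact .inr ⟨by simp [h], .inl h⟩
    · exact .inl ⟨by simp [h.not_gt], .inl h⟩
  · have hi : o < i := lt_of_le_of_ne (Fin.le_def.2 (Nat.zero_le _)) hi.symm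
    rcases hx' o i j hi hij with ⟨h1, h2⟩ | ⟨h1, h2⟩ | ⟨h1, h2⟩
    · exact .inl ⟨by simp [h1.not_gt, (h1.trans h2).not_gt], .inl h2⟩
    · exact .inl ⟨by simp [h2, h1.trans h2], .inl h1⟩
    · exact .inr ⟨by simp [h1, h2.not_gt], .inl (h1.trans h2)⟩

theorem cyclicMonotone_of_oneBreak (hf : G.IsLift z α f) {S : Type*} {p : Equiv.Perm S}
    {b : S → ℤ} (hb : OneBreak p b) {g : S → G.TrainTrack}
    (hg : ∀ x, b x = 0 → G.KeyLE z (g x) (g (p x))) :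
    CyclicMonotone (cycleOrder p) fun x => α (g x) := by
  classical
  intro n x hx
  rcases Nat.lt_or_ge n 3 with hn | hn
  · exact cyclicallyOrdered_of_le_two (by omega) _
  set o : Fin n := ⟨0, by omega⟩ with ho
  set d := Function.minimalPeriod p (x o) with hd
  have hex : ∀ j, ∃ m : ℕ, (o < j → 0 < m ∧ m < d ∧ p^[m] (x o) = x j) ∧ (j = o → m = 0) := by
    intro j
    rcases eq_or_ne j o with rfl | hj
    · exact ⟨0, fun h => absurd h (lt_irrefl _), fun _ => rfl⟩
    have hj : o < j := lt_of_le_of_ne (Fin.le_def.2 (Nat.zero_le _)) hj.symm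
    have hj0 : 0 < (j : ℕ) := hj
    rcases Nat.lt_or_ge (j : ℕ) 2 with h | h
    · obtain ⟨k, l, h1, h2, h3, h4, h5⟩ := hx o j ⟨2, by omega⟩ hj (Fin.lt_def.2 h)
      exact ⟨k, fun _ => ⟨h1, h2.trans h3, h4⟩, fun h => absurd h hj.ne'⟩
    · obtain ⟨k, l, h1, h2, h3, h4, h5⟩ :=
        hx o ⟨1, by omega⟩ j (Fin.lt_def.2 Nat.zero_lt_one) (Fin.lt_def.2 h)
      exact ⟨l, fun _ => ⟨h1.trans h2, h3, h5⟩, fun h => absurd h hj.ne'⟩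
  choose m hm hm0 using hex
  have hmo : m o = 0 := hm0 o rfl
  have hle : ∀ i, o ≤ i := fun i => Fin.le_def.2 (Nat.zero_le _)
  have hpos : 0 < d := by
    have := hm ⟨1, by omega⟩ (Fin.lt_def.2 Nat.zero_lt_one)
    omega
  have hmx : ∀ i, m i < d ∧ p^[m i] (x o) = x i := by
    intro i
    rcases (hle i).eq_or_lt with rfl | h
    · exact ⟨by rw [hmo]; exact hpos, by rw [hmo]; rfl⟩
    · exact (hm i h).2
  have hmono : ∀ i j, i < j → m i < m j := by
    intro i j hij
    rcases (hle i).eq_or_lt with rfl | h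
    · rw [hmo]; exact (hm j hij).1
    · obtain ⟨k, l, h1, h2, h3, h4, h5⟩ := hx o i j h hij
      have e1 : m i = k := Function.iterate_injOn_Iio_minimalPeriod (hmx i).1
        (Set.mem_Iio.2 (h2.trans h3)) ((hmx i).2.trans h4.symm)
      have e2 : m j = l := Function.iterate_injOn_Iio_minimalPeriod (hmx j).1
        (Set.mem_Iio.2 h3) ((hmx j).2.trans h5.symm)
      omega
  obtain ⟨r, hr, -, hbr⟩ := hb.exists_break (x o)
  have hchain : ∀ i j : ℕ, i < j → (∀ k, i ≤ k → k < j → k ≠ r) → j ≤ d + r →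
      G.KeyLE z (g (p^[i] (x o))) (g (p^[j] (x o))) := fun i j hij h hj =>
    OneBreak.chain (R := G.KeyLE z) hg (x o) hij fun k h1 h2 => hbr k (by omega) (h k h1 h2)
  -- With positions counted from the first element of the family, one turn is added beyond the break
  -- `r`.
  refine hf.cyclicallyOrdered (x := fun i => g (x i)) (fun i => if m i ≤ r then 0 else 1) ?_
  intro i j hij
  have h1 := hmono i j hij
  have hi := hmx i
  have hj := hmx j
  rcases Nat.lt_or_ge r (m i) with h2 | h2
  · have := hchain (m i) (m j) h1 (fun k _ _ => by omega) (by omega)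
    rw [hi.2, hj.2] at this
    exact .inl ⟨by simp [h2.not_ge, (h2.trans h1).not_ge], this⟩
  rcases Nat.lt_or_ge r (m j) with h3 | h3
  · have := hchain (m j) (m i + d) (by omega) (fun k _ _ => by omega) (by omega)
    rw [Function.iterate_add_apply, hd, Function.iterate_minimalPeriod, hi.2, hj.2] at this
    exact .inr ⟨by simp [h2, h3.not_ge], this⟩
  · have := hchain (m i) (m j) h1 (fun k _ _ => by omega) (by omega)
    rw [hi.2, hj.2] at this
    exact .inl ⟨by simp [h2, h3], this⟩

theorem mem_X (hG : G.IsMinimal) (hz : G.IsGeneric z) (hf : G.IsLift z α f) : α ∈ G.X :=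
  ⟨hf.cyclicMonotone hz, fun _ _ h => hf.ne
    (h.elim (key_ne_of_intersect hG hz) (key_ne_of_antiParallel hz))⟩

theorem mem_Y (hG : G.IsMinimal) (hz : G.IsGeneric z) (hf : G.IsLift z α f) : α ∈ G.Y := by
  refine ⟨fun c => ?_, fun c => ?_⟩
  · have hb := oneBreak_vertexBreak hG hz c
    have hinj : ∀ e e', (G.rot c).SameCycle e e' →
        α (G.track (e, c)) = α (G.track (e', c)) → e = e' := by
      intro e e' h heq
      by_contra hne
      exact hf.ne (hb.ne_of_sameCycle (G.finite_degree c)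
        (k := fun e => G.key z (G.track (e, c))) (key_lt_of_vertexBreak hG hz c) h hne) heq
    refine ⟨hf.cyclicMonotone_of_oneBreak hb (g := fun e => G.track (e, c))
      fun e he => .inl (key_lt_of_vertexBreak hG hz c e he), hinj, fun e => ?_⟩
    have h1 : (G.rot c).SameCycle e (G.rot c e) :=
      Equiv.Perm.sameCycle_apply_right.2 (.refl _ _)
    exact ⟨e, G.rot c e, .refl _ _, h1, fun h => rot_ne hG c e (hinj _ _ h1 h).symm⟩
  · have hb := oneBreak_faceBreak hG hz c
    refine ⟨hf.cyclicMonotone_of_oneBreak hb (g := fun e => G.track (e, c))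
      fun e he => (faceBreak_spec hG hz c e).2 he, fun e => ?_⟩
    obtain ⟨r, -, hr, -⟩ := hb.exists_break e
    have h1 : G.face.SameCycle e (G.face^[r] e) := by
      rw [Equiv.Perm.iterate_eq_pow]; exact Equiv.Perm.sameCycle_pow_right.2 (.refl _ _)
    exact ⟨_, _, Equiv.Perm.sameCycle_apply_right.2 h1, h1,
      hf.ne (key_lt_of_faceBreak hG hz c _ hr).ne⟩

end IsLift

end PeriodicPlaneGraph

/-! ### Train-tracks on both sides of a direction -/

namespace PeriodicPlaneGraph

variable {E : Type*} [AddAction (ℤ × ℤ) E] {G : PeriodicPlaneGraph E} {z : ℤ × ℤ}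

theorem infinite_edges (G : PeriodicPlaneGraph E) : Infinite E := by
  obtain ⟨e⟩ := G.nonempty
  refine Infinite.of_injective (fun k : ℤ => ((k, 0) : ℤ × ℤ) +ᵥ e) fun k l h => ?_
  exact congrArg Prod.fst (G.vadd_right_injective h)

/-- Some vertex has degree at least three. -/
theorem exists_rot_rot_ne (G : PeriodicPlaneGraph E) : ∃ c e, G.rot c (G.rot c e) ≠ e := by
  by_contra! h
  have hs : ∀ c e, (G.rot c).symm e = G.rot c e := fun c e => by
    rw [Equiv.symm_apply_eq, h]
  obtain ⟨e₀⟩ := G.nonempty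
  have hfin : ∀ e, {x | G.face.SameCycle e x}.Finite := fun e => by
    refine ((Finset.range (Function.minimalPeriod G.face e)).finite_toSet.image
      fun n => G.face^[n] e).subset fun x hx => ?_
    obtain ⟨n, hn, rfl⟩ := exists_iterate_eq_of_sameCycle G.finite_face_degree hx
    exact ⟨n, by simpa using hn, rfl⟩
  -- If all vertices had degree at most two, the edges of one face would be closed under both
  -- rotations, and the graph would be a finite cycle.
  have hrot : ∀ c e, (G.face.SameCycle e₀ e ∨ G.face.SameCycle e₀ (G.rot .white e)) →
      (G.face.SameCycle e₀ (G.rot c e) ∨ G.face.SameCycle e₀ (G.rot .white (G.rot c e))) := by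
    rintro (_ | _) e he
    · rw [h, or_comm]; exact he
    · rcases he with he | he
      · right
        have : G.rot .white (G.rot .black e) = G.face e := by
          rw [BipartiteMap.face_apply, hs, hs]
        rw [this]
        exact Equiv.Perm.sameCycle_apply_right.2 he
      · left
        have : G.face (G.rot .black e) = G.rot .white e := by
          rw [BipartiteMap.face_apply, hs, hs, h]
        rw [← this] at he
        exact Equiv.Perm.sameCycle_apply_right.1 he
  have hall := G.induction_on_edges (P := fun e => G.face.SameCycle e₀ e ∨
    G.face.SameCycle e₀ (G.rot .white e)) e₀ (.inl (.refl _ _)) hrot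
    fun c e he => by rw [hs]; exact hrot c e he
  have : (Set.univ : Set E).Finite := by
    refine ((hfin e₀).union ((hfin e₀).preimage (G.rot .white).injective.injOn)).subset
      fun e _ => hall e
  exact Set.infinite_univ_iff.2 G.infinite_edges this

/-- If all classes were collinear, only two directions would occur, whereas the train-tracks around
a vertex of degree at least three have pairwise different keys. -/
theorem exists_latticeDet_ne_zero (hG : G.IsMinimal) (hz : G.IsGeneric z) (t : G.TrainTrack) :
    ∃ s, latticeDet (G.strandClass s) (G.homologyClass t) ≠ 0 := by
  by_contra! h
  obtain ⟨c, e, hne⟩ := G.exists_rot_rot_ne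
  have ht := hz.latticeDet_ne_zero t
  have hz' : ∀ t', latticeDet z (G.homologyClass t') ≠ 0 := hz.latticeDet_ne_zero
  have hdet : ∀ s s', latticeDet (G.strandClass s) (G.strandClass s') = 0 := by
    intro s s'
    have := latticeDet_plucker z (G.strandClass s) (G.strandClass s') (G.homologyClass t)
    rw [latticeDet_swap (G.homologyClass t), h, h] at this
    simpa [ht] using this
  have hkey : ∀ s s', G.key z (G.track s) < G.key z (G.track s') ↔
      (0 < latticeDet z (G.strandClass s) ∧ latticeDet z (G.strandClass s') < 0) := by
    intro s s'
    have h1 := hz' (G.track s)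
    have h2 := hz' (G.track s')
    rw [homologyClass_track] at h1 h2
    rw [key, key, homologyClass_track, homologyClass_track, directionKey_lt_iff h1 h2, hdet]
    simp
  have hb := oneBreak_vertexBreak hG hz c
  have hd : ∀ {x y}, (G.rot c).SameCycle x y → x ≠ y →
      G.key z (G.track (x, c)) ≠ G.key z (G.track (y, c)) := fun h h' =>
    hb.ne_of_sameCycle (G.finite_degree c) (k := fun e => G.key z (G.track (e, c)))
      (key_lt_of_vertexBreak hG hz c) h h'
  have s1 : (G.rot c).SameCycle e (G.rot c e) := Equiv.Perm.sameCycle_apply_right.2 (.refl _ _)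
  have s2 : (G.rot c).SameCycle (G.rot c e) (G.rot c (G.rot c e)) :=
    Equiv.Perm.sameCycle_apply_right.2 (.refl _ _)
  have d1 := (hd s1 (rot_ne hG c e).symm).lt_or_gt
  have d2 := (hd s2 (rot_ne hG c _).symm).lt_or_gt
  have d3 := (hd (s1.trans s2) hne.symm).lt_or_gt
  rw [hkey, hkey] at d1 d2 d3
  omega

/-- The classes have a vanishing weighted sum with positive weights. As some class is not collinear
with that of `t`, there are classes on both sides. -/
theorem exists_track_of_sides (hG : G.IsMinimal) (hz : G.IsGeneric z) (t : G.TrainTrack) :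
    (∃ t', 0 < latticeDet (G.homologyClass t) (G.homologyClass t')) ∧
      ∃ t', 0 < latticeDet (G.homologyClass t') (G.homologyClass t) := by
  have := G.finite_quotient
  have := Fintype.ofFinite (AddAction.orbitRel.Quotient (ℤ × ℤ) E)
  have hsum := G.sum_latticeDet_eq_zero (G.homologyClass t)
  obtain ⟨⟨e, c⟩, hs⟩ := exists_latticeDet_ne_zero hG hz t
  have hout : ∃ q : AddAction.orbitRel.Quotient (ℤ × ℤ) E × VertexColor,
      latticeDet (G.strandClass (Quotient.out q.1, q.2)) (G.homologyClass t) ≠ 0 := by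
    obtain ⟨u, hu⟩ := (quotient_mk_eq_iff (Quotient.out (Quotient.mk _ e :
      AddAction.orbitRel.Quotient (ℤ × ℤ) E)) e).1 (Quotient.out_eq _)
    refine ⟨(Quotient.mk _ e, c), ?_⟩
    simp only [hu]
    have := G.strandClass_translate u (e, c)
    rw [translate] at this
    rwa [this]
  obtain ⟨q, hq⟩ := hout
  have hpos : ∀ s, (0 : ℝ) < G.strandPeriod s := fun s => by exact_mod_cast G.strandPeriod_pos s
  constructor
  · by_contra! h
    have hnn : ∀ s, 0 ≤ latticeDet (G.strandClass s) (G.homologyClass t) := fun s => by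
      have := h (G.track s)
      rw [homologyClass_track, latticeDet_swap] at this
      linarith
    have h0 := (Finset.sum_eq_zero_iff_of_nonneg fun q _ => div_nonneg
      (Int.cast_nonneg (hnn _)) (hpos _).le).1 hsum q (Finset.mem_univ q)
    rw [div_eq_zero_iff, or_iff_left (hpos _).ne'] at h0
    exact hq (by exact_mod_cast h0)
  · by_contra! h
    have hnn : ∀ s, latticeDet (G.strandClass s) (G.homologyClass t) ≤ 0 := fun s => by
      have := h (G.track s)
      rwa [homologyClass_track] at this
    have h0 := (Finset.sum_eq_zero_iff_of_nonpos fun q _ => div_nonpos_of_nonpos_of_nonneg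
      (Int.cast_nonpos.2 (hnn _)) (hpos _).le).1 hsum q (Finset.mem_univ q)
    rw [div_eq_zero_iff, or_iff_left (hpos _).ne'] at h0
    exact hq (by exact_mod_cast h0)

/-- Two train-tracks with distinct directions that do not intersect are separated by the directions
of two train-tracks intersecting both of them. -/
theorem exists_separating (hG : G.IsMinimal) (hz : G.IsGeneric z) {t t' : G.TrainTrack}
    (hk : G.key z t ≠ G.key z t') (hI : ¬ G.Intersect t t') : ∃ u v,
      0 < latticeDet (G.homologyClass t) (G.homologyClass u) ∧
      0 < latticeDet (G.homologyClass u) (G.homologyClass t') ∧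
      0 < latticeDet (G.homologyClass t') (G.homologyClass v) ∧
      0 < latticeDet (G.homologyClass v) (G.homologyClass t) := by
  have hdet : latticeDet (G.homologyClass t) (G.homologyClass t') = 0 := by
    by_contra h
    exact hI (intersect_of_latticeDet_ne_zero hG h)
  have h1 := hz.latticeDet_ne_zero t
  have h2 := hz.latticeDet_ne_zero t'
  -- Train-tracks that do not cross are collinear; having different keys, they point to opposite
  -- sides of the line of `z`.
  have hsign : (0 < latticeDet z (G.homologyClass t) ∧ latticeDet z (G.homologyClass t') < 0) ∨
      (latticeDet z (G.homologyClass t) < 0 ∧ 0 < latticeDet z (G.homologyClass t')) := by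
    rcases hk.lt_or_gt with h | h <;> rw [key, key, directionKey_lt_iff] at h <;> try assumption
    · omega
    · have := latticeDet_swap (G.homologyClass t) (G.homologyClass t')
      omega
  obtain ⟨⟨u, hu⟩, v, hv⟩ := exists_track_of_sides hG hz t
  have key : ∀ w, latticeDet (G.homologyClass t') (G.homologyClass w) *
      latticeDet z (G.homologyClass t) = -(latticeDet (G.homologyClass w) (G.homologyClass t) *
        latticeDet z (G.homologyClass t')) := by
    intro w
    have := latticeDet_plucker z (G.homologyClass t) (G.homologyClass t') (G.homologyClass w)
    rw [hdet] at this
    linarith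
  have ku := key u
  have kv := key v
  refine ⟨u, v, hu, ?_, ?_, hv⟩
  · rw [latticeDet_swap] at hu ⊢
    rcases hsign with ⟨h3, h4⟩ | ⟨h3, h4⟩ <;> nlinarith
  · rcases hsign with ⟨h3, h4⟩ | ⟨h3, h4⟩ <;> nlinarith

end PeriodicPlaneGraph

/-! ### Angles determined by the local cyclic orders -/

theorem le_of_coe_eq {x y : ℝ} (h : (x : Real.Angle) = y) (hx : x < 2 * Real.pi) (hy : 0 ≤ y) :
    x ≤ y := by
  obtain ⟨k, hk⟩ := Real.Angle.angle_eq_iff_two_pi_dvd_sub.1 h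
  have hpi := Real.pi_pos
  have h3 : (k : ℝ) < 1 := by nlinarith
  have h5 : (k : ℝ) ≤ 0 := by
    have : k < 1 := by exact_mod_cast h3
    exact_mod_cast (by omega : k ≤ 0)
  nlinarith

theorem coe_sum_angle {ι : Type*} (s : Finset ι) (f : ι → ℝ) :
    ((∑ i ∈ s, f i : ℝ) : Real.Angle) = ∑ i ∈ s, (f i : Real.Angle) :=
  map_sum Real.Angle.coeHom f s

/-- Along a cycle, a monotone map that is not constant turns exactly once around the circle. -/
theorem sum_lift_eq_two_pi {S : Type*} {p : Equiv.Perm S} {γ : S → Real.Angle}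
    (hγ : CyclicMonotone (cycleOrder p) γ) (hp : ∀ x, x ∈ Function.periodicPts p) {θ : S → ℝ}
    (h0 : ∀ y, 0 ≤ θ y) (h1 : ∀ y, θ y < 2 * Real.pi)
    (hθ : ∀ y, (θ y : Real.Angle) = γ (p y) - γ y) {x : S}
    (hne : ∃ y y', p.SameCycle x y ∧ p.SameCycle x y' ∧ γ y ≠ γ y') :
    ∑ j ∈ Finset.range (Function.minimalPeriod p x), θ (p^[j] x) = 2 * Real.pi := by
  set d := Function.minimalPeriod p x with hd
  have hpos : 0 < d := Function.minimalPeriod_pos_of_mem_periodicPts (hp x)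
  obtain ⟨Θ, hmono, hle, hcoe⟩ := hγ d (fun i => p^[i] x) (by
    intro i j k hij hjk
    have hij' : (i : ℕ) < j := hij
    have hjk' : (j : ℕ) < k := hjk
    have hper : Function.minimalPeriod p (p^[(i : ℕ)] x) = d := by
      generalize (i : ℕ) = n
      induction n with
      | zero => rfl
      | succ n ih => rw [Function.iterate_succ_apply', minimalPeriod_perm_apply, ih]
    refine ⟨j - i, k - i, by omega, by omega, by rw [hper]; omega, ?_, ?_⟩
    · rw [← Function.iterate_add_apply, Nat.sub_add_cancel hij'.le]
    · rw [← Function.iterate_add_apply, Nat.sub_add_cancel (hij'.trans hjk').le])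
  -- The monotone lift along one turn, continued at the end by its first value plus `2π`.
  set Φ : ℕ → ℝ := fun j => if h : j < d then Θ ⟨j, h⟩ else Θ ⟨0, hpos⟩ + 2 * Real.pi with hΦ
  have hΦcoe : ∀ j ≤ d, (Φ j : Real.Angle) = γ (p^[j] x) := by
    intro j hj
    simp only [hΦ]
    split_ifs with h
    · exact hcoe _
    · have : j = d := by omega
      rw [Real.Angle.coe_add, Real.Angle.coe_two_pi, add_zero, hcoe,
        show p^[j] x = x by rw [this]; exact Function.iterate_minimalPeriod]
      rfl
  have hΦle : ∀ j < d, Φ j ≤ Φ (j + 1) := by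
    intro j hj
    simp only [hΦ]
    rw [dif_pos hj]
    split_ifs with h
    · exact hmono (Fin.le_def.2 (Nat.le_succ j))
    · exact hle _ _
  -- Among nonnegative representatives of an angle, the one in `[0, 2π)` is the smallest. So the sum
  -- is at most `2π`; being a multiple of `2π`, it is `2π`, or else `0`, in which case `γ` is
  -- constant on the cycle.
  have hstep : ∀ j ∈ Finset.range d, θ (p^[j] x) ≤ Φ (j + 1) - Φ j := by
    intro j hj
    have hj := Finset.mem_range.1 hj
    refine le_of_coe_eq ?_ (h1 _) (by linarith [hΦle j hj])
    rw [hθ, Real.Angle.coe_sub, hΦcoe j hj.le, hΦcoe (j + 1) hj, Function.iterate_succ_apply']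
  have hsum : ∑ j ∈ Finset.range d, θ (p^[j] x) ≤ 2 * Real.pi := by
    refine (Finset.sum_le_sum hstep).trans (le_of_eq ?_)
    rw [Finset.sum_range_sub]
    simp only [hΦ]
    rw [dif_neg (lt_irrefl d), dif_pos hpos]
    ring
  have hcoe0 : ((∑ j ∈ Finset.range d, θ (p^[j] x) : ℝ) : Real.Angle) = (0 : ℝ) := by
    rw [coe_sum_angle, Real.Angle.coe_zero,
      ← sum_range_telescope_cycle (U := γ) d x Function.iterate_minimalPeriod]
    exact Finset.sum_congr rfl fun j _ => by rw [hθ, Function.iterate_succ_apply']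
  by_contra hne2
  have hlt := lt_of_le_of_ne hsum hne2
  have h00 := le_of_coe_eq hcoe0 hlt le_rfl
  have hz := (Finset.sum_eq_zero_iff_of_nonneg fun j _ => h0 (p^[j] x)).1
    (le_antisymm h00 (Finset.sum_nonneg fun j _ => h0 _))
  have hconst : ∀ n ≤ d, γ (p^[n] x) = γ x := by
    intro n hn
    induction n with
    | zero => rfl
    | succ n ih =>
      rw [← ih (by omega), Function.iterate_succ_apply', ← sub_eq_zero, ← hθ,
        hz n (Finset.mem_range.2 hn), Real.Angle.coe_zero]
  obtain ⟨y, y', hy, hy', hyy⟩ := hne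
  obtain ⟨n, hn, rfl⟩ := exists_iterate_eq_of_sameCycle hp hy
  obtain ⟨n', hn', rfl⟩ := exists_iterate_eq_of_sameCycle hp hy'
  exact hyy ((hconst n hn.le).trans (hconst n' hn'.le).symm)

namespace PeriodicPlaneGraph

variable {E : Type*} [AddAction (ℤ × ℤ) E] {G : PeriodicPlaneGraph E} {z : ℤ × ℤ}

variable (G) in
/-- The angle in `[0, 2π)` from the train-track `(e, black)` to the train-track `(e, white)`. -/
noncomputable def crossingAngle (α : G.TrainTrack → Real.Angle) (e : E) : ℝ :=
  angleLift (α (G.track (e, .white)) - α (G.track (e, .black)))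

variable {α : G.TrainTrack → Real.Angle}

/-- The two train-tracks crossing at `e` carry consecutive strands around the white end of `e`,
whose angles differ by injectivity. -/
theorem crossingAngle_pos (hG : G.IsMinimal) (hα : α ∈ G.Y) (e : E) :
    0 < G.crossingAngle α e := by
  refine angleLift_pos (sub_ne_zero.2 fun h => rot_ne hG .white ((G.rot .white).symm e) ?_)
  rw [Equiv.apply_symm_apply]
  refine (hα.1 .white).2.1 _ _ (Equiv.Perm.sameCycle_symm_apply_right.2 (.refl _ _)) ?_
  rw [h, ← track_rot_white, Equiv.apply_symm_apply]

theorem coe_crossingAngle_rot_white (e : E) : (G.crossingAngle α (G.rot .white e) : Real.Angle) =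
    α (G.track (G.rot .white e, .white)) - α (G.track (e, .white)) := by
  rw [crossingAngle, coe_angleLift, track_rot_white]

theorem sum_crossingAngle_rot (hα : α ∈ G.Y) (c : VertexColor) (e : E) :
    ∑ j ∈ Finset.range (Function.minimalPeriod (G.rot c) e),
      G.crossingAngle α ((G.rot c)^[j] e) = 2 * Real.pi := by
  cases c with
  | white =>
    rw [← sum_lift_eq_two_pi (hα.1 .white).1 (G.finite_degree .white)
      (θ := fun e => G.crossingAngle α (G.rot .white e)) (fun _ => angleLift_nonneg _)
      (fun _ => angleLift_lt _) coe_crossingAngle_rot_white ((hα.1 .white).2.2 e),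
      ← sum_range_iterate_shift (G.crossingAngle α) _ e Function.iterate_minimalPeriod]
    exact Finset.sum_congr rfl fun j _ => by rw [Function.iterate_succ_apply']
  | black =>
    refine sum_lift_eq_two_pi (hα.1 .black).1 (G.finite_degree .black)
      (θ := fun e => G.crossingAngle α e) (fun _ => angleLift_nonneg _)
      (fun _ => angleLift_lt _) (fun e => ?_) ((hα.1 .black).2.2 e)
    rw [crossingAngle, coe_angleLift, track_rot_black]

/-- The step from one strand around a white vertex of the face to the next is `2π` minus the
crossing angles at two edges. It lies in `[0, 2π)` because these are distinct edges of one black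
vertex, where all crossing angles add up to `2π`. The steps add up to one turn. -/
theorem sum_crossingAngle_face (hG : G.IsMinimal) (hα : α ∈ G.Y) (e : E) :
    ∑ j ∈ Finset.range (Function.minimalPeriod G.face e), (G.crossingAngle α (G.face^[j] e) +
      G.crossingAngle α ((G.rot .black).symm (G.face^[j] e))) =
        2 * Real.pi * (Function.minimalPeriod G.face e - 1) := by
  have hpair : ∀ e, G.crossingAngle α e + G.crossingAngle α ((G.rot .black).symm e) ≤
      2 * Real.pi := by
    intro e
    set y := (G.rot .black).symm e with hy
    have hye : G.rot .black y = e := Equiv.apply_symm_apply _ _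
    have h1 : 1 < Function.minimalPeriod (G.rot .black) y := by
      have h2 := Function.minimalPeriod_pos_of_mem_periodicPts (G.finite_degree .black y)
      have h3 : Function.minimalPeriod (G.rot .black) y ≠ 1 := fun h =>
        rot_ne hG .black y (Function.minimalPeriod_eq_one_iff_isFixedPt.1 h)
      omega
    rw [← sum_crossingAngle_rot hα .black y]
    have h4 := Finset.sum_le_sum_of_subset_of_nonneg (f := fun j =>
      G.crossingAngle α ((G.rot .black)^[j] y)) (Finset.range_subset_range.2 h1)
      fun _ _ _ => angleLift_nonneg _
    refine le_trans (le_of_eq ?_) h4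
    rw [Finset.sum_range_succ, Finset.sum_range_one, Function.iterate_zero_apply,
      Function.iterate_one, hye, add_comm]
  have h := sum_lift_eq_two_pi (hα.2 .white).1 G.finite_face_degree
    (θ := fun e => 2 * Real.pi -
      (G.crossingAngle α e + G.crossingAngle α ((G.rot .black).symm e)))
    (fun e => by linarith [hpair e])
    (fun e => by
      linarith [crossingAngle_pos hG hα e, crossingAngle_pos hG hα ((G.rot .black).symm e)])
    (fun e => by
      rw [Real.Angle.coe_sub, Real.Angle.coe_two_pi, Real.Angle.coe_add, crossingAngle,
        crossingAngle, coe_angleLift, coe_angleLift, track_rot_black_symm, track_face_white]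
      abel) ((hα.2 .white).2 e)
  rw [Finset.sum_sub_distrib, Finset.sum_const, Finset.card_range, nsmul_eq_mul] at h
  linarith

/-- A family of angles that respects the local cyclic orders has a strictly monotone lift along
crossing train-tracks. -/
theorem exists_crossing_lift (hG : G.IsMinimal) (hz : G.IsGeneric z) (hα : α ∈ G.Y) :
    ∃ f : G.TrainTrack → ℝ, (∀ t, (f t : Real.Angle) = α t) ∧
      ∀ e, f (G.track (e, .white)) - f (G.track (e, .black)) =
        G.crossingAngle α e - 2 * Real.pi * G.descent z e := by
  -- The intended difference of the lift between the white and the black train-track at `e`. Its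
  -- sums vanish around vertices and faces because crossing angles and descents obey the same count.
  set τ : E → ℝ := fun e => G.crossingAngle α e - 2 * Real.pi * G.descent z e with hτ
  have hτcoe : ∀ e, (τ e : Real.Angle) =
      α (G.track (e, .white)) - α (G.track (e, .black)) := by
    intro e
    rw [← coe_angleLift (α (G.track (e, .white)) - _), ← crossingAngle,
      Real.Angle.angle_eq_iff_two_pi_dvd_sub]
    exact ⟨-G.descent z e, by simp only [hτ]; push_cast; ring⟩
  have hprim : ∀ c, ∃ U : E → ℝ, ∀ e, U (G.rot c e) = U e + τ (G.rot c e) := by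
    intro c
    refine exists_cycle_primitive (G.rot c) (G.finite_degree c) (fun e => τ (G.rot c e))
      fun e => ?_
    have h1 := sum_range_iterate_shift τ _ e (Function.iterate_minimalPeriod (f := G.rot c))
    simp only [Function.iterate_succ_apply'] at h1
    rw [h1]
    simp only [hτ]
    rw [Finset.sum_sub_distrib, sum_crossingAngle_rot hα, ← Finset.mul_sum, ← Int.cast_sum,
      sum_descent_rot hG hz]
    simp
  choose U hU using hprim
  obtain ⟨V, hV⟩ := exists_cycle_primitive G.face G.finite_face_degree
    (fun e => τ e + τ ((G.rot .black).symm e)) fun e => by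
      have h1 := sum_crossingAngle_face hG hα e
      have h2 := congrArg (fun n : ℤ => (n : ℝ)) (sum_descent_face hG hz e)
      push_cast at h2
      simp only [hτ]
      have h3 : ∀ j, G.crossingAngle α (G.face^[j] e) - 2 * Real.pi * G.descent z (G.face^[j] e) +
          (G.crossingAngle α ((G.rot .black).symm (G.face^[j] e)) -
            2 * Real.pi * G.descent z ((G.rot .black).symm (G.face^[j] e))) =
          (G.crossingAngle α (G.face^[j] e) +
            G.crossingAngle α ((G.rot .black).symm (G.face^[j] e))) - 2 * Real.pi *
          (G.descent z (G.face^[j] e) + G.descent z ((G.rot .black).symm (G.face^[j] e))) :=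
        fun j => by ring
      rw [Finset.sum_congr rfl fun j _ => h3 j, Finset.sum_sub_distrib, h1, ← Finset.mul_sum, h2]
      ring
  -- The primitives `U c` are determined up to a constant at each vertex; the potential supplies
  -- constants for which the white and the black primitives agree on every edge.
  obtain ⟨h, H⟩ := G.exists_potential (fun e => U .white e - U .black e)
    (fun e => U .white e + V e) fun e => by
      have h1 := hU .white (G.face e)
      have h2 := hU .black ((G.rot .black).symm e)
      rw [BipartiteMap.rot_white_face] at h1
      rw [Equiv.apply_symm_apply] at h2
      have h3 := hV e
      linarith
  set F : E → ℝ := fun e => U .white e - h .white e with hF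
  have hFc : ∀ c e, F e = U c e - h c e := by
    rintro (_ | _) e
    · rfl
    · have := H.sub e
      simp only [hF]
      linarith
  have hFrot : ∀ c e, F (G.rot c e) = F e + τ (G.rot c e) := by
    intro c e
    rw [hFc c, hFc c, hU, H.rot]
    ring
  have hFsymm : ∀ c e, F e = F ((G.rot c).symm e) + τ e := fun c e => by
    simpa using hFrot c ((G.rot c).symm e)
  obtain ⟨e₀⟩ := G.nonempty
  set k : ℝ := angleLift (α (G.track (e₀, .white)) - F e₀) with hk
  have hFα : ∀ e, ((F e + k : ℝ) : Real.Angle) = α (G.track (e, .white)) := by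
    have htr : ∀ c e, α (G.track (G.rot c e, .black)) = α (G.track (e, .white)) := by
      rintro (_ | _) e
      exacts [by rw [track_rot_white], by rw [track_rot_black]]
    refine G.induction_on_edges (P := fun e => ((F e + k : ℝ) : Real.Angle) =
      α (G.track (e, .white))) e₀ ?_ ?_ ?_
    · rw [Real.Angle.coe_add, hk, coe_angleLift]; abel
    · intro c e he
      rw [hFrot, add_right_comm, Real.Angle.coe_add, he, hτcoe, htr]
      abel
    · intro c e he
      rw [hFsymm c, add_right_comm, Real.Angle.coe_add, hτcoe] at he
      have := htr c ((G.rot c).symm e)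
      rw [Equiv.apply_symm_apply] at this
      rw [this] at he
      rw [← sub_eq_zero, ← sub_eq_zero.2 he]
      abel
  -- The function is constant along steps because `F` varies by `τ` under the rotation of either
  -- colour.
  let f₀ : E × VertexColor → ℝ := fun s => match s with
    | (e, .white) => F e + k
    | (e, .black) => F e - τ e + k
  have hf₀ : ∀ s, f₀ (G.step s) = f₀ s := by
    rintro ⟨e, _ | _⟩
    · show F (G.rot .white e) - τ (G.rot .white e) + k = F e + k
      rw [hFrot]; ring
    · show F ((G.rot .black).symm e) + k = F e - τ e + k
      rw [hFsymm .black e]; ring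
  have hf₀n : ∀ (n : ℕ) s, f₀ (G.step^[n] s) = f₀ s := by
    intro n s
    induction n with
    | zero => rfl
    | succ n ih => rw [Function.iterate_succ_apply', hf₀, ih]
  have hf₀t : ∀ s s', G.track s' = G.track s → f₀ s' = f₀ s := by
    intro s s' h
    rcases (G.track_eq_iff s s').1 h with ⟨n, rfl⟩ | ⟨n, rfl⟩
    exacts [hf₀n n s, (hf₀n n s').symm]
  let f : G.TrainTrack → ℝ := fun t => f₀ (Quotient.out t)
  have hf : ∀ s, f (G.track s) = f₀ s := fun s => hf₀t _ _ (Quotient.out_eq (G.track s))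
  refine ⟨f, fun t => ?_, fun e => ?_⟩
  · obtain ⟨⟨e, c⟩, rfl⟩ : ∃ s, G.track s = t := ⟨Quotient.out t, Quotient.out_eq t⟩
    rw [hf]
    cases c with
    | white => exact hFα e
    | black =>
      show ((F e - τ e + k : ℝ) : Real.Angle) = _
      rw [show F e - τ e + k = F e + k - τ e by ring, Real.Angle.coe_sub, hFα, hτcoe]
      abel
  · rw [hf, hf]
    show F e + k - (F e - τ e + k) = _
    ring

/-- For train-tracks that cross, the bounds come from `0 < crossingAngle < 2π`. Otherwise a
train-track `u` crossing both with key between theirs gives monotonicity, and another one, `v`, with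
key outside gives the bound by `2π`. -/
theorem exists_isLift_of_mem_Y (hG : G.IsMinimal) (hz : G.IsGeneric z) (hα : α ∈ G.Y) :
    ∃ f, G.IsLift z α f := by
  obtain ⟨f, hf, hcross⟩ := exists_crossing_lift hG hz hα
  have hI : ∀ t t', G.Intersect t t' → G.key z t < G.key z t' →
      f t < f t' ∧ f t' < f t + 2 * Real.pi := by
    have hblack : ∀ e, G.key z (G.track (e, .black)) < G.key z (G.track (e, .white)) →
        f (G.track (e, .black)) < f (G.track (e, .white)) ∧
          f (G.track (e, .white)) < f (G.track (e, .black)) + 2 * Real.pi := by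
      intro e h
      have h1 := hcross e
      have h2 := crossingAngle_pos hG hα e
      have h3 : G.crossingAngle α e < 2 * Real.pi := angleLift_lt _
      rcases descent_eq_zero_or (G := G) z e with h0 | h0
      · rw [h0] at h1; push_cast at h1
        constructor <;> linarith
      · exact absurd (key_lt_of_descent_eq_one hz h0) h.not_gt
    have hwhite : ∀ e, G.key z (G.track (e, .white)) < G.key z (G.track (e, .black)) →
        f (G.track (e, .white)) < f (G.track (e, .black)) ∧
          f (G.track (e, .black)) < f (G.track (e, .white)) + 2 * Real.pi := by
      intro e h
      have h1 := hcross e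
      have h2 := crossingAngle_pos hG hα e
      have h3 : G.crossingAngle α e < 2 * Real.pi := angleLift_lt _
      rcases descent_eq_zero_or (G := G) z e with h0 | h0
      · exact absurd (key_lt_of_descent_eq_zero hG hz h0) h.not_gt
      · rw [h0] at h1; push_cast at h1
        constructor <;> linarith
    rintro t t' ⟨e, _ | _, rfl, rfl⟩ h
    exacts [hwhite e h, hblack e h]
  have hall : ∀ t t', G.key z t < G.key z t' → f t < f t' ∧ f t' < f t + 2 * Real.pi := by
    intro t t' h
    by_cases hint : G.Intersect t t'
    · exact hI t t' hint h
    obtain ⟨u, v, h1, h2, h3, h4⟩ := exists_separating hG hz h.ne hint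
    have hu : CyclicLt (G.key z t) (G.key z u) (G.key z t') :=
      (globalOrder_iff hz _ _ _).1 (.inl ⟨h1, h2⟩)
    have hv : CyclicLt (G.key z t') (G.key z v) (G.key z t) :=
      (globalOrder_iff hz _ _ _).1 (.inl ⟨h3, h4⟩)
    have hu' : G.key z t < G.key z u ∧ G.key z u < G.key z t' := by
      rcases hu with hu | hu | hu
      · exact hu
      · exact absurd h hu.2.not_gt
      · exact absurd h hu.1.not_gt
    have i1 := hI t u (intersect_of_latticeDet_ne_zero hG h1.ne') hu'.1
    have i2 := hI u t' (intersect_of_latticeDet_ne_zero hG h2.ne') hu'.2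
    refine ⟨i1.1.trans i2.1, ?_⟩
    have x1 := intersect_of_latticeDet_ne_zero hG h3.ne'
    have x2 := intersect_of_latticeDet_ne_zero hG h4.ne'
    rcases hv with hv | hv | hv
    · exact absurd h (hv.1.trans hv.2).not_gt
    · have i3 := hI v t x2 hv.1
      have i4 := hI v t' (G.intersect_symm x1) (hv.1.trans h)
      linarith
    · have i3 := hI t' v x1 hv.2
      have i4 := hI t v (G.intersect_symm x2) (h.trans hv.2)
      linarith
  exact ⟨f, hf, fun t t' h => (hall t t' h).1, fun t t' h => (hall t t' h).2⟩

end PeriodicPlaneGraph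

/-! ### Lifts of globally monotone maps -/

theorem angleLift_eq_sub {x y : ℝ} {a b : Real.Angle} (hx : (x : Real.Angle) = a)
    (hy : (y : Real.Angle) = b) (hab : a ≠ b) (hle : x ≤ y) (hle' : y ≤ x + 2 * Real.pi) :
    angleLift (b - a) = y - x := by
  rw [← hx, ← hy, ← Real.Angle.coe_sub]
  refine angleLift_coe (by linarith) (lt_of_le_of_ne (by linarith) fun h => hab ?_)
  rw [← hx, ← hy, show y = x + 2 * Real.pi by linarith, Real.Angle.coe_add,
    Real.Angle.coe_two_pi, add_zero]

theorem angleLift_add_of_cyclicallyOrdered {a b c : Real.Angle} (h : CyclicallyOrdered ![a, b, c])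
    (hab : a ≠ b) (hbc : b ≠ c) (hac : a ≠ c) :
    angleLift (c - a) = angleLift (b - a) + angleLift (c - b) := by
  obtain ⟨θ, hmono, hle, hθ⟩ := h
  have h01 : θ 0 ≤ θ 1 := hmono (by decide)
  have h12 : θ 1 ≤ θ 2 := hmono (by decide)
  have e0 : (θ 0 : Real.Angle) = a := hθ 0
  have e1 : (θ 1 : Real.Angle) = b := hθ 1
  have e2 : (θ 2 : Real.Angle) = c := hθ 2
  rw [angleLift_eq_sub e0 e2 hac (h01.trans h12) (hle 0 2),
    angleLift_eq_sub e0 e1 hab h01 (hle 0 1), angleLift_eq_sub e1 e2 hbc h12 (hle 1 2)]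
  ring

namespace PeriodicPlaneGraph

variable {E : Type*} [AddAction (ℤ × ℤ) E] {G : PeriodicPlaneGraph E} {z : ℤ × ℤ}
  {α : G.TrainTrack → Real.Angle}

theorem cyclicallyOrdered_three (hα : CyclicMonotone G.globalOrder α) {t₁ t₂ t₃ : G.TrainTrack}
    (h : G.globalOrder t₁ t₂ t₃) : CyclicallyOrdered ![α t₁, α t₂, α t₃] := by
  have := hα 3 ![t₁, t₂, t₃] (by
    intro i j k hij hjk
    fin_cases i <;> fin_cases j <;> fin_cases k <;> simp at hij hjk ⊢
    exact h)
  convert this using 1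
  funext i
  fin_cases i <;> rfl

/-- If `t` and `t'` had the same angle, one of the two arcs between them would be degenerate, and
`u` or `v` in that arc would share this angle. -/
theorem ne_of_separating (hα : α ∈ G.X') {t u t' v : G.TrainTrack}
    (h1 : 0 < latticeDet (G.homologyClass t) (G.homologyClass u))
    (h2 : 0 < latticeDet (G.homologyClass u) (G.homologyClass t'))
    (h3 : 0 < latticeDet (G.homologyClass t') (G.homologyClass v))
    (h4 : 0 < latticeDet (G.homologyClass v) (G.homologyClass t))
    (hu : α t ≠ α u) (hv : α t' ≠ α v) : α t ≠ α t' := by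
  intro heq
  obtain ⟨θ, hmono, hle, hθ⟩ := hα.1 4 ![t, u, t', v] (by
    intro i j k hij hjk
    fin_cases i <;> fin_cases j <;> fin_cases k <;> simp at hij hjk ⊢
    exacts [.inl ⟨h1, h2⟩, .inr (.inr ⟨h4, h1⟩), .inr (.inl ⟨h3, h4⟩), .inl ⟨h2, h3⟩])
  have h01 : θ 0 ≤ θ 1 := hmono (by decide)
  have h12 : θ 1 ≤ θ 2 := hmono (by decide)
  have h23 : θ 2 ≤ θ 3 := hmono (by decide)
  have h30 := hle 0 3
  have e0 : (θ 0 : Real.Angle) = α t := hθ 0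
  have e1 : (θ 1 : Real.Angle) = α u := hθ 1
  have e2 : (θ 2 : Real.Angle) = α t' := hθ 2
  have e3 : (θ 3 : Real.Angle) = α v := hθ 3
  by_cases h : θ 2 < θ 0 + 2 * Real.pi
  · have := eq_of_coe_eq (e0.trans (heq.trans e2.symm)) (by linarith [Real.pi_pos]) (by linarith)
    exact hu (by rw [← e0, ← e1, show θ 0 = θ 1 by linarith])
  · exact hv (by rw [← e2, ← e3, show θ 2 = θ 3 by linarith])

theorem ne_of_mem_X' (hG : G.IsMinimal) (hz : G.IsGeneric z) (hα : α ∈ G.X') {t t' : G.TrainTrack}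
    (hk : G.key z t ≠ G.key z t') : α t ≠ α t' := by
  by_cases hI : G.Intersect t t'
  · exact hα.2 _ _ hI
  · obtain ⟨u, v, h1, h2, h3, h4⟩ := exists_separating hG hz hk hI
    exact ne_of_separating hα h1 h2 h3 h4
      (hα.2 _ _ (intersect_of_latticeDet_ne_zero hG h1.ne'))
      (hα.2 _ _ (intersect_of_latticeDet_ne_zero hG h3.ne'))

theorem angleLift_add (hG : G.IsMinimal) (hz : G.IsGeneric z) (hα : α ∈ G.X')
    {s t u : G.TrainTrack} (h1 : G.key z s < G.key z t) (h2 : G.key z t < G.key z u) :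
    angleLift (α u - α s) = angleLift (α t - α s) + angleLift (α u - α t) :=
  angleLift_add_of_cyclicallyOrdered
    (cyclicallyOrdered_three hα.1 ((globalOrder_iff hz _ _ _).2 (.inl ⟨h1, h2⟩)))
    (ne_of_mem_X' hG hz hα h1.ne) (ne_of_mem_X' hG hz hα h2.ne)
    (ne_of_mem_X' hG hz hα (h1.trans h2).ne)

/-- Angles in `[0, 2π)` between train-tracks of increasing keys are additive by `angleLift_add`, so
the lift can be measured from a train-track `m` of smallest key. -/
theorem exists_isLift_of_mem_X' (hG : G.IsMinimal) (hz : G.IsGeneric z) (hα : α ∈ G.X') :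
    ∃ f, G.IsLift z α f := by
  classical
  obtain ⟨e⟩ := G.nonempty
  obtain ⟨_, ⟨m, rfl⟩, hm⟩ := Set.exists_min_image _ id (finite_range_key (G := G) z)
    ⟨_, ⟨G.track (e, .white), rfl⟩⟩
  have hm : ∀ t, G.key z m ≤ G.key z t := fun t => hm _ ⟨t, rfl⟩
  obtain ⟨u, v, hmu, huv⟩ : ∃ u v, G.key z m < G.key z u ∧ G.key z u < G.key z v := by
    obtain ⟨⟨u, hu⟩, v, hv⟩ := exists_track_of_sides hG hz m
    have h : CyclicLt (G.key z m) (G.key z u) (G.key z v) :=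
      (globalOrder_iff hz _ _ _).1 (.inr (.inr ⟨hv, hu⟩))
    rcases h with h | h | h
    · exact ⟨u, v, h⟩
    · exact absurd h.2 (hm v).not_gt
    · exact absurd h.1 (hm v).not_gt
  -- Train-tracks parallel to `m` may have other angles than `m` and cannot be measured from it;
  -- they are measured backwards from `u`, which has a larger key.
  set d : G.TrainTrack → ℝ := fun t => if G.key z t = G.key z m then -angleLift (α u - α t)
    else angleLift (α t - α m) - angleLift (α u - α m) with hd
  have hdcoe : ∀ t, (d t : Real.Angle) = α t - α u := by
    intro t
    simp only [hd]
    split_ifs with h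
    · rw [Real.Angle.coe_neg, coe_angleLift, neg_sub]
    · rw [Real.Angle.coe_sub, coe_angleLift, coe_angleLift, sub_sub_sub_cancel_right]
  have hadd : ∀ {s t u : G.TrainTrack}, G.key z s < G.key z t → G.key z t < G.key z u →
      angleLift (α u - α s) = angleLift (α t - α s) + angleLift (α u - α t) := fun h1 h2 =>
    angleLift_add hG hz hα h1 h2
  have hdiff : ∀ t t', G.key z t < G.key z t' → d t' - d t = angleLift (α t' - α t) := by
    intro t t' h
    have hmt' : G.key z m < G.key z t' := (hm t).trans_lt h
    simp only [hd]
    rw [if_neg hmt'.ne']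
    split_ifs with h0
    · have htu : G.key z t < G.key z u := by rw [h0]; exact hmu
      rcases lt_trichotomy (G.key z t') (G.key z u) with h1 | h1 | h1
      · linarith [hadd h h1, hadd hmt' h1]
      -- When `t'` is parallel to `u`, both are compared with `v`, whose key is larger.
      · have h2 : G.key z t' < G.key z v := h1.trans_lt huv
        linarith [hadd h h2, hadd hmt' h2, hadd htu huv, hadd hmu huv]
      · linarith [hadd htu h1, hadd hmu h1]
    · linarith [hadd (lt_of_le_of_ne (hm t) (Ne.symm h0)) h]
  refine ⟨fun t => d t + angleLift (α u), fun t => ?_, fun t t' h => ?_, fun t t' h => ?_⟩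
  · rw [Real.Angle.coe_add, hdcoe, coe_angleLift]; abel
  · have h1 := hdiff t t' h
    have h2 := angleLift_pos (sub_ne_zero.2 (ne_of_mem_X' hG hz hα h.ne'))
    linarith
  · have h1 := hdiff t t' h
    have h2 := angleLift_lt (α t' - α t)
    linarith

/-! ### Recovering the global cyclic order -/

/-- Three distinct angles in the reverse cyclic order would turn twice: the lifted differences fail
to add up, by exactly `2π`. -/
theorem not_cyclicallyOrdered {x₁ x₂ x₃ : ℝ} (h : CyclicLt x₁ x₃ x₂)
    (h12 : |x₁ - x₂| < 2 * Real.pi) (h13 : |x₁ - x₃| < 2 * Real.pi)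
    (h23 : |x₂ - x₃| < 2 * Real.pi) :
    ¬ CyclicallyOrdered ![(x₁ : Real.Angle), (x₂ : Real.Angle), (x₃ : Real.Angle)] := by
  intro hc
  rw [abs_lt] at h12 h13 h23
  have hne : ∀ {x y : ℝ}, x ≠ y → x - y < 2 * Real.pi → y - x < 2 * Real.pi →
      (x : Real.Angle) ≠ y := fun h h1 h2 heq => h (eq_of_coe_eq heq h1 h2)
  have n12 : x₁ ≠ x₂ := by
    rcases h with h | h | h
    exacts [(h.1.trans h.2).ne, h.2.ne', h.1.ne']
  have n23 : x₂ ≠ x₃ := by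
    rcases h with h | h | h
    exacts [h.2.ne', h.1.ne', (h.1.trans h.2).ne]
  have n13 : x₁ ≠ x₃ := by
    rcases h with h | h | h
    exacts [h.1.ne, (h.1.trans h.2).ne', h.2.ne]
  have := angleLift_add_of_cyclicallyOrdered hc (hne n12 (by linarith) (by linarith))
    (hne n23 (by linarith) (by linarith)) (hne n13 (by linarith) (by linarith))
  have hlift : ∀ {x y : ℝ}, x < y → y - x < 2 * Real.pi →
      angleLift ((y : Real.Angle) - x) = y - x := fun h1 h2 => by
    rw [← Real.Angle.coe_sub]; exact angleLift_coe (by linarith) h2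
  have hlift' : ∀ {x y : ℝ}, y < x → x - y < 2 * Real.pi →
      angleLift ((y : Real.Angle) - x) = y - x + 2 * Real.pi := fun {x y} h1 h2 => by
    rw [← Real.Angle.coe_sub, ← add_zero ((y - x : ℝ) : Real.Angle), ← Real.Angle.coe_two_pi,
      ← Real.Angle.coe_add]
    exact angleLift_coe (by linarith) (by linarith)
  rcases h with ⟨h1, h2⟩ | ⟨h1, h2⟩ | ⟨h1, h2⟩
  · rw [hlift h1 (by linarith), hlift (h1.trans h2) (by linarith),
      hlift' h2 (by linarith)] at this
    linarith [Real.pi_pos]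
  · rw [hlift' (h1.trans h2) (by linarith), hlift' h2 (by linarith),
      hlift' h1 (by linarith)] at this
    linarith [Real.pi_pos]
  · rw [hlift h2 (by linarith), hlift' h1 (by linarith),
      hlift (h1.trans h2) (by linarith)] at this
    linarith [Real.pi_pos]

theorem exists_key_gap (z : ℤ × ℤ) : ∃ δ > 0, ∀ t t' : G.TrainTrack, G.key z t < G.key z t' →
    G.key z t + δ ≤ G.key z t' := by
  have hfin := ((finite_range_key (G := G) z).prod (finite_range_key (G := G) z)).image
    fun p => p.2 - p.1
  have hfin' := hfin.subset (Set.inter_subset_left (t := Set.Ioi (0 : ℝ)))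
  rcases Set.eq_empty_or_nonempty (((fun p : ℝ × ℝ => p.2 - p.1) ''
      Set.range (G.key z) ×ˢ Set.range (G.key z)) ∩ Set.Ioi (0 : ℝ)) with h | h
  · refine ⟨1, one_pos, fun t t' ht => ?_⟩
    have : G.key z t' - G.key z t ∈ (∅ : Set ℝ) := by
      rw [← h]
      exact ⟨⟨(G.key z t, G.key z t'), ⟨⟨t, rfl⟩, ⟨t', rfl⟩⟩, rfl⟩, sub_pos.2 ht⟩
    exact this.elim
  · obtain ⟨δ, hδ, hmin⟩ := Set.exists_min_image _ id hfin' h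
    refine ⟨δ, hδ.2, fun t t' ht => ?_⟩
    have := hmin (G.key z t' - G.key z t)
      ⟨⟨(G.key z t, G.key z t'), ⟨⟨t, rfl⟩, ⟨t', rfl⟩⟩, rfl⟩, sub_pos.2 ht⟩
    simp only [id] at this
    linarith

/-- A perturbation of the directions is a lift of an angle map. -/
theorem exists_isLift_perturbation (z : ℤ × ℤ) : ∃ ε > 0, ε ≤ Real.pi / 2 ∧ (∀ t t' : G.TrainTrack,
      G.key z t < G.key z t' → G.key z t / 2 + ε < G.key z t' / 2) ∧
    ∀ g : G.TrainTrack → ℝ, (∀ t, 0 ≤ g t ∧ g t ≤ 1) →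
      G.IsLift z (fun t => ((G.key z t / 2 + ε * g t : ℝ) : Real.Angle))
        fun t => G.key z t / 2 + ε * g t := by
  obtain ⟨δ, hδ, hgap⟩ := exists_key_gap (G := G) z
  have hpi := Real.pi_pos
  refine ⟨min (δ / 4) (Real.pi / 2), lt_min (by linarith) (by linarith), min_le_right _ _,
    fun t t' h => ?_, fun g hg => ⟨fun t => rfl, fun t t' h => ?_, fun t t' h => ?_⟩⟩
  · linarith [hgap t t' h, min_le_left (δ / 4) (Real.pi / 2)]
  all_goals
    set ε := min (δ / 4) (Real.pi / 2) with hε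
    have hε0 : 0 < ε := lt_min (by linarith) (by linarith)
    have h1 : ε ≤ δ / 4 := min_le_left _ _
    have h2 : ε ≤ Real.pi / 2 := min_le_right _ _
    have h3 := hgap t t' h
    have h4 := key_sub_key_lt (G := G) z t' t
    have h5 : 0 ≤ ε * g t := mul_nonneg hε0.le (hg t).1
    have h6 : 0 ≤ ε * g t' := mul_nonneg hε0.le (hg t').1
    have h7 : ε * g t ≤ ε := mul_le_of_le_one_right hε0.le (hg t).2
    have h8 : ε * g t' ≤ ε := mul_le_of_le_one_right hε0.le (hg t').2
    linarith

/-- If the relation fails, distinct keys are already in the reverse cyclic order. When keys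
coincide, the train-tracks are moved independently within `Y` so as to produce this reverse order.
-/
theorem globalOrder_of_forall (hG : G.IsMinimal) (hz : G.IsGeneric z) {t₁ t₂ t₃ : G.TrainTrack}
    (h12 : t₁ ≠ t₂) (h23 : t₂ ≠ t₃) (h13 : t₁ ≠ t₃)
    (h : ∀ α ∈ G.Y, CyclicallyOrdered ![α t₁, α t₂, α t₃]) : G.globalOrder t₁ t₂ t₃ := by
  classical
  rw [globalOrder_iff hz]
  by_contra hnot
  obtain ⟨ε, hε, hεpi, hlt, hlift⟩ := exists_isLift_perturbation (G := G) z
  have key : ∀ a₁ a₂ a₃ : ℝ, (0 ≤ a₁ ∧ a₁ ≤ 1) → (0 ≤ a₂ ∧ a₂ ≤ 1) → (0 ≤ a₃ ∧ a₃ ≤ 1) →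
      ¬ CyclicLt (G.key z t₁ / 2 + ε * a₁) (G.key z t₃ / 2 + ε * a₃)
        (G.key z t₂ / 2 + ε * a₂) := by
    intro a₁ a₂ a₃ h1 h2 h3 hc
    have L := hlift (fun t => if t = t₁ then a₁ else if t = t₂ then a₂ else a₃) fun t => by
      split_ifs <;> assumption
    have hY := h _ (L.mem_Y hG hz)
    simp only [if_true, if_neg h12.symm, if_neg h23.symm, if_neg h13.symm] at hY
    have hpi := Real.pi_pos
    have bd : ∀ t t' : G.TrainTrack, ∀ a b : ℝ, (0 ≤ a ∧ a ≤ 1) → (0 ≤ b ∧ b ≤ 1) →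
        |G.key z t / 2 + ε * a - (G.key z t' / 2 + ε * b)| < 2 * Real.pi := by
      intro t t' a b ha hb
      have k1 := key_sub_key_lt (G := G) z t t'
      have k2 := key_sub_key_lt (G := G) z t' t
      have k3 : 0 ≤ ε * a := mul_nonneg hε.le ha.1
      have k4 : 0 ≤ ε * b := mul_nonneg hε.le hb.1
      have k5 : ε * a ≤ ε := mul_le_of_le_one_right hε.le ha.2
      have k6 : ε * b ≤ ε := mul_le_of_le_one_right hε.le hb.2
      rw [abs_lt]
      constructor <;> linarith
    exact not_cyclicallyOrdered hc (bd _ _ _ _ h1 h2) (bd _ _ _ _ h1 h3) (bd _ _ _ _ h2 h3) hY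
  -- These two perturbations break all ties: the first puts `t₁` before `t₃` before `t₂`, which
  -- serves every tie but that of `t₁` and `t₂` alone; the second puts `t₂` before `t₁`.
  have k1 := key 0 1 (1 / 2) (by norm_num) (by norm_num) (by norm_num)
  have k2 := key (1 / 2) 0 0 (by norm_num) (by norm_num) (by norm_num)
  have l12 := hlt t₁ t₂
  have l21 := hlt t₂ t₁
  have l13 := hlt t₁ t₃
  have l31 := hlt t₃ t₁
  have l23 := hlt t₂ t₃
  have l32 := hlt t₃ t₂
  simp only [CyclicLt] at k1 k2 hnot
  rcases lt_trichotomy (G.key z t₁) (G.key z t₂) with c12 | c12 | c12 <;>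
    rcases lt_trichotomy (G.key z t₂) (G.key z t₃) with c23 | c23 | c23 <;>
    rcases lt_trichotomy (G.key z t₁) (G.key z t₃) with c13 | c13 | c13
  all_goals grind

theorem distinct_of_globalOrder (hz : G.IsGeneric z) {t₁ t₂ t₃ : G.TrainTrack}
    (h : G.globalOrder t₁ t₂ t₃) : t₁ ≠ t₂ ∧ t₂ ≠ t₃ ∧ t₁ ≠ t₃ := by
  rw [globalOrder_iff hz] at h
  unfold CyclicLt at h
  refine ⟨?_, ?_, ?_⟩ <;> rintro rfl <;> grind

theorem X_eq_X' (hG : G.IsMinimal) : G.X = G.X' := by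
  obtain ⟨z, hz⟩ : ∃ z, G.IsGeneric z := exists_generic hG
  refine Set.Subset.antisymm (fun α hα => ⟨hα.1, fun t t' h => hα.2 t t' (.inl h)⟩) fun α hα => ?_
  obtain ⟨f, hf⟩ := exists_isLift_of_mem_X' hG hz hα
  exact hf.mem_X hG hz

theorem Y_eq_X' (hG : G.IsMinimal) : G.Y = G.X' := by
  obtain ⟨z, hz⟩ : ∃ z, G.IsGeneric z := exists_generic hG
  refine Set.Subset.antisymm (fun α hα => ?_) fun α hα => ?_
  · obtain ⟨f, hf⟩ := exists_isLift_of_mem_Y hG hz hα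
    rw [← X_eq_X' hG]
    exact hf.mem_X hG hz
  · obtain ⟨f, hf⟩ := exists_isLift_of_mem_X' hG hz hα
    exact hf.mem_Y hG hz

theorem globalOrder_iff_forall_mem_Y (hG : G.IsMinimal) (t₁ t₂ t₃ : G.TrainTrack) :
    G.globalOrder t₁ t₂ t₃ ↔ (t₁ ≠ t₂ ∧ t₂ ≠ t₃ ∧ t₁ ≠ t₃ ∧
      ∀ α ∈ G.Y, CyclicallyOrdered ![α t₁, α t₂, α t₃]) := by
  obtain ⟨z, hz⟩ : ∃ z, G.IsGeneric z := exists_generic hG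
  constructor
  · intro h
    obtain ⟨h1, h2, h3⟩ := distinct_of_globalOrder hz h
    refine ⟨h1, h2, h3, fun α hα => ?_⟩
    rw [Y_eq_X' hG] at hα
    exact cyclicallyOrdered_three hα.1 h
  · rintro ⟨h1, h2, h3, h⟩
    exact globalOrder_of_forall hG hz h1 h2 h3 h

end PeriodicPlaneGraph

theorem corollary3p8 {E : Type*} [AddAction (ℤ × ℤ) E] (G : PeriodicPlaneGraph E)
    (hG : G.IsMinimal) :
    G.X = G.X' ∧ G.Y = G.X' ∧
      ∀ t₁ t₂ t₃ : G.TrainTrack, G.globalOrder t₁ t₂ t₃ ↔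
        (t₁ ≠ t₂ ∧ t₂ ≠ t₃ ∧ t₁ ≠ t₃ ∧
          ∀ α ∈ G.Y, CyclicallyOrdered ![α t₁, α t₂, α t₃]) :=
  ⟨PeriodicPlaneGraph.X_eq_X' hG, PeriodicPlaneGraph.Y_eq_X' hG,
    PeriodicPlaneGraph.globalOrder_iff_forall_mem_Y hG⟩
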